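/- Let $n\ge 3$, let $R_0\ge 0$, let $\mathcal K\subset\{x\in\mathbb R^n:|x|<R_0\}$ be compact (possibly empty), and let $M=[0,\infty)\times(\mathbb R^n\setminus\mathcal K)$, with coordinates $(x^0,\dots,x^n)=(t,x)$, $r=|x|$, $\langle r\rangle=(1+r^2)^{1/2}$, $\partial=(\partial_t,\nabla_x)$. All norms $L^q_tL^2_x$ and $L^\infty_{t,x}$ are taken over $M$ with respect to $dt\,dx$, and $H^k$ is the Sobolev space of $\mathbb R^n\setminus\mathcal K$. Write $\|\partial^{\le k}u\|_A=\sum_{|a|\le k}\|\partial^a u\|_A$, the sum being over space-time multi-indices $a$. Fix a smooth inhomogeneous dyadic partition $(\phi_j)_{j\ge0}$ of $\mathbb R^n$: $\sum_j\phi_j^2=1$, $\phi_0$ supported in $|x|\le2$ and $\phi_j$ in $2^{j-1}\le|x|\le2^{j+1}$ for $j\ge1$; put $\|u\|_{\ell^s_q(A)}=\big\|\big(2^{js}\|\phi_ju\|_A\big)_{j\ge 0}\big\|_{\ell^q}$. Let $g$ be a smooth Lorentzian metric on $M$ of signature $(-,+,\dots,+)$ that is asymptotically flat in the following sense. (H1)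 $g=m+g_1+g_2$, where $m=\mathrm{diag}(-1,1,\dots,1)$, $g_1$ and $g_2$ are smooth on $M$, $g_1$ is radial, that is, $g_1=\tilde g_{00}(t,r)dt^2+2\tilde g_{01}(t,r)dt\,dr+\tilde g_{11}(t,r)dr^2+\tilde g_{22}(t,r)r^2d\omega^2$, and for $j=1,2$, every multi-index $a$ and all components, $\|\partial^a g_{j,\alpha\beta}\|_{\ell^{|a|+j-1}_1L^\infty_{t,x}}<\infty$. Let $\Box_g=|g|^{-1/2}\partial_\alpha\big(g^{\alpha\beta}|g|^{1/2}\partial_\beta\,\cdot\,\big)$ with $|g|=-\det(g_{\alpha\beta})$. Let $\mathcal S$ be a class of functions on $M$ (for example all functions, or those satisfying a given boundary condition on $\partial\mathcal K$). Let $R_1\ge R_0$, $N\in\mathbb R$, and let $\psi_{R_1}\ge0$ be a smooth function on $\mathbb R^n$ with $\psi_{R_1}=1$ for $r>R_1+1$ and $\psi_{R_1}=0$ for $r<R_1$. Define $$\|u\|_{LE_g}=\|\partial u\|_{L^\infty_tL^2_x}+\|\psi_{R_1}\partial u\|_{\ell^{-1/2}_\infty L^2_tL^2_x}+\|u\|_{\ell^{-3/2}_\infty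 L^2_tL^2_x},$$ $$D_k(u,F)=\|u(0,\cdot)\|_{H^{k+1}}+\|\partial_tu(0,\cdot)\|_{H^k}+\|\partial^{\le k}F\|_{L^1_tL^2_x}.$$ Suppose that the following weak local energy bound holds. (H2') For every $k\ge0$ there is a constant $C$ such that every $u\in\mathcal S$ that is smooth on $M$, with $\Box_gu=F$, satisfies $$\|\partial\partial^{\le k}u\|_{L^\infty_tL^2_x}+\|\langle r\rangle^{-N}\partial\partial^{\le k}u\|_{L^2_tL^2_x(r\ge R_1)}+\|\langle r\rangle^{-N-1}\partial^{\le k}u\|_{L^2_tL^2_x}\le C\,D_k(u,F).$$ Then the local energy hypothesis holds, with the same $R_1$. (H2) For every $k\ge0$ there is a constant $C$ such that every $u\in\mathcal S$ that is smooth on $M$, with $\Box_gu=F$, satisfies $$\|\partial^{\le k}u\|_{LE_g}\le C\,D_k(u,F).$$ (Both sides of these inequalities may be $+\infty$.) -/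

import Mathlib

open MeasureTheory
open scoped ENNReal NNReal ContDiff

noncomputable section

namespace AFWave

/-- Space `ℝⁿ`. -/
abbrev Space (n : ℕ) := EuclideanSpace ℝ (Fin n)

/-- Points `(t, x)` of `ℝ × ℝⁿ`. -/
abbrev Spacetime (n : ℕ) := ℝ × Space n

variable {n : ℕ}

/-- The region `M = [0, ∞) × (ℝⁿ \ K)`. -/
def region (K : Set (Space n)) : Set (Spacetime n) := Set.Ici (0 : ℝ) ×ˢ Kᶜ

/-- Coordinate directions: index `0` is time, index `i + 1` is the `i`-th space direction. -/
def dir : Fin (n + 1) → Spacetime n :=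
  Fin.cases (1, 0) (fun i => (0, EuclideanSpace.single i 1))

/-- `∂_α f` on the set `M` (one-sided in time on the initial slice). -/
def pd (M : Set (Spacetime n)) (α : Fin (n + 1)) (f : Spacetime n → ℝ) : Spacetime n → ℝ :=
  fun p => fderivWithin ℝ f M p (dir α)

/-- `∂^a f = ∂_0^{a 0} ∂_1^{a 1} ⋯ ∂_n^{a n} f` for a space-time multi-index `a`. -/
def mpd (M : Set (Spacetime n)) (a : Fin (n + 1) → ℕ) (f : Spacetime n → ℝ) :
    Spacetime n → ℝ :=
  (List.finRange (n + 1)).foldr (fun α h => (pd M α)^[a α] h) f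

/-- `∇^b f` for a spatial multi-index `b` and a function `f` of `x` alone. -/
def spd (b : Fin n → ℕ) (f : Space n → ℝ) : Space n → ℝ :=
  (List.finRange n).foldr
    (fun i h => (fun w : Space n → ℝ =>
      fun x => fderiv ℝ w x (EuclideanSpace.single i 1))^[b i] h) f

/-- Sum over all multi-indices `a ∈ ℕ^d` with `|a| ≤ k`. -/
def sumUpTo (d k : ℕ) (G : (Fin d → ℕ) → ℝ≥0∞) : ℝ≥0∞ :=
  ∑ j ∈ Finset.range (k + 1), ∑ a ∈ (Finset.univ : Finset (Fin d)).piAntidiag j, G a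

/-! ### Norms -/

/-- The `L²` norm over `ℝⁿ \ K`. -/
def normL2 (K : Set (Space n)) (f : Space n → ℝ) : ℝ≥0∞ :=
  eLpNorm f 2 (volume.restrict Kᶜ)

/-- The Sobolev norm `H^k(ℝⁿ \ K)` of a smooth function. -/
def normH (K : Set (Space n)) (k : ℕ) (f : Space n → ℝ) : ℝ≥0∞ :=
  sumUpTo n k fun b => normL2 K (spd b f)

/-- The mixed norm `L^q_t L²_x` over `[0, ∞) × (ℝⁿ \ K)`. -/
def normLqL2 (K : Set (Space n)) (q : ℝ≥0∞) (f : Spacetime n → ℝ) : ℝ≥0∞ :=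
  eLpNorm (fun t : ℝ => normL2 K fun x => f (t, x)) q (volume.restrict (Set.Ici 0))

/-- `φ_0, φ_1, φ_2, …` is an inhomogeneous smooth dyadic partition in the space variable:
`∑ φ_j² = 1`, with `φ_0` living in `|x| ≤ 2` and `φ_j` in `2^(j-1) ≤ |x| ≤ 2^(j+1)`. -/
structure IsDyadicPartition (φ : ℕ → Space n → ℝ) : Prop where
  smooth : ∀ j, ContDiff ℝ ∞ (φ j)
  zero_of_lt : ∀ j x, (2 : ℝ) ^ (j + 1) < ‖x‖ → φ j x = 0
  zero_of_gt : ∀ j x, ‖x‖ < (2 : ℝ) ^ j → φ (j + 1) x = 0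
  sum_sq : ∀ x, HasSum (fun j => φ j x ^ 2) 1

/-- The dyadic weight `2^(j s)`. -/
def dyad (j : ℕ) (s : ℝ) : ℝ≥0∞ := ENNReal.ofReal ((2 : ℝ) ^ ((j : ℝ) * s))

/-- The norm `ℓ^s_1 L^∞_{t,x}` over `M`. -/
def normEll1Linf (φ : ℕ → Space n → ℝ) (K : Set (Space n)) (s : ℝ) (f : Spacetime n → ℝ) :
    ℝ≥0∞ :=
  ∑' j : ℕ, dyad j s * eLpNorm (fun p => φ j p.2 * f p) ⊤ (volume.restrict (region K))

/-- The norm `ℓ^s_∞ L²_t L²_x` over `M`. -/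
def normEllInfL2 (φ : ℕ → Space n → ℝ) (K : Set (Space n)) (s : ℝ) (f : Spacetime n → ℝ) :
    ℝ≥0∞ :=
  ⨆ j : ℕ, dyad j s * normLqL2 K 2 fun p => φ j p.2 * f p

/-! ### The metric -/

/-- A field of `(n+1) × (n+1)` matrices, i.e. the components `g_{αβ}(t, x)`. -/
abbrev TensorField (n : ℕ) := Spacetime n → Matrix (Fin (n + 1)) (Fin (n + 1)) ℝ

/-- The Minkowski matrix `diag(-1, 1, …, 1)`. -/
def minkowski (n : ℕ) : Matrix (Fin (n + 1)) (Fin (n + 1)) ℝ :=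
  Matrix.diagonal (Fin.cons (-1) fun _ => 1)

/-- All components are smooth on `M`. -/
def SmoothTensor (K : Set (Space n)) (g : TensorField n) : Prop :=
  ∀ α β, ContDiffOn ℝ ∞ (fun p => g p α β) (region K)

/-- `g` is a smooth Lorentzian metric on `M`: symmetric, of signature `(-, +, …, +)`. -/
def IsLorentzianMetric (K : Set (Space n)) (g : TensorField n) : Prop :=
  SmoothTensor K g ∧ ∀ p ∈ region K, (g p).IsSymm ∧
    ∃ P : Matrix (Fin (n + 1)) (Fin (n + 1)) ℝ,
      IsUnit P.det ∧ P.transpose * g p * P = minkowski n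

/-- `h = h₀₀ dt² + 2 h₀₁ dt dr + h₁₁ dr² + h₂₂ r² dω²` with coefficients depending on `(t, r)`
only; recall `dr = ∑ (x_i / r) dx_i` and `r² dω² = ∑ dx_i² - dr²`. -/
def IsRadialTensor (K : Set (Space n)) (h : TensorField n) : Prop :=
  ∃ h00 h01 h11 h22 : ℝ → ℝ → ℝ, ∀ (t : ℝ) (x : Space n), (t, x) ∈ region K → x ≠ 0 →
    h (t, x) 0 0 = h00 t ‖x‖ ∧
    (∀ i : Fin n, h (t, x) 0 i.succ = h01 t ‖x‖ * (x i / ‖x‖) ∧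
      h (t, x) i.succ 0 = h01 t ‖x‖ * (x i / ‖x‖)) ∧
    ∀ i j : Fin n, h (t, x) i.succ j.succ =
      h11 t ‖x‖ * (x i / ‖x‖ * (x j / ‖x‖)) +
      h22 t ‖x‖ * ((if i = j then 1 else 0) - x i / ‖x‖ * (x j / ‖x‖))

/-- For every multi-index `a` and all components, `‖∂^a h_{αβ}‖` is finite in
`ℓ^{|a| + σ}_1 L^∞_{t,x}`. -/
def DecaysAtRate (φ : ℕ → Space n → ℝ) (K : Set (Space n)) (σ : ℕ) (h : TensorField n) : Prop :=
  ∀ (a : Fin (n + 1) → ℕ) (α β : Fin (n + 1)),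
    normEll1Linf φ K (((∑ i, a i) + σ : ℕ) : ℝ) (mpd (region K) a fun p => h p α β) < ⊤

/-- Asymptotic flatness: `g = m + g₁(t, r) + g₂(t, x)` with `g₁` radial, and
`‖∂^a g_j‖_{ℓ^{|a| + j - 1}_1 L^∞} < ∞` for `j = 1, 2` and every `a`. -/
def IsAsymptoticallyFlat (φ : ℕ → Space n → ℝ) (K : Set (Space n)) (g : TensorField n) : Prop :=
  ∃ g₁ g₂ : TensorField n,
    (∀ p ∈ region K, g p = minkowski n + g₁ p + g₂ p) ∧
    SmoothTensor K g₁ ∧ SmoothTensor K g₂ ∧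
    IsRadialTensor K g₁ ∧ DecaysAtRate φ K 0 g₁ ∧ DecaysAtRate φ K 1 g₂

/-- The d'Alembertian `□_g u = |g|^{-1/2} ∂_α (g^{αβ} |g|^{1/2} ∂_β u)`, `|g| = -det g`. -/
def box (K : Set (Space n)) (g : TensorField n) (u : Spacetime n → ℝ) : Spacetime n → ℝ :=
  fun p => (Real.sqrt (-(g p).det))⁻¹ * ∑ α, pd (region K) α
    (fun q => ∑ β, (g q)⁻¹ α β * Real.sqrt (-(g q).det) * pd (region K) β u q) p

/-- `u` is a (smooth, classical) solution of `□_g u = F` on `M`. -/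
def IsSolution (K : Set (Space n)) (g : TensorField n) (u F : Spacetime n → ℝ) : Prop :=
  ContDiffOn ℝ ∞ u (region K) ∧ ∀ p ∈ region K, box K g u p = F p

/-! ### The local energy hypotheses -/

/-- `ψ` is a smooth nonnegative cutoff with `ψ = 1` for `r > R + 1` and `ψ = 0` for `r < R`. -/
structure IsCutoff (R : ℝ) (ψ : Space n → ℝ) : Prop where
  smooth : ContDiff ℝ ∞ ψ
  nonneg : ∀ x, 0 ≤ ψ x
  eq_one : ∀ x, R + 1 < ‖x‖ → ψ x = 1
  eq_zero : ∀ x, ‖x‖ < R → ψ x = 0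

/-- `‖u‖_{LE_g} = ‖∂u‖_{L^∞_t L²_x} + ‖ψ ∂u‖_{ℓ^{-1/2}_∞ L²_t L²_x} + ‖u‖_{ℓ^{-3/2}_∞ L²_t L²_x}`. -/
def normLE (φ : ℕ → Space n → ℝ) (K : Set (Space n)) (ψ : Space n → ℝ) (u : Spacetime n → ℝ) :
    ℝ≥0∞ :=
  (∑ α, normLqL2 K ⊤ (pd (region K) α u)) +
  (∑ α, normEllInfL2 φ K (-1 / 2) fun p => ψ p.2 * pd (region K) α u p) +
  normEllInfL2 φ K (-3 / 2) u

/-- `‖u(0)‖_{H^{k+1}} + ‖∂_t u(0)‖_{H^k} + ‖∂^{≤k} F‖_{L¹_t L²_x}`. -/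
def dataNorm (K : Set (Space n)) (k : ℕ) (u F : Spacetime n → ℝ) : ℝ≥0∞ :=
  normH K (k + 1) (fun x => u (0, x)) + normH K k (fun x => pd (region K) 0 u (0, x)) +
  sumUpTo (n + 1) k fun a => normLqL2 K 1 (mpd (region K) a F)

/-- The left side of the weak local energy bound: `‖∂∂^{≤k}u‖_{L^∞_t L²_x}
+ ‖⟨r⟩^{-N} ∂∂^{≤k}u‖_{L²_t L²_x(r ≥ R₁)} + ‖⟨r⟩^{-N-1} ∂^{≤k}u‖_{L²_t L²_x}`. -/
def weakNorm (K : Set (Space n)) (R₁ N : ℝ) (k : ℕ) (u : Spacetime n → ℝ) : ℝ≥0∞ :=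
  sumUpTo (n + 1) k fun a =>
    (∑ α, normLqL2 K ⊤ (pd (region K) α (mpd (region K) a u))) +
    (∑ α, normLqL2 K 2 (Set.indicator {p | R₁ ≤ ‖p.2‖} fun p =>
      (1 + ‖p.2‖ ^ 2) ^ (-N / 2) * pd (region K) α (mpd (region K) a u) p)) +
    normLqL2 K 2 fun p => (1 + ‖p.2‖ ^ 2) ^ ((-N - 1) / 2) * mpd (region K) a u p

/-- The local energy hypothesis for the solutions in the class `𝒮`. -/
def LocalEnergy (φ : ℕ → Space n → ℝ) (K : Set (Space n)) (g : TensorField n)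
    (𝒮 : Set (Spacetime n → ℝ)) (ψ : Space n → ℝ) : Prop :=
  ∀ k : ℕ, ∃ C : ℝ≥0, ∀ u ∈ 𝒮, ∀ F, IsSolution K g u F →
    (sumUpTo (n + 1) k fun a => normLE φ K ψ (mpd (region K) a u)) ≤ C * dataNorm K k u F

/-- The weak local energy bound, with weights `⟨r⟩^{-N}`, for the solutions in the class `𝒮`. -/
def WeakLocalEnergy (K : Set (Space n)) (g : TensorField n) (𝒮 : Set (Spacetime n → ℝ))
    (R₁ N : ℝ) : Prop :=
  ∀ k : ℕ, ∃ C : ℝ≥0, ∀ u ∈ 𝒮, ∀ F, IsSolution K g u F →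
    weakNorm K R₁ N k u ≤ C * dataNorm K k u F

end AFWave

end

open AFWave

/-!
The weak bound controls solutions for bounded radii, so the local energy norms have to be estimated
for `r` large only. There the metric is a small perturbation of the Minkowski metric and a Morawetz
multiplier applies, even though nothing is known about the geometry near `𝒦`.

Write `ext R = {t > 0, r > R}`. The asymptotic flatness of `g` is condensed into a summable dyadic
profile `c_j` and the weight `λ = ∑_j 2^{-j} c_j |φ_j|`: for `r` large, `g - m` and `g⁻¹ - m` are
`O(r λ)` and all derivatives of `g` and `g⁻¹` up to a given order are `O(λ)`
(`IsAsymptoticallyFlat.exists_symbolMetric`). Radial symmetry of the leading part is not needed for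
this. As `∑ c_j < ∞`, the operator of multiplication by `λ` is small on `ext R` for `R` large: with
`A_j = {2^{j-1} ≤ r ≤ 2^{j+1}}`, the integral of `λ f` over `ext R` is at most `o(1)` times
`sup_j 2^{-j} ∫_{A_j} f` (`lintegral_weight_mul_le`).

By the Leibniz rule the derivatives `w_a = ∂^a u`, `|a| ≤ k`, form a system
`g^{αβ} ∂_α ∂_β w_a = ∂^a F + O(λ ∑_b |∂ w_b|)` (`SymbolMetric.exists_exteriorSystem`). With
`κ = (r² + ρ²)^{-1/2}`, contracting with the multiplier `κ x · ∇w + (n - 1)/2 κ w` gives, for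
`n ≥ 3`, a divergence that dominates `ρ^{-1} (|∂w|² + w²/r²)` on the annulus `r ∼ ρ`, up to
`|g^{αβ} ∂_α ∂_β w| (|∂w|² + w²/r²)^{1/2}` and `λ (|∂w|² + w²/r²)` (`multiplier_positivity`,
`ExteriorSystem.pointwise`). Integrating against a compactly supported cutoff, taking the supremum
over `ρ = 2^j` and absorbing the terms with `λ` (the supremum is finite thanks to the cutoff) bounds
`sup_j 2^{-j} ∫_{A_j} (|∂w|² + w²/r²)` by the pairing of the source with `w`, by the energies of the
time slices, and by the density on a bounded range of radii
(`ExteriorSystem.local_energy_estimate`).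

The three terms on the right are controlled by the data. The slice energies come from the
`L^∞_t L²_x` part of the weak bound and Hardy's inequality (`hardy_slice`); the latter needs the
slices of `u` to be in `L²`, which follows from `u(0) ∈ L²` by integrating `∂_t u`
(`lintegral_slice_sq_ne_top`). The source term is at most `‖∂^{≤k} F‖_{L^1_t L²_x}` times the square
root of the slice energies. On a bounded range of radii the polynomial weights of the weak bound are
comparable to one. The last remark also estimates the local energy norms for bounded radii.
-/

namespace AFWave

noncomputable section

variable {n : ℕ}

/-! ### Partial derivatives on the region -/

section Calculus

variable {K : Set (Space n)}

/-- `f` is smooth on the region `M`, up to the initial slice. -/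
abbrev SmoothOn (K : Set (Space n)) (f : Spacetime n → ℝ) : Prop :=
  ContDiffOn ℝ ∞ f (region K)

lemma uniqueDiffOn_region (hK : IsClosed K) : UniqueDiffOn ℝ (region K) :=
  (uniqueDiffOn_Ici 0).prod hK.isOpen_compl.uniqueDiffOn

lemma region_subset_closure_interior (hK : IsClosed K) :
    region K ⊆ closure (interior (region K)) := by
  rw [region, interior_prod_eq, closure_prod_eq, interior_Ici, closure_Ioi,
    hK.isOpen_compl.interior_eq]
  exact Set.prod_mono le_rfl subset_closure

lemma SmoothOn.diffWithinAt {f : Spacetime n → ℝ} (hf : SmoothOn K f) {p : Spacetime n}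
    (hp : p ∈ region K) : DifferentiableWithinAt ℝ f (region K) p :=
  hf.differentiableOn (by simp) p hp

lemma pd_congr {f g : Spacetime n → ℝ} (h : Set.EqOn f g (region K)) (α : Fin (n + 1)) :
    Set.EqOn (pd (region K) α f) (pd (region K) α g) (region K) := fun p hp => by
  simp only [pd, fderivWithin_congr h (h hp)]

lemma SmoothOn.pd (hK : IsClosed K) {f : Spacetime n → ℝ} (hf : SmoothOn K f)
    (α : Fin (n + 1)) : SmoothOn K (pd (region K) α f) :=
  (hf.fderivWithin (uniqueDiffOn_region hK) (m := ∞) (by simp)).clm_apply contDiffOn_const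

lemma pd_add (hK : IsClosed K) {f g : Spacetime n → ℝ} (hf : SmoothOn K f) (hg : SmoothOn K g)
    (α : Fin (n + 1)) {p : Spacetime n} (hp : p ∈ region K) :
    pd (region K) α (fun q => f q + g q) p = pd (region K) α f p + pd (region K) α g p := by
  simp only [pd]
  rw [fderivWithin_fun_add (uniqueDiffOn_region hK p hp) (hf.diffWithinAt hp)
    (hg.diffWithinAt hp)]
  rfl

lemma pd_mul (hK : IsClosed K) {f g : Spacetime n → ℝ} (hf : SmoothOn K f) (hg : SmoothOn K g)
    (α : Fin (n + 1)) {p : Spacetime n} (hp : p ∈ region K) :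
    pd (region K) α (fun q => f q * g q) p =
      pd (region K) α f p * g p + f p * pd (region K) α g p := by
  simp only [pd]
  rw [fderivWithin_fun_mul (uniqueDiffOn_region hK p hp) (hf.diffWithinAt hp)
    (hg.diffWithinAt hp)]
  simp only [add_apply, smul_apply, smul_eq_mul]
  ring

lemma pd_sum (hK : IsClosed K) {ι : Type*} (s : Finset ι) {f : ι → Spacetime n → ℝ}
    (hf : ∀ i ∈ s, SmoothOn K (f i)) (α : Fin (n + 1)) {p : Spacetime n} (hp : p ∈ region K) :
    pd (region K) α (fun q => ∑ i ∈ s, f i q) p = ∑ i ∈ s, pd (region K) α (f i) p := by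
  simp only [pd]
  rw [fderivWithin_fun_sum (uniqueDiffOn_region hK p hp) fun i hi => (hf i hi).diffWithinAt hp]
  simp

lemma pd_const (c : ℝ) (α : Fin (n + 1)) (p : Spacetime n) :
    pd (region K) α (fun _ => c) p = 0 := by
  simp [pd]

lemma pd_const_mul (hK : IsClosed K) {f : Spacetime n → ℝ} (hf : SmoothOn K f) (c : ℝ)
    (α : Fin (n + 1)) {p : Spacetime n} (hp : p ∈ region K) :
    pd (region K) α (fun q => c * f q) p = c * pd (region K) α f p := by
  rw [pd_mul hK contDiffOn_const hf α hp, pd_const]; ring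

lemma pd_comp (hK : IsClosed K) {f : Spacetime n → ℝ} (hf : SmoothOn K f) {Φ : ℝ → ℝ} {Φ' : ℝ}
    (α : Fin (n + 1)) {p : Spacetime n} (hp : p ∈ region K) (hΦ : HasDerivAt Φ Φ' (f p)) :
    pd (region K) α (fun q => Φ (f q)) p = Φ' * pd (region K) α f p := by
  have := (hΦ.comp_hasFDerivWithinAt p (hf.diffWithinAt hp).hasFDerivWithinAt).fderivWithin
    (uniqueDiffOn_region hK p hp)
  simp only [pd]
  rw [show (fun q => Φ (f q)) = Φ ∘ f from rfl, this]
  simp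

/-- Partial derivatives of a smooth function commute, also on the initial slice. -/
lemma pd_comm (hK : IsClosed K) {f : Spacetime n → ℝ} (hf : SmoothOn K f)
    (α β : Fin (n + 1)) {p : Spacetime n} (hp : p ∈ region K) :
    pd (region K) α (pd (region K) β f) p = pd (region K) β (pd (region K) α f) p := by
  have hs : IsSymmSndFDerivWithinAt ℝ f (region K) p :=
    (hf p hp).isSymmSndFDerivWithinAt
      (by
        rw [minSmoothness_of_isRCLikeNormedField]
        exact WithTop.coe_le_coe.2 (le_top : (2 : ℕ∞) ≤ ⊤))
      (uniqueDiffOn_region hK)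
      (region_subset_closure_interior hK hp) hp
  have hd : DifferentiableWithinAt ℝ (fderivWithin ℝ f (region K)) (region K) p :=
    (hf.fderivWithin (uniqueDiffOn_region hK) (m := ∞) (by simp)).differentiableOn (by simp) p hp
  have key : ∀ γ δ : Fin (n + 1), pd (region K) γ (pd (region K) δ f) p =
      fderivWithin ℝ (fderivWithin ℝ f (region K)) (region K) p (dir γ) (dir δ) := by
    intro γ δ
    have := fderivWithin_clm_apply (uniqueDiffOn_region hK p hp) hd
      (differentiableWithinAt_const (dir δ))
    change fderivWithin ℝ (fun y => (fderivWithin ℝ f (region K) y) (dir δ)) (region K) p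
      (dir γ) = _
    rw [this]
    simp
  rw [key, key]
  exact hs.eq _ _

lemma dir_zero : (dir 0 : Spacetime n) = (1, 0) := rfl

lemma dir_succ (i : Fin n) : (dir i.succ : Spacetime n) = (0, EuclideanSpace.single i 1) := rfl

/-- On the region, `pd` of a globally smooth function is its directional derivative. -/
lemma pd_eq_of_hasFDerivAt (hK : IsClosed K) {f : Spacetime n → ℝ}
    {f' : Spacetime n →L[ℝ] ℝ} {p : Spacetime n} (hf : HasFDerivAt f f' p) (α : Fin (n + 1))
    (hp : p ∈ region K) : pd (region K) α f p = f' (dir α) := by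
  simp only [pd]
  rw [hf.hasFDerivWithinAt.fderivWithin (uniqueDiffOn_region hK p hp)]

/-! ### Words of derivatives -/

/-- `∂_L f` for a word `L` in the coordinate directions; the first letter acts first. -/
def wordDeriv (K : Set (Space n)) : List (Fin (n + 1)) → (Spacetime n → ℝ) → Spacetime n → ℝ
  | [], f => f
  | α :: L, f => wordDeriv K L (pd (region K) α f)

@[simp] lemma wordDeriv_nil (f : Spacetime n → ℝ) : wordDeriv K [] f = f := rfl

@[simp] lemma wordDeriv_cons (α : Fin (n + 1)) (L : List (Fin (n + 1))) (f : Spacetime n → ℝ) :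
    wordDeriv K (α :: L) f = wordDeriv K L (pd (region K) α f) := rfl

lemma wordDeriv_append (L L' : List (Fin (n + 1))) (f : Spacetime n → ℝ) :
    wordDeriv K (L ++ L') f = wordDeriv K L' (wordDeriv K L f) := by
  induction L generalizing f with
  | nil => rfl
  | cons α L ih => simp [ih]

lemma wordDeriv_congr {f g : Spacetime n → ℝ} (h : Set.EqOn f g (region K))
    (L : List (Fin (n + 1))) : Set.EqOn (wordDeriv K L f) (wordDeriv K L g) (region K) := by
  induction L generalizing f g with
  | nil => exact h
  | cons α L ih => exact ih (pd_congr h α)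

lemma SmoothOn.wordDeriv (hK : IsClosed K) {f : Spacetime n → ℝ} (hf : SmoothOn K f)
    (L : List (Fin (n + 1))) : SmoothOn K (wordDeriv K L f) := by
  induction L generalizing f with
  | nil => exact hf
  | cons α L ih => exact ih (hf.pd hK α)

lemma wordDeriv_perm (hK : IsClosed K) {L L' : List (Fin (n + 1))} (h : L.Perm L')
    {f : Spacetime n → ℝ} (hf : SmoothOn K f) :
    Set.EqOn (wordDeriv K L f) (wordDeriv K L' f) (region K) := by
  induction h generalizing f with
  | nil => exact fun _ _ => rfl
  | cons α _ ih => exact ih (hf.pd hK α)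
  | swap α β L => exact wordDeriv_congr (fun p hp => pd_comm hK hf _ _ hp) L
  | trans _ _ ih₁ ih₂ => exact (ih₁ hf).trans (ih₂ hf)

lemma wordDeriv_add (hK : IsClosed K) (L : List (Fin (n + 1))) {f g : Spacetime n → ℝ}
    (hf : SmoothOn K f) (hg : SmoothOn K g) :
    Set.EqOn (wordDeriv K L fun q => f q + g q)
      (fun p => wordDeriv K L f p + wordDeriv K L g p) (region K) := by
  induction L generalizing f g with
  | nil => exact fun _ _ => rfl
  | cons α L ih =>
    exact (wordDeriv_congr (fun p hp => pd_add hK hf hg α hp) L).trans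
      (ih (hf.pd hK α) (hg.pd hK α))

lemma wordDeriv_const (c : ℝ) {L : List (Fin (n + 1))} (hL : L ≠ []) :
    wordDeriv K L (fun _ => c) = fun _ => 0 := by
  have h0 : ∀ (L : List (Fin (n + 1))), wordDeriv K L (fun _ => (0 : ℝ)) = fun _ => 0 := by
    intro L
    induction L with
    | nil => rfl
    | cons α L ih =>
      rw [wordDeriv_cons, show pd (region K) α (fun _ => (0 : ℝ)) = fun _ => 0 from
        funext fun p => pd_const 0 α p, ih]
  cases L with
  | nil => exact absurd rfl hL
  | cons α L =>
    rw [wordDeriv_cons, show pd (region K) α (fun _ => c) = fun _ => 0 from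
      funext fun p => pd_const c α p, h0]

lemma wordDeriv_sum (hK : IsClosed K) {ι : Type*} (s : Finset ι) (L : List (Fin (n + 1)))
    {f : ι → Spacetime n → ℝ} (hf : ∀ i ∈ s, SmoothOn K (f i)) :
    Set.EqOn (wordDeriv K L fun q => ∑ i ∈ s, f i q)
      (fun p => ∑ i ∈ s, wordDeriv K L (f i) p) (region K) := by
  induction L generalizing f with
  | nil => exact fun _ _ => rfl
  | cons α L ih =>
    exact (wordDeriv_congr (fun p hp => pd_sum hK s hf α hp) L).trans
      (ih fun i hi => (hf i hi).pd hK α)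

lemma sum_count_eq_length (L : List (Fin (n + 1))) : ∑ i, L.count i = L.length := by
  simpa using Multiset.sum_count_eq_card (s := Finset.univ) (m := (L : Multiset (Fin (n + 1))))
    (by simp)

/-- Every multi-index derivative is a word derivative. -/
lemma exists_word_eq_mpd (K : Set (Space n)) (a : Fin (n + 1) → ℕ) :
    ∃ W : List (Fin (n + 1)), W.length = ∑ i, a i ∧ (∀ i, W.count i = a i) ∧
      ∀ f, mpd (region K) a f = wordDeriv K W f := by
  have hrep : ∀ (α : Fin (n + 1)) (m : ℕ) (f : Spacetime n → ℝ),
      (pd (region K) α)^[m] f = wordDeriv K (List.replicate m α) f := by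
    intro α m
    induction m with
    | zero => intro f; rfl
    | succ m ih => intro f; rw [Function.iterate_succ_apply, ih]; rfl
  have key : ∀ l : List (Fin (n + 1)), ∃ W : List (Fin (n + 1)),
      (∀ i, W.count i = l.count i * a i) ∧
      ∀ f, l.foldr (fun α h => (pd (region K) α)^[a α] h) f = wordDeriv K W f := by
    intro l
    induction l with
    | nil => exact ⟨[], by simp, fun f => rfl⟩
    | cons α l ih =>
      obtain ⟨W, h1, h2⟩ := ih
      refine ⟨W ++ List.replicate (a α) α, fun i => ?_, fun f => ?_⟩
      · rw [List.count_append, h1, List.count_replicate, List.count_cons]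
        by_cases h : α = i
        · subst h; simp; ring
        · simp [h]
      · rw [List.foldr_cons, h2, hrep, wordDeriv_append]
  obtain ⟨W, h1, h2⟩ := key (List.finRange (n + 1))
  have h3 : ∀ i, W.count i = a i := fun i => by
    rw [h1, List.count_eq_one_of_mem (List.nodup_finRange _) (List.mem_finRange i), one_mul]
  refine ⟨W, ?_, h3, h2⟩
  rw [← Finset.sum_congr rfl fun i _ => h3 i]
  exact (sum_count_eq_length W).symm

lemma wordDeriv_eqOn_mpd (hK : IsClosed K) (L : List (Fin (n + 1))) {f : Spacetime n → ℝ}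
    (hf : SmoothOn K f) :
    Set.EqOn (wordDeriv K L f) (mpd (region K) (fun i => L.count i) f) (region K) := by
  obtain ⟨W, -, h2, h3⟩ := exists_word_eq_mpd K (fun i => L.count i)
  rw [h3]
  exact wordDeriv_perm hK (List.perm_iff_count.2 fun i => (h2 i).symm) hf

end Calculus

/-! ### Symbols: bounded coefficients with decaying derivatives -/

section Symbols

variable {K : Set (Space n)} {Ω : Set (Spacetime n)} {lam lam₁ lam₂ : Spacetime n → ℝ}
  {m : ℕ} {f v w : Spacetime n → ℝ}

/-- On `Ω` all word derivatives of `f` of order at most `m` are `O(lam)`. -/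
def DerivBound (K : Set (Space n)) (Ω : Set (Spacetime n)) (lam : Spacetime n → ℝ) (m : ℕ)
    (f : Spacetime n → ℝ) : Prop :=
  ∃ C : ℝ, 0 ≤ C ∧ ∀ L : List (Fin (n + 1)), L.length ≤ m → ∀ p ∈ Ω,
    |wordDeriv K L f p| ≤ C * lam p

/-- Crude Leibniz bound at a point. -/
lemma abs_wordDeriv_mul_le (hK : IsClosed K) (L : List (Fin (n + 1)))
    (hv : SmoothOn K v) (hw : SmoothOn K w) {p : Spacetime n} (hp : p ∈ region K) {A B : ℝ}
    (hA : ∀ L' : List (Fin (n + 1)), L'.length ≤ L.length → |wordDeriv K L' v p| ≤ A)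
    (hB : ∀ L' : List (Fin (n + 1)), L'.length ≤ L.length → |wordDeriv K L' w p| ≤ B) :
    |wordDeriv K L (fun q => v q * w q) p| ≤ 2 ^ L.length * (A * B) := by
  induction L generalizing v w with
  | nil =>
    have h1 := hA [] le_rfl
    have h2 := hB [] le_rfl
    simp only [wordDeriv_nil, List.length_nil, pow_zero, one_mul, abs_mul] at *
    exact mul_le_mul h1 h2 (abs_nonneg _) ((abs_nonneg _).trans h1)
  | cons α L ih =>
    have e : wordDeriv K (α :: L) (fun q => v q * w q) p =
        wordDeriv K L (fun q => pd (region K) α v q * w q) p +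
          wordDeriv K L (fun q => v q * pd (region K) α w q) p := by
      rw [wordDeriv_cons, wordDeriv_congr (fun q hq => pd_mul hK hv hw α hq) L hp,
        wordDeriv_add hK L ((hv.pd hK α).mul hw) (hv.mul (hw.pd hK α)) hp]
    have h1 := ih (hv.pd hK α) hw (fun L' h => hA (α :: L') (by simpa using h))
      (fun L' h => hB L' (h.trans (by simp)))
    have h2 := ih hv (hw.pd hK α) (fun L' h => hA L' (h.trans (by simp)))
      (fun L' h => hB (α :: L') (by simpa using h))
    rw [e, List.length_cons, pow_succ]
    refine (abs_add_le _ _).trans ?_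
    linarith

/-- Crude commutator bound at a point: only derivatives of `v` of positive order and derivatives
of `w` of lower order enter. -/
lemma abs_wordDeriv_mul_sub_le (hK : IsClosed K) (L : List (Fin (n + 1)))
    (hv : SmoothOn K v) (hw : SmoothOn K w) {p : Spacetime n} (hp : p ∈ region K) {A B : ℝ}
    (hA0 : 0 ≤ A) (hB0 : 0 ≤ B)
    (hA : ∀ α, ∀ L' : List (Fin (n + 1)), L'.length < L.length →
      |wordDeriv K L' (pd (region K) α v) p| ≤ A)
    (hB : ∀ L' : List (Fin (n + 1)), L'.length < L.length → |wordDeriv K L' w p| ≤ B) :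
    |wordDeriv K L (fun q => v q * w q) p - v p * wordDeriv K L w p| ≤
      2 ^ L.length * (A * B) := by
  induction L generalizing v w with
  | nil => simp; positivity
  | cons α L ih =>
    have e : wordDeriv K (α :: L) (fun q => v q * w q) p =
        wordDeriv K L (fun q => pd (region K) α v q * w q) p +
          wordDeriv K L (fun q => v q * pd (region K) α w q) p := by
      rw [wordDeriv_cons, wordDeriv_congr (fun q hq => pd_mul hK hv hw α hq) L hp,
        wordDeriv_add hK L ((hv.pd hK α).mul hw) (hv.mul (hw.pd hK α)) hp]
    have h1 := abs_wordDeriv_mul_le hK L (hv.pd hK α) hw hp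
      (fun L' h => hA α L' (by simpa using Nat.lt_succ_of_le h))
      (fun L' h => hB L' (by simpa using Nat.lt_succ_of_le h))
    have h2 := ih hv (hw.pd hK α) (fun β L' h => hA β L' (h.trans (by simp)))
      (fun L' h => hB (α :: L') (by simpa using h))
    rw [e, wordDeriv_cons, List.length_cons, pow_succ, add_sub_assoc]
    refine (abs_add_le _ _).trans ?_
    linarith

namespace DerivBound

lemma congr (h : DerivBound K Ω lam m v) (hΩ : Ω ⊆ region K) (e : Set.EqOn v w (region K)) :
    DerivBound K Ω lam m w := by
  obtain ⟨C, hC, h⟩ := h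
  exact ⟨C, hC, fun L hL p hp => by rw [← wordDeriv_congr e L (hΩ hp)]; exact h L hL p hp⟩

lemma mono_weight (h : DerivBound K Ω lam₁ m v) (hl : ∀ p ∈ Ω, lam₁ p ≤ lam₂ p) :
    DerivBound K Ω lam₂ m v := by
  obtain ⟨C, hC, h⟩ := h
  exact ⟨C, hC, fun L hL p hp => (h L hL p hp).trans
    (mul_le_mul_of_nonneg_left (hl p hp) hC)⟩

lemma mono_order {m' : ℕ} (h : DerivBound K Ω lam m v) (hm : m' ≤ m) :
    DerivBound K Ω lam m' v := by
  obtain ⟨C, hC, h⟩ := h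
  exact ⟨C, hC, fun L hL => h L (hL.trans hm)⟩

lemma add (hK : IsClosed K) (hΩ : Ω ⊆ region K) (hv : SmoothOn K v) (hw : SmoothOn K w)
    (h₁ : DerivBound K Ω lam m v) (h₂ : DerivBound K Ω lam m w) :
    DerivBound K Ω lam m fun q => v q + w q := by
  obtain ⟨C₁, hC₁, h₁⟩ := h₁
  obtain ⟨C₂, hC₂, h₂⟩ := h₂
  refine ⟨C₁ + C₂, by positivity, fun L hL p hp => ?_⟩
  rw [wordDeriv_add hK L hv hw (hΩ hp), add_mul]
  exact (abs_add_le _ _).trans (add_le_add (h₁ L hL p hp) (h₂ L hL p hp))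

lemma mul (hK : IsClosed K) (hΩ : Ω ⊆ region K) (hv : SmoothOn K v) (hw : SmoothOn K w)
    (h₁ : DerivBound K Ω lam₁ m v) (h₂ : DerivBound K Ω lam₂ m w) :
    DerivBound K Ω (fun p => lam₁ p * lam₂ p) m fun q => v q * w q := by
  obtain ⟨C₁, hC₁, h₁⟩ := h₁
  obtain ⟨C₂, hC₂, h₂⟩ := h₂
  refine ⟨2 ^ m * (C₁ * C₂), by positivity, fun L hL p hp => ?_⟩
  have hA := fun L' (h : List.length L' ≤ L.length) => h₁ L' (h.trans hL) p hp
  have hB := fun L' (h : List.length L' ≤ L.length) => h₂ L' (h.trans hL) p hp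
  have h := abs_wordDeriv_mul_le hK L hv hw (hΩ hp) hA hB
  have h0 : 0 ≤ C₁ * lam₁ p * (C₂ * lam₂ p) :=
    mul_nonneg ((abs_nonneg _).trans (hA [] (by simp))) ((abs_nonneg _).trans (hB [] (by simp)))
  calc _ ≤ 2 ^ L.length * (C₁ * lam₁ p * (C₂ * lam₂ p)) := h
    _ ≤ 2 ^ m * (C₁ * lam₁ p * (C₂ * lam₂ p)) := by gcongr; norm_num
    _ = _ := by ring

lemma succ_of_pd (hlam : ∀ p ∈ Ω, 0 ≤ lam p) (h0 : ∃ C, ∀ p ∈ Ω, |v p| ≤ C * lam p)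
    (h : ∀ α, DerivBound K Ω lam m (pd (region K) α v)) : DerivBound K Ω lam (m + 1) v := by
  obtain ⟨C₀, h0⟩ := h0
  choose C hC h using h
  refine ⟨|C₀| + ∑ α, C α, add_nonneg (abs_nonneg _) (Finset.sum_nonneg fun α _ => hC α),
    fun L hL p hp => ?_⟩
  have hS : 0 ≤ ∑ α, C α := Finset.sum_nonneg fun α _ => hC α
  cases L with
  | nil =>
    refine (h0 p hp).trans (mul_le_mul_of_nonneg_right ?_ (hlam p hp))
    linarith [le_abs_self C₀]
  | cons α L =>
    refine (h α L (by simpa using hL) p hp).trans (mul_le_mul_of_nonneg_right ?_ (hlam p hp))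
    have := Finset.single_le_sum (fun β _ => hC β) (Finset.mem_univ α)
    linarith [abs_nonneg C₀]

end DerivBound

/-- A symbol of order `m`: a smooth function that is bounded on `Ω` and whose derivatives of
orders `1, …, m + 1` are `O(lam)` there. -/
structure IsSymbol (K : Set (Space n)) (Ω : Set (Spacetime n)) (lam : Spacetime n → ℝ) (m : ℕ)
    (f : Spacetime n → ℝ) : Prop where
  smooth : SmoothOn K f
  bdd : ∃ C, ∀ p ∈ Ω, |f p| ≤ C
  deriv : ∀ α, DerivBound K Ω lam m (pd (region K) α f)

namespace IsSymbol

lemma derivBound (hl : ∀ p ∈ Ω, lam p ≤ 1) (h : IsSymbol K Ω lam m f) :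
    DerivBound K Ω (fun _ => 1) m f := by
  obtain ⟨C, hC⟩ := h.bdd
  exact (DerivBound.succ_of_pd (fun _ _ => zero_le_one) ⟨C, by simpa using hC⟩
    fun α => (h.deriv α).mono_weight hl).mono_order (Nat.le_succ m)

lemma congr (hΩ : Ω ⊆ region K) (h : IsSymbol K Ω lam m v)
    (e : Set.EqOn v w (region K)) : IsSymbol K Ω lam m w where
  smooth := h.smooth.congr fun p hp => (e hp).symm
  bdd := by
    obtain ⟨C, hC⟩ := h.bdd
    exact ⟨C, fun p hp => by rw [← e (hΩ hp)]; exact hC p hp⟩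
  deriv α := (h.deriv α).congr hΩ (pd_congr e α)

lemma const (c : ℝ) : IsSymbol K Ω lam m fun _ => c where
  smooth := contDiffOn_const
  bdd := ⟨|c|, fun _ _ => le_rfl⟩
  deriv α := ⟨0, le_rfl, fun L _ p hp => by
    rw [← wordDeriv_cons, wordDeriv_const c (by simp)]; simp⟩

lemma add (hK : IsClosed K) (hΩ : Ω ⊆ region K) (h₁ : IsSymbol K Ω lam m v)
    (h₂ : IsSymbol K Ω lam m w) : IsSymbol K Ω lam m fun q => v q + w q where
  smooth := h₁.smooth.add h₂.smooth
  bdd := by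
    obtain ⟨C₁, h₁⟩ := h₁.bdd
    obtain ⟨C₂, h₂⟩ := h₂.bdd
    exact ⟨C₁ + C₂, fun p hp => (abs_add_le _ _).trans (add_le_add (h₁ p hp) (h₂ p hp))⟩
  deriv α := (DerivBound.add hK hΩ (h₁.smooth.pd hK α) (h₂.smooth.pd hK α) (h₁.deriv α)
    (h₂.deriv α)).congr hΩ fun p hp => (pd_add hK h₁.smooth h₂.smooth α hp).symm

lemma mul (hK : IsClosed K) (hΩ : Ω ⊆ region K) (hl : ∀ p ∈ Ω, lam p ≤ 1)
    (h₁ : IsSymbol K Ω lam m v) (h₂ : IsSymbol K Ω lam m w) :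
    IsSymbol K Ω lam m fun q => v q * w q where
  smooth := h₁.smooth.mul h₂.smooth
  bdd := by
    obtain ⟨C₁, h₁⟩ := h₁.bdd
    obtain ⟨C₂, h₂⟩ := h₂.bdd
    refine ⟨C₁ * C₂, fun p hp => ?_⟩
    rw [abs_mul]
    exact mul_le_mul (h₁ p hp) (h₂ p hp) (abs_nonneg _) ((abs_nonneg _).trans (h₁ p hp))
  deriv α := by
    have a₁ := (h₁.deriv α).mul hK hΩ (h₁.smooth.pd hK α) h₂.smooth (h₂.derivBound hl)
    have a₂ := (h₁.derivBound hl).mul hK hΩ h₁.smooth (h₂.smooth.pd hK α) (h₂.deriv α)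
    simp only [mul_one, one_mul] at a₁ a₂
    exact (DerivBound.add hK hΩ ((h₁.smooth.pd hK α).mul h₂.smooth)
      (h₁.smooth.mul (h₂.smooth.pd hK α)) a₁ a₂).congr hΩ
      fun p hp => (pd_mul hK h₁.smooth h₂.smooth α hp).symm

lemma sum (hK : IsClosed K) (hΩ : Ω ⊆ region K) {ι : Type*}
    (s : Finset ι) {F : ι → Spacetime n → ℝ} (h : ∀ i ∈ s, IsSymbol K Ω lam m (F i)) :
    IsSymbol K Ω lam m fun q => ∑ i ∈ s, F i q := by
  classical
  induction s using Finset.induction_on with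
  | empty => simpa using const 0
  | insert i s hi ih =>
    simp only [Finset.sum_insert hi]
    exact (h i (by simp)).add hK hΩ (ih fun j hj => h j (by simp [hj]))

lemma prod (hK : IsClosed K) (hΩ : Ω ⊆ region K) (hl : ∀ p ∈ Ω, lam p ≤ 1) {ι : Type*}
    (s : Finset ι) {F : ι → Spacetime n → ℝ} (h : ∀ i ∈ s, IsSymbol K Ω lam m (F i)) :
    IsSymbol K Ω lam m fun q => ∏ i ∈ s, F i q := by
  classical
  induction s using Finset.induction_on with
  | empty => simpa using const 1
  | insert i s hi ih =>
    simp only [Finset.prod_insert hi]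
    exact (h i (by simp)).mul hK hΩ hl (ih fun j hj => h j (by simp [hj]))

lemma det (hK : IsClosed K) (hΩ : Ω ⊆ region K) (hl : ∀ p ∈ Ω, lam p ≤ 1)
    {ι : Type*} [Fintype ι] [DecidableEq ι]
    {G : Spacetime n → Matrix ι ι ℝ} (h : ∀ i j, IsSymbol K Ω lam m fun q => G q i j) :
    IsSymbol K Ω lam m fun q => (G q).det := by
  simp only [Matrix.det_apply']
  exact sum hK hΩ _ fun σ _ => (const _).mul hK hΩ hl
    (prod hK hΩ hl _ fun i _ => h _ _)

lemma adjugate (hK : IsClosed K) (hΩ : Ω ⊆ region K) (hl : ∀ p ∈ Ω, lam p ≤ 1)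
    {ι : Type*} [Fintype ι] [DecidableEq ι]
    {G : Spacetime n → Matrix ι ι ℝ} (h : ∀ i j, IsSymbol K Ω lam m fun q => G q i j) (i j : ι) :
    IsSymbol K Ω lam m fun q => (G q).adjugate i j := by
  simp only [Matrix.adjugate_apply]
  refine det hK hΩ hl fun a b => ?_
  by_cases hj : a = j
  · subst hj
    simpa using const _
  · simpa [Matrix.updateRow_ne hj] using h a b

/-- Real powers of a symbol with a positive lower bound are symbols: the chain rule
`∂ f^s = s f^{s-1} ∂ f` stays inside the family of powers. -/
lemma rpow (hK : IsClosed K) (hΩ : Ω ⊆ region K) (hl : ∀ p ∈ Ω, lam p ≤ 1)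
    (h : IsSymbol K Ω lam m f) (hpos : ∀ p ∈ region K, 0 < f p)
    {c : ℝ} (hc : 0 < c) (hcf : ∀ p ∈ Ω, c ≤ f p) (s : ℝ) :
    IsSymbol K Ω lam m fun q => f q ^ s := by
  have hsm : ∀ s : ℝ, SmoothOn K fun q => f q ^ s := fun s =>
    h.smooth.rpow_const_of_ne fun p hp => (hpos p hp).ne'
  have hpd : ∀ (s : ℝ) (α : Fin (n + 1)), Set.EqOn
      (fun q => s * (f q ^ (s - 1) * pd (region K) α f q))
      (pd (region K) α fun q => f q ^ s) (region K) := by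
    intro s α p hp
    rw [pd_comp hK h.smooth α hp (Real.hasDerivAt_rpow_const (Or.inl (hpos p hp).ne'))]
    ring
  obtain ⟨C, hC⟩ := h.bdd
  have hbd : ∀ s : ℝ, ∃ B, ∀ p ∈ Ω, |f p ^ s| ≤ B := by
    intro s
    refine ⟨max (c ^ s) (C ^ s), fun p hp => ?_⟩
    have h1 := hcf p hp
    have h2 := (le_abs_self _).trans (hC p hp)
    rw [abs_of_nonneg (Real.rpow_nonneg (hc.le.trans h1) s)]
    rcases le_total 0 s with h0 | h0
    · exact le_max_of_le_right (Real.rpow_le_rpow (hc.le.trans h1) h2 h0)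
    · exact le_max_of_le_left (Real.rpow_le_rpow_of_nonpos hc h1 h0)
  have hconst : ∀ (s : ℝ) (j : ℕ), DerivBound K Ω (fun _ => 1) j fun _ => s := fun s j =>
    (const (m := j) (lam := fun _ => 1) s).derivBound fun _ _ => le_rfl
  have key : ∀ j ≤ m, ∀ s : ℝ, DerivBound K Ω (fun _ => 1) j fun q => f q ^ s := by
    intro j
    induction j with
    | zero =>
      intro _ s
      obtain ⟨B, hB⟩ := hbd s
      refine ⟨|B|, abs_nonneg _, fun L hL p hp => ?_⟩
      rw [List.length_eq_zero_iff.1 (Nat.le_zero.1 hL), mul_one]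
      exact (hB p hp).trans (le_abs_self B)
    | succ j ih =>
      intro hj s
      obtain ⟨B, hB⟩ := hbd s
      refine DerivBound.succ_of_pd (fun _ _ => zero_le_one) ⟨B, by simpa using hB⟩ fun α => ?_
      have a₁ := (ih (by omega) (s - 1)).mul hK hΩ (hsm _) (h.smooth.pd hK α)
        (((h.deriv α).mono_weight hl).mono_order (by omega))
      have a₂ := (hconst s j).mul hK hΩ contDiffOn_const ((hsm (s - 1)).mul (h.smooth.pd hK α)) a₁
      simp only [mul_one] at a₂
      exact a₂.congr hΩ (hpd s α)
  refine ⟨hsm s, hbd s, fun α => ?_⟩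
  have a₁ := (key m le_rfl (s - 1)).mul hK hΩ (hsm _) (h.smooth.pd hK α) (h.deriv α)
  have a₂ := (hconst s m).mul hK hΩ contDiffOn_const ((hsm (s - 1)).mul (h.smooth.pd hK α)) a₁
  simp only [one_mul] at a₂
  exact a₂.congr hΩ (hpd s α)

end IsSymbol

end Symbols

/-! ### The coefficients of the d'Alembertian -/

section Coefficients

variable {K : Set (Space n)} {Ω : Set (Spacetime n)} {lam : Spacetime n → ℝ} {m : ℕ}
  {g : TensorField n}

lemma det_minkowski (n : ℕ) : (minkowski n).det = -1 := by
  simp [minkowski, Matrix.det_diagonal, Fin.prod_univ_succ]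

lemma IsLorentzianMetric.det_neg (hg : IsLorentzianMetric K g) {p : Spacetime n}
    (hp : p ∈ region K) : 0 < -(g p).det := by
  obtain ⟨-, P, hP, h⟩ := hg.2 p hp
  have h1 : P.det * (g p).det * P.det = -1 := by
    rw [← det_minkowski n, ← h, Matrix.det_mul, Matrix.det_mul, Matrix.det_transpose]
  have h2 : 0 < P.det ^ 2 := by have := hP.ne_zero; positivity
  nlinarith

lemma IsLorentzianMetric.inv_symm (hg : IsLorentzianMetric K g) {p : Spacetime n}
    (hp : p ∈ region K) (α β : Fin (n + 1)) : (g p)⁻¹ α β = (g p)⁻¹ β α := by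
  have h := (hg.2 p hp).1
  have h1 : ((g p)⁻¹).transpose = (g p)⁻¹ := by rw [Matrix.transpose_nonsing_inv, h.eq]
  exact congrFun (congrFun h1 β) α

lemma inv_eq_neg_rpow_mul_adjugate (hg : IsLorentzianMetric K g) {p : Spacetime n}
    (hp : p ∈ region K) (α β : Fin (n + 1)) :
    (g p)⁻¹ α β = -1 * ((-(g p).det) ^ (-1 : ℝ) * (g p).adjugate α β) := by
  have h := hg.det_neg hp
  rw [Matrix.inv_def, Ring.inverse_eq_inv', Matrix.smul_apply, smul_eq_mul, Real.rpow_neg_one]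
  rw [inv_neg]; ring

/-- The symbol hypotheses on the metric: its components are symbols on `Ω` and the volume element
does not degenerate there. -/
structure SymbolMetric (K : Set (Space n)) (Ω : Set (Spacetime n)) (lam : Spacetime n → ℝ)
    (m : ℕ) (g : TensorField n) : Prop where
  lorentz : IsLorentzianMetric K g
  closed : IsClosed K
  subset : Ω ⊆ region K
  nonneg : ∀ p ∈ Ω, 0 ≤ lam p
  le_one : ∀ p ∈ Ω, lam p ≤ 1
  symbol : ∀ α β, IsSymbol K Ω lam m fun q => g q α β
  det : ∃ c : ℝ, 0 < c ∧ ∀ p ∈ Ω, c ≤ -(g p).det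

namespace SymbolMetric

lemma rpow (h : SymbolMetric K Ω lam m g) (s : ℝ) :
    IsSymbol K Ω lam m fun q => (-(g q).det) ^ s := by
  obtain ⟨c, hc, hcD⟩ := h.det
  have h1 : IsSymbol K Ω lam m fun q => -(g q).det := by
    have := (IsSymbol.const (-1)).mul h.closed h.subset h.le_one
      (IsSymbol.det h.closed h.subset h.le_one h.symbol)
    simpa using this
  exact h1.rpow h.closed h.subset h.le_one (fun p hp => h.lorentz.det_neg hp) hc hcD s

lemma inv (h : SymbolMetric K Ω lam m g) (α β : Fin (n + 1)) :
    IsSymbol K Ω lam m fun q => (g q)⁻¹ α β := by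
  have h1 := (IsSymbol.const (-1)).mul h.closed h.subset h.le_one
    ((h.rpow (-1)).mul h.closed h.subset h.le_one
      (IsSymbol.adjugate h.closed h.subset h.le_one h.symbol α β))
  exact h1.congr h.subset fun p hp => (inv_eq_neg_rpow_mul_adjugate h.lorentz hp α β).symm

/-- In non-divergence form `□_g = g^{αβ} ∂_α ∂_β + b^β ∂_β` with `b^β` decaying like the first
derivatives of the metric. -/
lemma exists_box_eq (h : SymbolMetric K Ω lam m g) :
    ∃ b : Fin (n + 1) → Spacetime n → ℝ, (∀ β, SmoothOn K (b β)) ∧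
      (∀ β, DerivBound K Ω lam m (b β)) ∧
      ∀ u, SmoothOn K u → ∀ p ∈ region K, box K g u p =
        ∑ α, ∑ β, (g p)⁻¹ α β * pd (region K) α (pd (region K) β u) p +
        ∑ β, b β p * pd (region K) β u p := by
  have hK := h.closed
  have hA : ∀ α β, IsSymbol K Ω lam m fun q => (g q)⁻¹ α β * Real.sqrt (-(g q).det) := by
    intro α β
    have := (h.inv α β).mul hK h.subset h.le_one (h.rpow (1 / 2))
    simpa only [← Real.sqrt_eq_rpow] using this
  have hs : IsSymbol K Ω lam m fun q => (Real.sqrt (-(g q).det))⁻¹ := by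
    refine (h.rpow (-(1 / 2))).congr h.subset fun p hp => ?_
    rw [Real.sqrt_eq_rpow, Real.rpow_neg (h.lorentz.det_neg hp).le]
  have hb1 : ∀ α β, SmoothOn K fun p => (Real.sqrt (-(g p).det))⁻¹ *
      pd (region K) α (fun q => (g q)⁻¹ α β * Real.sqrt (-(g q).det)) p :=
    fun α β => hs.smooth.mul ((hA α β).smooth.pd hK α)
  refine ⟨fun β p => ∑ α, (Real.sqrt (-(g p).det))⁻¹ *
    pd (region K) α (fun q => (g q)⁻¹ α β * Real.sqrt (-(g q).det)) p, fun β =>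
      ContDiffOn.sum fun α _ => hb1 α β, fun β => ?_, fun u hu p hp => ?_⟩
  · have : ∀ s : Finset (Fin (n + 1)), DerivBound K Ω lam m fun p =>
        ∑ α ∈ s, (Real.sqrt (-(g p).det))⁻¹ *
          pd (region K) α (fun q => (g q)⁻¹ α β * Real.sqrt (-(g q).det)) p := by
      intro s
      induction s using Finset.induction_on with
      | empty =>
        refine ⟨0, le_rfl, fun L _ p hp => ?_⟩
        cases L with
        | nil => simp
        | cons α L => simp only [Finset.sum_empty]; rw [wordDeriv_const 0 (by simp)]; simp
      | insert α s hi ih =>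
        simp only [Finset.sum_insert hi]
        refine DerivBound.add hK h.subset (hb1 α β) (ContDiffOn.sum fun α _ => hb1 α β) ?_ ih
        have := (hs.derivBound h.le_one).mul hK h.subset hs.smooth ((hA α β).smooth.pd hK α)
          ((hA α β).deriv α)
        simpa only [one_mul] using this
    exact this Finset.univ
  · have hD := Real.sqrt_pos.2 (h.lorentz.det_neg hp)
    have e : ∀ α, pd (region K) α (fun q => ∑ β, (g q)⁻¹ α β * Real.sqrt (-(g q).det) *
        pd (region K) β u q) p = ∑ β, (pd (region K) α
          (fun q => (g q)⁻¹ α β * Real.sqrt (-(g q).det)) p * pd (region K) β u p +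
          (g p)⁻¹ α β * Real.sqrt (-(g p).det) * pd (region K) α (pd (region K) β u) p) := by
      intro α
      rw [pd_sum hK Finset.univ (fun β _ => (hA α β).smooth.mul (hu.pd hK β)) α hp]
      exact Finset.sum_congr rfl fun β _ => pd_mul hK (hA α β).smooth (hu.pd hK β) α hp
    simp only [box]
    rw [Finset.sum_congr rfl fun α _ => e α]
    simp only [Finset.mul_sum, Finset.sum_add_distrib, Finset.sum_mul, mul_add]
    rw [add_comm]
    congr 1
    · refine Finset.sum_congr rfl fun α _ => Finset.sum_congr rfl fun β _ => ?_
      field_simp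
    · rw [Finset.sum_comm]
      refine Finset.sum_congr rfl fun α _ => Finset.sum_congr rfl fun β _ => ?_
      ring

/-- Commuting `□_g` with derivatives: `g^{αβ} ∂_α ∂_β ∂_L u` is `∂_L □_g u` up to
`O(lam |∂ ∂^{≤k} u|)`. -/
lemma exists_commutator_bound (h : SymbolMetric K Ω lam m g) {k : ℕ} (hk : k ≤ m) :
    ∃ C : ℝ, 0 ≤ C ∧ ∀ u, SmoothOn K u → ∀ L : List (Fin (n + 1)), L.length ≤ k → ∀ p ∈ Ω,
      ∀ B : ℝ, (∀ γ, ∀ L' : List (Fin (n + 1)), L'.length ≤ k →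
        |pd (region K) γ (wordDeriv K L' u) p| ≤ B) →
      |∑ α, ∑ β, (g p)⁻¹ α β * pd (region K) α (pd (region K) β (wordDeriv K L u)) p -
        wordDeriv K L (box K g u) p| ≤ C * lam p * B := by
  have hK := h.closed
  obtain ⟨b, hbs, hbd, hbox⟩ := h.exists_box_eq
  choose Cb hCb hb using hbd
  have hinv := fun α β γ => (h.inv α β).deriv γ
  choose Ci hCi hi using hinv
  set Cs : ℝ := ∑ α, ∑ β, ∑ γ, Ci α β γ with hCs
  have hCs0 : 0 ≤ Cs := Finset.sum_nonneg fun α _ => Finset.sum_nonneg fun β _ =>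
    Finset.sum_nonneg fun γ _ => hCi α β γ
  have hCile : ∀ α β γ, Ci α β γ ≤ Cs := fun α β γ =>
    ((Finset.single_le_sum (fun c _ => hCi α β c) (Finset.mem_univ γ)).trans
      (Finset.single_le_sum (f := fun β => ∑ γ, Ci α β γ)
        (fun b _ => Finset.sum_nonneg fun γ _ => hCi α b γ)
        (Finset.mem_univ β))).trans
      (Finset.single_le_sum (f := fun α => ∑ β, ∑ γ, Ci α β γ)
        (fun a _ => Finset.sum_nonneg fun b _ => Finset.sum_nonneg fun γ _ => hCi a b γ)
        (Finset.mem_univ α))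
  refine ⟨(∑ _α : Fin (n + 1), ∑ _β : Fin (n + 1), 2 ^ k * Cs) + ∑ β, 2 ^ k * Cb β,
    add_nonneg (Finset.sum_nonneg fun _ _ => Finset.sum_nonneg fun _ _ => by positivity)
      (Finset.sum_nonneg fun β _ => mul_nonneg (by positivity) (hCb β)),
    fun u hu L hL p hp B hB => ?_⟩
  have hpR := h.subset hp
  have hB0 : 0 ≤ B := (abs_nonneg _).trans (hB 0 [] (by simp))
  have hl := h.nonneg p hp
  have hpp : ∀ α β, SmoothOn K (pd (region K) α (pd (region K) β u)) :=
    fun α β => (hu.pd hK β).pd hK α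
  have s1 : ∀ α β, SmoothOn K fun q => (g q)⁻¹ α β * pd (region K) α (pd (region K) β u) q :=
    fun α β => (h.inv α β).smooth.mul (hpp α β)
  have s2 : ∀ β, SmoothOn K fun q => b β q * pd (region K) β u q :=
    fun β => (hbs β).mul (hu.pd hK β)
  have e : wordDeriv K L (box K g u) p =
      ∑ α, ∑ β, wordDeriv K L (fun q => (g q)⁻¹ α β * pd (region K) α (pd (region K) β u) q) p +
      ∑ β, wordDeriv K L (fun q => b β q * pd (region K) β u q) p := by
    rw [wordDeriv_congr (fun q hq => hbox u hu q hq) L hpR]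
    refine (wordDeriv_add hK L (ContDiffOn.sum fun α _ => ContDiffOn.sum fun β _ => s1 α β)
      (ContDiffOn.sum fun β _ => s2 β) hpR).trans ?_
    refine congrArg₂ (· + ·) ?_ (wordDeriv_sum hK _ L (fun β _ => s2 β) hpR)
    refine (wordDeriv_sum hK _ L (fun α _ => ContDiffOn.sum fun β _ => s1 α β) hpR).trans ?_
    exact Finset.sum_congr rfl fun α _ => wordDeriv_sum hK _ L (fun β _ => s1 α β) hpR
  have e2 : ∀ α β, pd (region K) α (pd (region K) β (wordDeriv K L u)) p =
      wordDeriv K L (pd (region K) α (pd (region K) β u)) p := by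
    intro α β
    have : (L ++ [β, α]).Perm (β :: α :: L) := List.perm_append_comm
    have := wordDeriv_perm hK this hu hpR
    simpa [wordDeriv_append] using this
  have t1 : ∀ α β, |(g p)⁻¹ α β * pd (region K) α (pd (region K) β (wordDeriv K L u)) p -
      wordDeriv K L (fun q => (g q)⁻¹ α β * pd (region K) α (pd (region K) β u) q) p| ≤
      2 ^ k * Cs * (lam p * B) := by
    intro α β
    rw [e2, abs_sub_comm]
    refine (abs_wordDeriv_mul_sub_le hK L (h.inv α β).smooth (hpp α β) hpR
      (A := Cs * lam p) (B := B) (by positivity) hB0 (fun γ L' hL' => ?_) fun L' hL' => ?_).trans ?_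
    · exact (hi α β γ L' (by omega) p hp).trans (mul_le_mul_of_nonneg_right (hCile α β γ) hl)
    · have h1 : (β :: α :: L').Perm ((β :: L') ++ [α]) := by
        simpa using (List.perm_append_singleton α L').symm
      have h2 := wordDeriv_perm hK h1 hu hpR
      rw [wordDeriv_append] at h2
      simp only [wordDeriv_cons, wordDeriv_nil] at h2
      rw [h2]
      exact hB α (β :: L') (by simp; omega)
    · calc (2 : ℝ) ^ L.length * (Cs * lam p * B) ≤ 2 ^ k * (Cs * lam p * B) := by
            gcongr; norm_num
        _ = _ := by ring
  have t2 : ∀ β, |wordDeriv K L (fun q => b β q * pd (region K) β u q) p| ≤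
      2 ^ k * Cb β * (lam p * B) := by
    intro β
    have hC := hCb β
    refine (abs_wordDeriv_mul_le hK L (hbs β) (hu.pd hK β) hpR (A := Cb β * lam p) (B := B)
      (fun L' hL' => hb β L' (by omega) p hp) fun L' hL' => ?_).trans ?_
    · have h1 : (β :: L').Perm (L' ++ [β]) := (List.perm_append_singleton β L').symm
      have h2 := wordDeriv_perm hK h1 hu hpR
      rw [wordDeriv_append] at h2
      simp only [wordDeriv_cons, wordDeriv_nil] at h2
      rw [h2]
      exact hB β L' (by omega)
    · calc (2 : ℝ) ^ L.length * (Cb β * lam p * B) ≤ 2 ^ k * (Cb β * lam p * B) := by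
            gcongr; norm_num
        _ = _ := by ring
  rw [e, ← sub_sub, ← Finset.sum_sub_distrib,
    Finset.sum_congr rfl fun α _ => (Finset.sum_sub_distrib _ _).symm]
  refine (abs_sub _ _).trans ?_
  calc
    _ ≤ (∑ _α : Fin (n + 1), ∑ _β : Fin (n + 1), 2 ^ k * Cs * (lam p * B)) +
        ∑ β, 2 ^ k * Cb β * (lam p * B) := by
      refine add_le_add ?_ ?_
      · refine (Finset.abs_sum_le_sum_abs _ _).trans (Finset.sum_le_sum fun α _ => ?_)
        exact (Finset.abs_sum_le_sum_abs _ _).trans (Finset.sum_le_sum fun β _ => t1 α β)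
      · exact (Finset.abs_sum_le_sum_abs _ _).trans (Finset.sum_le_sum fun β _ => t2 β)
    _ = _ := by simp only [← Finset.sum_mul]; ring_nf

end SymbolMetric

end Coefficients

/-! ### The radial multiplier -/

section Multiplier

/-- The spatial coordinates, with the time component replaced by zero. -/
def coord (α : Fin (n + 1)) (p : Spacetime n) : ℝ :=
  Fin.cases (motive := fun _ => ℝ) 0 (fun i => p.2 i) α

@[simp] lemma coord_zero (p : Spacetime n) : coord 0 p = 0 := rfl

@[simp] lemma coord_succ (i : Fin n) (p : Spacetime n) : coord i.succ p = p.2 i := rfl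

/-- The indicator of the spatial directions. -/
def spatial (α : Fin (n + 1)) : ℝ := Fin.cases (motive := fun _ => ℝ) 0 (fun _ => 1) α

@[simp] lemma spatial_zero : spatial (0 : Fin (n + 1)) = 0 := rfl

@[simp] lemma spatial_succ (i : Fin n) : spatial i.succ = 1 := rfl

/-- The function `(|x|² + ρ²)^{-1/2}`. -/
def kap (ρ : ℝ) (p : Spacetime n) : ℝ := (Real.sqrt (‖p.2‖ ^ 2 + ρ ^ 2))⁻¹

lemma sum_coord_sq (p : Spacetime n) : ∑ α, coord α p ^ 2 = ‖p.2‖ ^ 2 := by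
  rw [Fin.sum_univ_succ, EuclideanSpace.norm_sq_eq]
  simp

lemma sum_spatial : ∑ α : Fin (n + 1), spatial α = n := by
  rw [Fin.sum_univ_succ]; simp

lemma abs_coord_le (α : Fin (n + 1)) (p : Spacetime n) : |coord α p| ≤ ‖p.2‖ := by
  have := Finset.single_le_sum (f := fun α => coord α p ^ 2) (fun _ _ => sq_nonneg _)
    (Finset.mem_univ α)
  rw [sum_coord_sq] at this
  exact abs_le_of_sq_le_sq this (norm_nonneg _)

lemma kap_pos {ρ : ℝ} (hρ : 0 < ρ) (p : Spacetime n) : 0 < kap ρ p := by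
  unfold kap; positivity

lemma kap_sq_mul {ρ : ℝ} (hρ : 0 < ρ) (p : Spacetime n) :
    kap ρ p ^ 2 * (‖p.2‖ ^ 2 + ρ ^ 2) = 1 := by
  have : 0 < ‖p.2‖ ^ 2 + ρ ^ 2 := by positivity
  rw [kap, inv_pow, Real.sq_sqrt this.le, inv_mul_cancel₀ this.ne']

lemma kap_mul_norm_le {ρ : ℝ} (hρ : 0 < ρ) (p : Spacetime n) : kap ρ p * ‖p.2‖ ≤ 1 := by
  have h := kap_sq_mul hρ p
  have h0 := kap_pos hρ p
  refine abs_le_of_sq_le_sq' ?_ zero_le_one |>.2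
  nlinarith [mul_pos (pow_pos h0 2) (pow_pos hρ 2)]

lemma contDiff_coord (α : Fin (n + 1)) : ContDiff ℝ ∞ (coord α : Spacetime n → ℝ) := by
  refine Fin.cases contDiff_const (fun i => ?_) α
  exact (EuclideanSpace.proj (𝕜 := ℝ) i).contDiff.comp contDiff_snd

lemma contDiff_normSq : ContDiff ℝ ∞ fun p : Spacetime n => ‖p.2‖ ^ 2 :=
  (contDiff_norm_sq ℝ).comp contDiff_snd

lemma contDiff_kap {ρ : ℝ} (hρ : 0 < ρ) : ContDiff ℝ ∞ (kap ρ : Spacetime n → ℝ) := by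
  have h : ∀ p : Spacetime n, ‖p.2‖ ^ 2 + ρ ^ 2 ≠ 0 := fun p => by positivity
  exact ((contDiff_normSq.add contDiff_const).sqrt h).inv
    fun p => (Real.sqrt_pos.2 (by positivity)).ne'

variable {K : Set (Space n)}

lemma pd_coord (hK : IsClosed K) (α β : Fin (n + 1)) {p : Spacetime n} (hp : p ∈ region K) :
    pd (region K) β (coord α) p = if β = α then spatial α else 0 := by
  refine Fin.cases ?_ (fun i => ?_) α
  · have : (coord 0 : Spacetime n → ℝ) = fun _ => 0 := rfl
    rw [this, pd_const]; simp
  · have h : HasFDerivAt (coord i.succ : Spacetime n → ℝ)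
        ((EuclideanSpace.proj (𝕜 := ℝ) i).comp (ContinuousLinearMap.snd ℝ ℝ (Space n))) p :=
      ((EuclideanSpace.proj (𝕜 := ℝ) i).comp
        (ContinuousLinearMap.snd ℝ ℝ (Space n))).hasFDerivAt
    rw [pd_eq_of_hasFDerivAt hK h β hp]
    refine Fin.cases ?_ (fun j => ?_) β
    · have : (0 : Fin (n + 1)) ≠ i.succ := (Fin.succ_ne_zero i).symm
      simp [dir_zero, this]
    · simp [dir_succ, Fin.succ_inj, eq_comm]

lemma pd_normSq (hK : IsClosed K) (β : Fin (n + 1)) {p : Spacetime n} (hp : p ∈ region K) :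
    pd (region K) β (fun q : Spacetime n => ‖q.2‖ ^ 2) p = 2 * coord β p := by
  have e : (fun q : Spacetime n => ‖q.2‖ ^ 2) = fun q => ∑ α, coord α q * coord α q := by
    funext q; rw [← sum_coord_sq]; simp [sq]
  have hs : ∀ α, SmoothOn K (coord α) := fun α => (contDiff_coord α).contDiffOn
  rw [e, pd_sum hK _ (fun α _ => (hs α).mul (hs α)) β hp,
    Finset.sum_congr rfl fun α _ => pd_mul hK (hs α) (hs α) β hp]
  simp only [pd_coord hK _ β hp, ite_mul, mul_ite, zero_mul, mul_zero]
  rw [Finset.sum_add_distrib]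
  simp only [Finset.sum_ite_eq, Finset.mem_univ, if_true]
  refine Fin.cases ?_ (fun i => ?_) β
  · simp
  · simp; ring

lemma pd_kap (hK : IsClosed K) {ρ : ℝ} (hρ : 0 < ρ) (β : Fin (n + 1)) {p : Spacetime n}
    (hp : p ∈ region K) : pd (region K) β (kap ρ) p = -coord β p * kap ρ p ^ 3 := by
  have h0 : 0 < ‖p.2‖ ^ 2 + ρ ^ 2 := by positivity
  have h1 : HasDerivAt (fun y => (Real.sqrt (y + ρ ^ 2))⁻¹)
      (-(1 / (2 * Real.sqrt (‖p.2‖ ^ 2 + ρ ^ 2))) / Real.sqrt (‖p.2‖ ^ 2 + ρ ^ 2) ^ 2)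
      (‖p.2‖ ^ 2) :=
    (((hasDerivAt_id (‖p.2‖ ^ 2)).add_const (ρ ^ 2)).sqrt h0.ne').inv (Real.sqrt_pos.2 h0).ne'
  have := pd_comp hK contDiff_normSq.contDiffOn β hp h1
  rw [show kap ρ = fun q : Spacetime n => (Real.sqrt (‖q.2‖ ^ 2 + ρ ^ 2))⁻¹ from rfl, this,
    pd_normSq hK β hp]
  have := Real.sqrt_pos.2 h0
  field_simp

/-- Algebraic core of the multiplier identity. The arrays stand for the values at a point of
`d = ∂w`, `s = ∂∂w`, the coefficients `H` and their derivatives `H'`, the coordinates `x` and the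
indicator `e` of the spatial directions; `c κ` is the zeroth order part of the multiplier. All
second derivatives drop out except in the combination `H^{αβ} ∂_α ∂_β w`. -/
lemma multiplier_algebra {ι : Type*} [Fintype ι] (x d e : ι → ℝ) (s H : ι → ι → ℝ)
    (H' : ι → ι → ι → ℝ) (κ c w : ℝ) (hs : ∀ α β, s α β = s β α) (hH : ∀ α β, H α β = H β α) :
    ∑ α, ((∑ β, (H' α α β * d β + H α β * s α β)) * (κ * ∑ γ, x γ * d γ + c * κ * w) +
      (∑ β, H α β * d β) * (-x α * κ ^ 3 * ∑ γ, x γ * d γ +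
        κ * (e α * d α + ∑ γ, x γ * s α γ) + c * (-x α * κ ^ 3) * w + c * κ * d α) -
      1 / 2 * ((-x α * κ ^ 3 * x α + κ * e α) * (∑ μ, ∑ ν, H μ ν * d μ * d ν) +
        κ * x α * ∑ μ, ∑ ν, (H' α μ ν * d μ * d ν + H μ ν * (s α μ * d ν + d μ * s α ν))) +
      1 / 2 * c * (e α * κ ^ 3 * w ^ 2 + x α * (3 * κ ^ 2 * (-x α * κ ^ 3)) * w ^ 2 +
        x α * κ ^ 3 * (2 * w * d α))) =
    (∑ α, ∑ β, H α β * s α β) * (κ * ∑ γ, x γ * d γ + c * κ * w) +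
      (∑ α, ∑ β, H' α α β * d β) * (κ * ∑ γ, x γ * d γ + c * κ * w) -
      1 / 2 * κ * (∑ γ, x γ * ∑ μ, ∑ ν, H' γ μ ν * d μ * d ν) -
      κ ^ 3 * (∑ α, x α * ∑ β, H α β * d β) * (∑ γ, x γ * d γ) +
      κ * (∑ α, e α * d α * ∑ β, H α β * d β) +
      (c * κ - 1 / 2 * κ * (∑ α, e α) + 1 / 2 * κ ^ 3 * ∑ α, x α ^ 2) *
        (∑ μ, ∑ ν, H μ ν * d μ * d ν) -
      c * κ ^ 3 * w * (∑ α, x α * ∑ β, H α β * d β) + c * κ ^ 3 * w * (∑ γ, x γ * d γ) +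
      1 / 2 * c * (κ ^ 3 * (∑ α, e α) - 3 * κ ^ 5 * ∑ α, x α ^ 2) * w ^ 2 := by
  set S := κ * ∑ γ, x γ * d γ + c * κ * w
  set E := ∑ μ, ∑ ν, H μ ν * d μ * d ν with hE
  set Y : ι → ℝ := fun α => ∑ β, H α β * d β with hY
  set xd := ∑ γ, x γ * d γ with hxd
  -- the second derivatives created by the two halves of the current cancel
  have cross : ∑ α, Y α * ∑ γ, x γ * s α γ =
      1 / 2 * ∑ α, x α * ∑ μ, ∑ ν, H μ ν * (s α μ * d ν + d μ * s α ν) := by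
    have h1 : ∀ α, ∑ μ, ∑ ν, H μ ν * (s α μ * d ν + d μ * s α ν) = 2 * ∑ μ, Y μ * s α μ := by
      intro α
      have a1 : ∑ μ, ∑ ν, H μ ν * (s α μ * d ν) = ∑ μ, Y μ * s α μ := by
        refine Finset.sum_congr rfl fun μ _ => ?_
        simp only [hY, Finset.sum_mul]
        exact Finset.sum_congr rfl fun ν _ => by ring
      have a2 : ∑ μ, ∑ ν, H μ ν * (d μ * s α ν) = ∑ μ, Y μ * s α μ := by
        rw [Finset.sum_comm]
        refine Finset.sum_congr rfl fun μ _ => ?_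
        simp only [hY, Finset.sum_mul]
        exact Finset.sum_congr rfl fun ν _ => by rw [hH ν μ]; ring
      simp only [mul_add, Finset.sum_add_distrib, a1, a2]
      ring
    simp only [h1, Finset.mul_sum]
    rw [Finset.sum_comm]
    refine Finset.sum_congr rfl fun α _ => Finset.sum_congr rfl fun γ _ => ?_
    rw [hs γ α]; ring
  have hE' : E = ∑ α, d α * Y α := by
    simp only [hE, hY, Finset.mul_sum]
    exact Finset.sum_congr rfl fun α _ => Finset.sum_congr rfl fun β _ => by ring
  have step : ∀ α, ((∑ β, (H' α α β * d β + H α β * s α β)) * S +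
      Y α * (-x α * κ ^ 3 * xd +
        κ * (e α * d α + ∑ γ, x γ * s α γ) + c * (-x α * κ ^ 3) * w + c * κ * d α) -
      1 / 2 * ((-x α * κ ^ 3 * x α + κ * e α) * E +
        κ * x α * ∑ μ, ∑ ν, (H' α μ ν * d μ * d ν + H μ ν * (s α μ * d ν + d μ * s α ν))) +
      1 / 2 * c * (e α * κ ^ 3 * w ^ 2 + x α * (3 * κ ^ 2 * (-x α * κ ^ 3)) * w ^ 2 +
        x α * κ ^ 3 * (2 * w * d α))) =
      (∑ β, H α β * s α β) * S + (∑ β, H' α α β * d β) * S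
      + (-(κ ^ 3 * xd)) * (x α * Y α) + κ * (e α * d α * Y α) + κ * (Y α * ∑ γ, x γ * s α γ)
      + (-(c * κ ^ 3 * w)) * (x α * Y α) + c * κ * (d α * Y α) + 1 / 2 * κ ^ 3 * E * x α ^ 2
      + (-(1 / 2 * κ * E)) * e α
      + (-(1 / 2 * κ)) * (x α * ∑ μ, ∑ ν, H' α μ ν * d μ * d ν)
      + (-(1 / 2 * κ)) * (x α * ∑ μ, ∑ ν, H μ ν * (s α μ * d ν + d μ * s α ν))
      + 1 / 2 * c * κ ^ 3 * w ^ 2 * e α + (-(3 / 2 * c * κ ^ 5 * w ^ 2)) * x α ^ 2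
      + c * κ ^ 3 * w * (x α * d α) := by
    intro α
    simp only [Finset.sum_add_distrib]
    ring
  rw [Finset.sum_congr rfl fun α _ => step α]
  simp only [Finset.sum_add_distrib, ← Finset.mul_sum, ← Finset.sum_mul]
  rw [cross, ← hE', ← hxd]
  ring

end Multiplier

/-! ### Coercivity of the multiplier identity -/

section MultiplierEstimate

lemma abs_sum_le_card_mul {ι : Type*} [Fintype ι] {f : ι → ℝ} {B : ℝ} (h : ∀ i, |f i| ≤ B) :
    |∑ i, f i| ≤ Fintype.card ι * B := by
  refine (Finset.abs_sum_le_sum_abs _ _).trans ?_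
  refine (Finset.sum_le_sum fun i _ => h i).trans ?_
  simp

set_option maxHeartbeats 1000000 in
/-- Positivity of the bulk term: `h` is the deviation of the coefficients from the Minkowski
metric, of size `a r`, and `H'` are the derivatives of the coefficients, of size `a`. The flat part
of the identity is coercive because `n ≥ 3`; everything else is `O(a δ²)`, where `δ` bounds `∂w`
and `w / r`. -/
lemma multiplier_positivity (hn : 3 ≤ n) (x d : Fin (n + 1) → ℝ)
    (h : Fin (n + 1) → Fin (n + 1) → ℝ) (H' : Fin (n + 1) → Fin (n + 1) → Fin (n + 1) → ℝ)
    (κ ρ w r a δ : ℝ) (hκ : 0 < κ) (hr : 0 < r) (hκr : κ ^ 2 * (r ^ 2 + ρ ^ 2) = 1)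
    (hx0 : x 0 = 0) (hx : ∑ α, x α ^ 2 = r ^ 2) (ha : 0 ≤ a) (hδ : 0 ≤ δ)
    (hh : ∀ α β, |h α β| ≤ a * r) (hH' : ∀ γ α β, |H' γ α β| ≤ a)
    (hd : ∀ α, |d α| ≤ δ) (hw : |w| ≤ r * δ) :
    1 / 2 * ρ ^ 2 * κ ^ 3 * ∑ α, d α ^ 2 + 3 / 2 * ρ ^ 2 * κ ^ 5 * w ^ 2 ≤
      ((∑ α, ∑ β, H' α α β * d β) * (κ * ∑ γ, x γ * d γ + ((n : ℝ) - 1) / 2 * κ * w) -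
      1 / 2 * κ * (∑ γ, x γ * ∑ μ, ∑ ν, H' γ μ ν * d μ * d ν) -
      κ ^ 3 * (∑ α, x α * ∑ β, (minkowski n α β + h α β) * d β) * (∑ γ, x γ * d γ) +
      κ * (∑ α, spatial α * d α * ∑ β, (minkowski n α β + h α β) * d β) +
      (((n : ℝ) - 1) / 2 * κ - 1 / 2 * κ * (∑ α : Fin (n + 1), spatial α) +
        1 / 2 * κ ^ 3 * ∑ α, x α ^ 2) *
        (∑ μ, ∑ ν, (minkowski n μ ν + h μ ν) * d μ * d ν) -
      ((n : ℝ) - 1) / 2 * κ ^ 3 * w * (∑ α, x α * ∑ β, (minkowski n α β + h α β) * d β) +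
      ((n : ℝ) - 1) / 2 * κ ^ 3 * w * (∑ γ, x γ * d γ) +
      1 / 2 * (((n : ℝ) - 1) / 2) * (κ ^ 3 * (∑ α : Fin (n + 1), spatial α) -
        3 * κ ^ 5 * ∑ α, x α ^ 2) * w ^ 2) + 10 * ((n : ℝ) + 1) ^ 3 * a * δ ^ 2 := by
  have hn3 : (3 : ℝ) ≤ n := by exact_mod_cast hn
  set N : ℝ := (n : ℝ) + 1 with hN
  have hN4 : 4 ≤ N := by linarith
  have hcard : ∀ {f : Fin (n + 1) → ℝ} {B : ℝ}, (∀ i, |f i| ≤ B) → |∑ i, f i| ≤ N * B := by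
    intro f B hf
    simpa [hN] using abs_sum_le_card_mul hf
  set c : ℝ := ((n : ℝ) - 1) / 2 with hc
  have hc1 : 1 ≤ c := by linarith
  have hcN : c ≤ N := by linarith
  have hxr : ∀ α, |x α| ≤ r := fun α => by
    have := Finset.single_le_sum (f := fun α => x α ^ 2) (fun _ _ => sq_nonneg _)
      (Finset.mem_univ α)
    rw [hx] at this
    exact abs_le_of_sq_le_sq this hr.le
  have hκr1 : κ * r ≤ 1 := by
    refine (abs_le_of_sq_le_sq' ?_ zero_le_one).2
    nlinarith [mul_nonneg (pow_pos hκ 2).le (sq_nonneg ρ)]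
  have hκρ1 : κ ^ 2 * ρ ^ 2 ≤ 1 := by nlinarith [mul_pos (pow_pos hκ 2) (pow_pos hr 2)]
  have hκr0 : 0 ≤ κ * r := by positivity
  -- splitting off the flat part
  set y : Fin (n + 1) → ℝ := fun α => ∑ β, h α β * d β with hy
  have hmd : ∀ α, ∑ β, minkowski n α β * d β = (2 * spatial α - 1) * d α := by
    intro α
    simp only [minkowski, Matrix.diagonal_apply, ite_mul, zero_mul, Finset.sum_ite_eq,
      Finset.mem_univ, if_true]
    refine Fin.cases ?_ (fun i => ?_) α
    · simp
    · simp; ring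
  have hY : ∀ α, ∑ β, (minkowski n α β + h α β) * d β = (2 * spatial α - 1) * d α + y α := by
    intro α
    simp only [add_mul, Finset.sum_add_distrib, hmd, hy]
  have hxe : ∀ α, x α * spatial α = x α := by
    intro α
    refine Fin.cases (by simp [hx0]) (fun i => by simp) α
  have hee : ∀ α : Fin (n + 1), spatial α * spatial α = spatial α := by
    intro α
    refine Fin.cases (by simp) (fun i => by simp) α
  set xd := ∑ γ, x γ * d γ with hxd
  set xy := ∑ γ, x γ * y γ with hxy
  set P := ∑ α, spatial α * d α ^ 2 with hP
  set D := ∑ α, d α ^ 2 with hD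
  have e1 : ∑ α, x α * ∑ β, (minkowski n α β + h α β) * d β = xd + xy := by
    rw [hxd, hxy, ← Finset.sum_add_distrib]
    refine Finset.sum_congr rfl fun α _ => ?_
    rw [hY]; linear_combination (2 * d α) * hxe α
  have e2 : ∑ α, spatial α * d α * ∑ β, (minkowski n α β + h α β) * d β =
      P + ∑ α, spatial α * d α * y α := by
    rw [hP, ← Finset.sum_add_distrib]
    refine Finset.sum_congr rfl fun α _ => ?_
    rw [hY]; linear_combination (2 * d α ^ 2) * hee α
  have e3 : ∑ μ, ∑ ν, (minkowski n μ ν + h μ ν) * d μ * d ν =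
      2 * P - D + ∑ α, d α * y α := by
    have : ∀ μ, ∑ ν, (minkowski n μ ν + h μ ν) * d μ * d ν =
        2 * (spatial μ * d μ ^ 2) - d μ ^ 2 + d μ * y μ := by
      intro μ
      calc _ = d μ * ∑ ν, (minkowski n μ ν + h μ ν) * d ν := by
            rw [Finset.mul_sum]; exact Finset.sum_congr rfl fun ν _ => by ring
        _ = _ := by rw [hY]; ring
    simp only [this, Finset.sum_add_distrib, Finset.sum_sub_distrib, ← Finset.mul_sum]
    rw [hP, hD]
  have hCS : xd ^ 2 ≤ r ^ 2 * P := by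
    have := Finset.sum_mul_sq_le_sq_mul_sq Finset.univ x fun α => spatial α * d α
    rw [hx] at this
    calc xd ^ 2 = (∑ α, x α * (spatial α * d α)) ^ 2 := by
          rw [hxd]; congr 1
          exact Finset.sum_congr rfl fun α _ => by rw [← mul_assoc, hxe]
      _ ≤ _ := this
      _ = r ^ 2 * P := by
          rw [hP]; congr 1
          exact Finset.sum_congr rfl fun α _ => by rw [mul_pow, sq (spatial α), hee]
  have hPD : P ≤ D := by
    refine Finset.sum_le_sum fun α _ => ?_
    refine Fin.cases (by simp [sq_nonneg]) (fun i => by simp) α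
  -- sizes of the error terms
  have by_ : ∀ α, |y α| ≤ N * (a * r * δ) := fun α => hcard fun β => by
    rw [abs_mul]; exact mul_le_mul (hh α β) (hd β) (abs_nonneg _) (by positivity)
  have bxd : |xd| ≤ N * (r * δ) := hcard fun α => by
    rw [abs_mul]; exact mul_le_mul (hxr α) (hd α) (abs_nonneg _) (by positivity)
  have bxy : |xy| ≤ N * (r * (N * (a * r * δ))) := hcard fun α => by
    rw [abs_mul]; exact mul_le_mul (hxr α) (by_ α) (abs_nonneg _) (by positivity)
  have hsp : ∀ α : Fin (n + 1), |spatial α| ≤ 1 := by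
    intro α
    refine Fin.cases (by simp) (fun i => by simp) α
  have bedy : |∑ α, spatial α * d α * y α| ≤ N * (1 * δ * (N * (a * r * δ))) := hcard fun α => by
    rw [abs_mul, abs_mul]
    exact mul_le_mul (mul_le_mul (hsp α) (hd α) (abs_nonneg _) zero_le_one) (by_ α)
      (abs_nonneg _) (by positivity)
  have bdy : |∑ α, d α * y α| ≤ N * (δ * (N * (a * r * δ))) := hcard fun α => by
    rw [abs_mul]; exact mul_le_mul (hd α) (by_ α) (abs_nonneg _) (by positivity)
  have bH1 : |∑ α, ∑ β, H' α α β * d β| ≤ N * (N * (a * δ)) := hcard fun α => hcard fun β => by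
    rw [abs_mul]; exact mul_le_mul (hH' α α β) (hd β) (abs_nonneg _) ha
  have bH2 : |∑ γ, x γ * ∑ μ, ∑ ν, H' γ μ ν * d μ * d ν| ≤ N * (r * (N * (N * (a * δ * δ)))) :=
    hcard fun γ => by
      rw [abs_mul]
      refine mul_le_mul (hxr γ) (hcard fun μ => hcard fun ν => ?_) (abs_nonneg _) (by positivity)
      rw [abs_mul, abs_mul]
      exact mul_le_mul (mul_le_mul (hH' γ μ ν) (hd μ) (abs_nonneg _) ha) (hd ν) (abs_nonneg _)
        (by positivity)
  set T := N ^ 3 * a * δ ^ 2 with hT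
  have hT0 : 0 ≤ T := by positivity
  have hNT : N ^ 2 * a * δ ^ 2 ≤ T := by
    have : N ^ 2 ≤ N ^ 3 := pow_le_pow_right₀ (by linarith) (by norm_num)
    rw [hT]; gcongr
  have bS : |κ * xd + c * κ * w| ≤ 2 * N * δ := by
    have h1 : |κ * xd| ≤ N * δ := by
      rw [abs_mul, abs_of_pos hκ]
      calc κ * |xd| ≤ κ * (N * (r * δ)) := by gcongr
        _ = (κ * r) * (N * δ) := by ring
        _ ≤ 1 * (N * δ) := by gcongr
        _ = N * δ := one_mul _
    have h2 : |c * κ * w| ≤ N * δ := by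
      rw [abs_mul, abs_mul, abs_of_pos hκ, abs_of_pos (by linarith)]
      calc c * κ * |w| ≤ c * κ * (r * δ) := by gcongr
        _ = (κ * r) * (c * δ) := by ring
        _ ≤ 1 * (N * δ) := by gcongr
        _ = N * δ := one_mul _
    linarith [abs_add_le (κ * xd) (c * κ * w)]
  have r1 : |(∑ α, ∑ β, H' α α β * d β) * (κ * xd + c * κ * w)| ≤ 2 * T := by
    rw [abs_mul]
    calc _ ≤ N * (N * (a * δ)) * (2 * N * δ) := by gcongr
      _ = 2 * T := by rw [hT]; ring
  have r2 : |1 / 2 * κ * ∑ γ, x γ * ∑ μ, ∑ ν, H' γ μ ν * d μ * d ν| ≤ T := by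
    rw [abs_mul, abs_of_pos (by positivity)]
    calc _ ≤ 1 / 2 * κ * (N * (r * (N * (N * (a * δ * δ))))) := by gcongr
      _ = (κ * r) * (1 / 2 * T) := by rw [hT]; ring
      _ ≤ 1 * (1 / 2 * T) := by gcongr
      _ ≤ T := by linarith
  have r3 : |κ ^ 3 * xy * xd| ≤ T := by
    rw [abs_mul, abs_mul, abs_of_pos (pow_pos hκ 3)]
    calc _ ≤ κ ^ 3 * (N * (r * (N * (a * r * δ)))) * (N * (r * δ)) := by gcongr
      _ = (κ * r) ^ 3 * T := by rw [hT]; ring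
      _ ≤ 1 ^ 3 * T := by gcongr
      _ = T := by ring
  have r4 : |κ * ∑ α, spatial α * d α * y α| ≤ T := by
    rw [abs_mul, abs_of_pos hκ]
    calc _ ≤ κ * (N * (1 * δ * (N * (a * r * δ)))) := by gcongr
      _ = (κ * r) * (N ^ 2 * a * δ ^ 2) := by ring
      _ ≤ 1 * T := by gcongr
      _ = T := one_mul _
  have r5 : |1 / 2 * κ ^ 3 * ρ ^ 2 * ∑ α, d α * y α| ≤ T := by
    rw [abs_mul, abs_of_nonneg (by positivity)]
    calc _ ≤ 1 / 2 * κ ^ 3 * ρ ^ 2 * (N * (δ * (N * (a * r * δ)))) := by gcongr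
      _ = (κ ^ 2 * ρ ^ 2) * ((κ * r) * (1 / 2 * (N ^ 2 * a * δ ^ 2))) := by ring
      _ ≤ 1 * (1 * (1 / 2 * T)) := by gcongr
      _ ≤ T := by linarith
  have r6 : |c * κ ^ 3 * w * xy| ≤ T := by
    rw [abs_mul, abs_mul, abs_mul, abs_of_pos (pow_pos hκ 3), abs_of_pos (by linarith)]
    calc _ ≤ N * κ ^ 3 * (r * δ) * (N * (r * (N * (a * r * δ)))) := by gcongr
      _ = (κ * r) ^ 3 * T := by rw [hT]; ring
      _ ≤ 1 ^ 3 * T := by gcongr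
      _ = T := by ring
  -- coercivity of the flat part
  have m1 : ρ ^ 2 * κ ^ 3 * P ≤ κ * P - κ ^ 3 * xd ^ 2 := by
    have : κ ^ 3 * xd ^ 2 ≤ κ ^ 3 * (r ^ 2 * P) := by gcongr
    linear_combination this + κ * P * hκr
  have m2 : 3 / 2 * ρ ^ 2 * κ ^ 5 * w ^ 2 ≤
      1 / 2 * c * (κ ^ 3 * n - 3 * κ ^ 5 * r ^ 2) * w ^ 2 := by
    have h1 : κ ^ 3 * n - 3 * κ ^ 5 * r ^ 2 = κ ^ 5 * (n * ρ ^ 2 + (n - 3) * r ^ 2) := by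
      linear_combination (-(κ ^ 3 * n)) * hκr
    have h2 : 3 * ρ ^ 2 ≤ n * ρ ^ 2 + (n - 3) * r ^ 2 := by
      nlinarith [sq_nonneg ρ, sq_nonneg r]
    rw [h1]
    have h3 : κ ^ 5 * (3 * ρ ^ 2) ≤ κ ^ 5 * (n * ρ ^ 2 + (n - 3) * r ^ 2) := by gcongr
    have h4 : 1 * (κ ^ 5 * (3 * ρ ^ 2)) ≤ c * (κ ^ 5 * (n * ρ ^ 2 + (n - 3) * r ^ 2)) :=
      mul_le_mul hc1 h3 (by positivity) (by linarith)
    nlinarith [mul_le_mul_of_nonneg_right h4 (sq_nonneg w)]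
  have m3 : c * κ - 1 / 2 * κ * n + 1 / 2 * κ ^ 3 * r ^ 2 = -(1 / 2 * κ ^ 3 * ρ ^ 2) := by
    rw [hc]; linear_combination (1 / 2 * κ) * hκr
  rw [e1, e2, e3, hx, sum_spatial, m3]
  have hT10 : 10 * N ^ 3 * a * δ ^ 2 = 10 * T := by rw [hT]; ring
  rw [hT10]
  have a1 := (abs_le.1 r1).1
  have a2 := (abs_le.1 r2).2
  have a3 := (abs_le.1 r3).2
  have a4 := (abs_le.1 r4).1
  have a5 := (abs_le.1 r5).2
  have a6 := (abs_le.1 r6).2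
  have b1 : κ ^ 3 * (xd + xy) * xd = κ ^ 3 * xd ^ 2 + κ ^ 3 * xy * xd := by ring
  have b2 : κ * (P + ∑ α, spatial α * d α * y α) =
    κ * P + κ * ∑ α, spatial α * d α * y α := by ring
  have b3 : -(1 / 2 * κ ^ 3 * ρ ^ 2) * (2 * P - D + ∑ α, d α * y α) =
    -(ρ ^ 2 * κ ^ 3 * P) + 1 / 2 * ρ ^ 2 * κ ^ 3 * D -
      1 / 2 * κ ^ 3 * ρ ^ 2 * ∑ α, d α * y α := by ring
  have b4 : c * κ ^ 3 * w * (xd + xy) = c * κ ^ 3 * w * xd + c * κ ^ 3 * w * xy := by ring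
  rw [b1, b2, b3, b4]
  linarith

end MultiplierEstimate

section MultiplierField

variable {K : Set (Space n)}

/-- The energy density `|∂w|² + w² / r²`. -/
def dens (K : Set (Space n)) (w : Spacetime n → ℝ) (p : Spacetime n) : ℝ :=
  ∑ α, pd (region K) α w p ^ 2 + w p ^ 2 / ‖p.2‖ ^ 2

/-- The multiplier `S = κ x · ∇w + (n - 1)/2 κ w`, where `κ = (r² + ρ²)^{-1/2}`. -/
def mult (K : Set (Space n)) (ρ : ℝ) (w : Spacetime n → ℝ) (p : Spacetime n) : ℝ :=
  kap ρ p * ∑ γ, coord γ p * pd (region K) γ w p + ((n : ℝ) - 1) / 2 * kap ρ p * w p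

/-- The current `H^{αβ} ∂_β w S - ½ κ x^α H^{μν} ∂_μ w ∂_ν w + ½ (n - 1)/2 x^α κ³ w²`. -/
def current (K : Set (Space n)) (ρ : ℝ) (H : TensorField n) (w : Spacetime n → ℝ)
    (α : Fin (n + 1)) (p : Spacetime n) : ℝ :=
  (∑ β, H p α β * pd (region K) β w p) * mult K ρ w p -
    1 / 2 * ((coord α p * kap ρ p) *
      ∑ μ, ∑ ν, H p μ ν * pd (region K) μ w p * pd (region K) ν w p) +
    1 / 2 * (((n : ℝ) - 1) / 2) * (coord α p * kap ρ p ^ 3 * w p ^ 2)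

lemma dens_nonneg (w : Spacetime n → ℝ) (p : Spacetime n) : 0 ≤ dens K w p := by
  unfold dens; positivity

lemma abs_pd_le_sqrt_dens (w : Spacetime n → ℝ) (p : Spacetime n) (α : Fin (n + 1)) :
    |pd (region K) α w p| ≤ Real.sqrt (dens K w p) := by
  refine Real.abs_le_sqrt ?_
  have := Finset.single_le_sum (f := fun α => pd (region K) α w p ^ 2) (fun _ _ => sq_nonneg _)
    (Finset.mem_univ α)
  have h : 0 ≤ w p ^ 2 / ‖p.2‖ ^ 2 := by positivity
  unfold dens; linarith

lemma abs_le_norm_mul_sqrt_dens (w : Spacetime n → ℝ) (p : Spacetime n) (hp : 0 < ‖p.2‖) :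
    |w p| ≤ ‖p.2‖ * Real.sqrt (dens K w p) := by
  have h : |w p / ‖p.2‖| ≤ Real.sqrt (dens K w p) := by
    refine Real.abs_le_sqrt ?_
    have : 0 ≤ ∑ α, pd (region K) α w p ^ 2 := by positivity
    unfold dens; rw [div_pow]; linarith
  rwa [abs_div, abs_of_pos hp, div_le_iff₀ hp, mul_comm] at h

lemma smoothOn_mult (hK : IsClosed K) {ρ : ℝ} (hρ : 0 < ρ) {w : Spacetime n → ℝ}
    (hw : SmoothOn K w) : SmoothOn K (mult K ρ w) := by
  have hκ : SmoothOn K (kap ρ) := (contDiff_kap hρ).contDiffOn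
  exact (hκ.mul (ContDiffOn.sum fun γ _ => (contDiff_coord γ).contDiffOn.mul (hw.pd hK γ))).add
    ((contDiffOn_const.mul hκ).mul hw)

lemma smoothOn_current (hK : IsClosed K) {ρ : ℝ} (hρ : 0 < ρ) {H : TensorField n}
    (hH : SmoothTensor K H) {w : Spacetime n → ℝ} (hw : SmoothOn K w) (α : Fin (n + 1)) :
    SmoothOn K (current K ρ H w α) := by
  have hκ : SmoothOn K (kap ρ) := (contDiff_kap hρ).contDiffOn
  have hx : SmoothOn K (coord α) := (contDiff_coord α).contDiffOn
  exact (((ContDiffOn.sum fun β _ => (hH α β).mul (hw.pd hK β)).mul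
    (smoothOn_mult hK hρ hw)).sub (contDiffOn_const.mul ((hx.mul hκ).mul
      (ContDiffOn.sum fun μ _ => ContDiffOn.sum fun ν _ =>
        ((hH μ ν).mul (hw.pd hK μ)).mul (hw.pd hK ν))))).add
    (contDiffOn_const.mul ((hx.mul (hκ.pow 3)).mul (hw.pow 2)))

lemma pd_sub (hK : IsClosed K) {f g : Spacetime n → ℝ} (hf : SmoothOn K f) (hg : SmoothOn K g)
    (α : Fin (n + 1)) {p : Spacetime n} (hp : p ∈ region K) :
    pd (region K) α (fun q => f q - g q) p = pd (region K) α f p - pd (region K) α g p := by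
  simp only [pd]
  rw [fderivWithin_fun_sub (uniqueDiffOn_region hK p hp) (hf.diffWithinAt hp)
    (hg.diffWithinAt hp)]
  rfl

lemma pd_pow (hK : IsClosed K) {f : Spacetime n → ℝ} (hf : SmoothOn K f) (j : ℕ)
    (α : Fin (n + 1)) {p : Spacetime n} (hp : p ∈ region K) :
    pd (region K) α (fun q => f q ^ j) p = j * f p ^ (j - 1) * pd (region K) α f p :=
  pd_comp hK hf α hp (hasDerivAt_pow j (f p))

lemma pd_mult (hK : IsClosed K) {ρ : ℝ} (hρ : 0 < ρ) {w : Spacetime n → ℝ}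
    (hw : SmoothOn K w) (α : Fin (n + 1)) {p : Spacetime n} (hp : p ∈ region K) :
    pd (region K) α (mult K ρ w) p =
      -coord α p * kap ρ p ^ 3 * (∑ γ, coord γ p * pd (region K) γ w p) +
      kap ρ p * (spatial α * pd (region K) α w p +
        ∑ γ, coord γ p * pd (region K) α (pd (region K) γ w) p) +
      ((n : ℝ) - 1) / 2 * (-coord α p * kap ρ p ^ 3) * w p +
      ((n : ℝ) - 1) / 2 * kap ρ p * pd (region K) α w p := by
  have hκ : SmoothOn K (kap ρ) := (contDiff_kap hρ).contDiffOn
  have hx : ∀ γ, SmoothOn K (coord γ) := fun γ => (contDiff_coord γ).contDiffOn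
  have hs : SmoothOn K fun q => ∑ γ, coord γ q * pd (region K) γ w q :=
    ContDiffOn.sum fun γ _ => (hx γ).mul (hw.pd hK γ)
  have e1 : pd (region K) α (fun q => ∑ γ, coord γ q * pd (region K) γ w q) p =
      spatial α * pd (region K) α w p +
        ∑ γ, coord γ p * pd (region K) α (pd (region K) γ w) p := by
    rw [pd_sum hK _ (fun γ _ => (hx γ).mul (hw.pd hK γ)) α hp,
      Finset.sum_congr rfl fun γ _ => pd_mul hK (hx γ) (hw.pd hK γ) α hp,
      Finset.sum_add_distrib]
    simp only [pd_coord hK _ α hp, ite_mul, zero_mul, Finset.sum_ite_eq, Finset.mem_univ, if_true]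
  rw [show mult K ρ w = fun q => kap ρ q * ∑ γ, coord γ q * pd (region K) γ w q +
    ((n : ℝ) - 1) / 2 * kap ρ q * w q from rfl,
    pd_add hK (hκ.mul hs) ((contDiffOn_const.mul hκ).mul hw) α hp, pd_mul hK hκ hs α hp, e1,
    pd_mul hK (contDiffOn_const.mul hκ) hw α hp, pd_const_mul hK hκ _ α hp, pd_kap hK hρ α hp]
  ring

lemma pd_current (hK : IsClosed K) {ρ : ℝ} (hρ : 0 < ρ) {H : TensorField n}
    (hH : SmoothTensor K H) {w : Spacetime n → ℝ} (hw : SmoothOn K w) (α : Fin (n + 1))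
    {p : Spacetime n} (hp : p ∈ region K) :
    pd (region K) α (current K ρ H w α) p =
      (∑ β, (pd (region K) α (fun q => H q α β) p * pd (region K) β w p +
        H p α β * pd (region K) α (pd (region K) β w) p)) *
        (kap ρ p * ∑ γ, coord γ p * pd (region K) γ w p + ((n : ℝ) - 1) / 2 * kap ρ p * w p) +
      (∑ β, H p α β * pd (region K) β w p) *
        (-coord α p * kap ρ p ^ 3 * (∑ γ, coord γ p * pd (region K) γ w p) +
        kap ρ p * (spatial α * pd (region K) α w p +
          ∑ γ, coord γ p * pd (region K) α (pd (region K) γ w) p) +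
        ((n : ℝ) - 1) / 2 * (-coord α p * kap ρ p ^ 3) * w p +
        ((n : ℝ) - 1) / 2 * kap ρ p * pd (region K) α w p) -
      1 / 2 * ((-coord α p * kap ρ p ^ 3 * coord α p + kap ρ p * spatial α) *
          (∑ μ, ∑ ν, H p μ ν * pd (region K) μ w p * pd (region K) ν w p) +
        kap ρ p * coord α p * ∑ μ, ∑ ν,
          (pd (region K) α (fun q => H q μ ν) p * pd (region K) μ w p * pd (region K) ν w p +
          H p μ ν * (pd (region K) α (pd (region K) μ w) p * pd (region K) ν w p +
            pd (region K) μ w p * pd (region K) α (pd (region K) ν w) p))) +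
      1 / 2 * (((n : ℝ) - 1) / 2) * (spatial α * kap ρ p ^ 3 * w p ^ 2 +
        coord α p * (3 * kap ρ p ^ 2 * (-coord α p * kap ρ p ^ 3)) * w p ^ 2 +
        coord α p * kap ρ p ^ 3 * (2 * w p * pd (region K) α w p)) := by
  have hκ : SmoothOn K (kap ρ) := (contDiff_kap hρ).contDiffOn
  have hx : SmoothOn K (coord α) := (contDiff_coord α).contDiffOn
  have hd := fun β => hw.pd hK β
  have hY : SmoothOn K fun q => ∑ β, H q α β * pd (region K) β w q :=
    ContDiffOn.sum fun β _ => (hH α β).mul (hd β)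
  have hE : SmoothOn K fun q =>
      ∑ μ, ∑ ν, H q μ ν * pd (region K) μ w q * pd (region K) ν w q :=
    ContDiffOn.sum fun μ _ => ContDiffOn.sum fun ν _ => ((hH μ ν).mul (hd μ)).mul (hd ν)
  have hS := smoothOn_mult hK hρ hw
  have eY : pd (region K) α (fun q => ∑ β, H q α β * pd (region K) β w q) p =
      ∑ β, (pd (region K) α (fun q => H q α β) p * pd (region K) β w p +
        H p α β * pd (region K) α (pd (region K) β w) p) := by
    rw [pd_sum hK _ (fun β _ => (hH α β).mul (hd β)) α hp]
    exact Finset.sum_congr rfl fun β _ => pd_mul hK (hH α β) (hd β) α hp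
  have eE : pd (region K) α
      (fun q => ∑ μ, ∑ ν, H q μ ν * pd (region K) μ w q * pd (region K) ν w q) p =
      ∑ μ, ∑ ν, (pd (region K) α (fun q => H q μ ν) p * pd (region K) μ w p *
          pd (region K) ν w p +
        H p μ ν * (pd (region K) α (pd (region K) μ w) p * pd (region K) ν w p +
          pd (region K) μ w p * pd (region K) α (pd (region K) ν w) p)) := by
    rw [pd_sum hK _ (fun μ _ => ContDiffOn.sum fun ν _ => ((hH μ ν).mul (hd μ)).mul (hd ν)) α hp]
    refine Finset.sum_congr rfl fun μ _ => ?_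
    rw [pd_sum hK _ (fun ν _ => ((hH μ ν).mul (hd μ)).mul (hd ν)) α hp]
    refine Finset.sum_congr rfl fun ν _ => ?_
    rw [pd_mul hK ((hH μ ν).mul (hd μ)) (hd ν) α hp, pd_mul hK (hH μ ν) (hd μ) α hp]
    ring
  rw [show current K ρ H w α = fun q => (∑ β, H q α β * pd (region K) β w q) * mult K ρ w q -
    1 / 2 * ((coord α q * kap ρ q) *
      ∑ μ, ∑ ν, H q μ ν * pd (region K) μ w q * pd (region K) ν w q) +
    1 / 2 * (((n : ℝ) - 1) / 2) * (coord α q * kap ρ q ^ 3 * w q ^ 2) from rfl,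
    pd_add hK ((hY.mul hS).sub (contDiffOn_const.mul ((hx.mul hκ).mul hE)))
      (contDiffOn_const.mul ((hx.mul (hκ.pow 3)).mul (hw.pow 2))) α hp,
    pd_sub hK (hY.mul hS) (contDiffOn_const.mul ((hx.mul hκ).mul hE)) α hp,
    pd_mul hK hY hS α hp, pd_const_mul hK ((hx.mul hκ).mul hE) _ α hp,
    pd_mul hK (hx.mul hκ) hE α hp, pd_mul hK hx hκ α hp,
    pd_const_mul hK ((hx.mul (hκ.pow 3)).mul (hw.pow 2)) _ α hp,
    pd_mul hK (hx.mul (hκ.pow 3)) (hw.pow 2) α hp, pd_mul hK hx (hκ.pow 3) α hp,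
    pd_pow hK hκ 3 α hp, pd_pow hK hw 2 α hp, eY, eE, pd_mult hK hρ hw α hp, pd_kap hK hρ α hp,
    pd_coord hK α α hp, if_pos rfl, mult]
  push_cast
  ring

/-- The divergence of the current controls the local energy density at scale `ρ`. -/
lemma le_div_current (hn : 3 ≤ n) (hK : IsClosed K) {ρ : ℝ} (hρ : 0 < ρ) {H : TensorField n}
    (hH : SmoothTensor K H) {w : Spacetime n → ℝ} (hw : SmoothOn K w)
    {p : Spacetime n} (hp : p ∈ region K) (hr : 0 < ‖p.2‖) (hsymm : ∀ α β, H p α β = H p β α)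
    {a : ℝ} (ha : 0 ≤ a) (hh : ∀ α β, |H p α β - minkowski n α β| ≤ a * ‖p.2‖)
    (hH' : ∀ γ α β, |pd (region K) γ (fun q => H q α β) p| ≤ a) :
    1 / 2 * ρ ^ 2 * kap ρ p ^ 3 * ∑ α, pd (region K) α w p ^ 2 +
        3 / 2 * ρ ^ 2 * kap ρ p ^ 5 * w p ^ 2 ≤
      ∑ α, pd (region K) α (current K ρ H w α) p -
        (∑ α, ∑ β, H p α β * pd (region K) α (pd (region K) β w) p) * mult K ρ w p +
        10 * ((n : ℝ) + 1) ^ 3 * a * dens K w p := by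
  have h1 := multiplier_algebra (fun α => coord α p) (fun α => pd (region K) α w p) spatial
    (fun α β => pd (region K) α (pd (region K) β w) p) (fun α β => H p α β)
    (fun γ α β => pd (region K) γ (fun q => H q α β) p) (kap ρ p) (((n : ℝ) - 1) / 2) (w p)
    (fun α β => pd_comm hK hw α β hp) hsymm
  have h2 := multiplier_positivity hn (fun α => coord α p) (fun α => pd (region K) α w p)
    (fun α β => H p α β - minkowski n α β)
    (fun γ α β => pd (region K) γ (fun q => H q α β) p) (kap ρ p) ρ (w p) ‖p.2‖ a
    (Real.sqrt (dens K w p)) (kap_pos hρ p) hr (kap_sq_mul hρ p) (coord_zero p) (sum_coord_sq p)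
    ha (Real.sqrt_nonneg _) hh hH' (abs_pd_le_sqrt_dens w p) (abs_le_norm_mul_sqrt_dens w p hr)
  rw [Finset.sum_congr rfl fun α _ => pd_current hK hρ hH hw α hp, h1]
  rw [Real.sq_sqrt (dens_nonneg w p)] at h2
  simp only [add_sub_cancel] at h2
  rw [mult]
  refine h2.trans (le_of_eq ?_)
  ring

lemma dens_le_of_annulus {ρ : ℝ} (hρ : 0 < ρ) {w : Spacetime n → ℝ} {p : Spacetime n}
    (h1 : ρ / 2 ≤ ‖p.2‖) (h2 : ‖p.2‖ ≤ 2 * ρ) :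
    ρ⁻¹ * dens K w p ≤ 648 * (1 / 2 * ρ ^ 2 * kap ρ p ^ 3 * ∑ α, pd (region K) α w p ^ 2 +
        3 / 2 * ρ ^ 2 * kap ρ p ^ 5 * w p ^ 2) := by
  have hr : 0 < ‖p.2‖ := by linarith
  have hk := kap_pos hρ p
  set κ := kap ρ p
  have hsq := kap_sq_mul hρ p
  have h3 : 1 / 3 ≤ κ * ρ := by
    refine (abs_le_of_sq_le_sq' ?_ (by positivity)).2
    have : κ ^ 2 * (‖p.2‖ ^ 2 + ρ ^ 2) ≤ κ ^ 2 * ((2 * ρ) ^ 2 + ρ ^ 2) := by gcongr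
    nlinarith
  have e1 : 1 / 27 * ρ⁻¹ ≤ ρ ^ 2 * κ ^ 3 := by
    calc 1 / 27 * ρ⁻¹ = (1 / 3) ^ 3 * ρ⁻¹ := by norm_num
      _ ≤ (κ * ρ) ^ 3 * ρ⁻¹ := by gcongr
      _ = ρ ^ 2 * κ ^ 3 := by field_simp
  have e2 : 1 / 972 * (ρ⁻¹ * (1 / ‖p.2‖ ^ 2)) ≤ ρ ^ 2 * κ ^ 5 := by
    have : 1 / ‖p.2‖ ^ 2 ≤ 1 / (ρ / 2) ^ 2 := by gcongr
    calc 1 / 972 * (ρ⁻¹ * (1 / ‖p.2‖ ^ 2)) ≤ 1 / 972 * (ρ⁻¹ * (1 / (ρ / 2) ^ 2)) := by gcongr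
      _ = (1 / 3) ^ 5 * (ρ⁻¹) ^ 3 := by field_simp; norm_num
      _ ≤ (κ * ρ) ^ 5 * (ρ⁻¹) ^ 3 := by gcongr
      _ = ρ ^ 2 * κ ^ 5 := by field_simp
  have hS : 0 ≤ ∑ α, pd (region K) α w p ^ 2 := by positivity
  have f1 := mul_le_mul_of_nonneg_right e1 hS
  have f2 := mul_le_mul_of_nonneg_right e2 (sq_nonneg (w p))
  have e : ρ⁻¹ * dens K w p = ρ⁻¹ * (∑ α, pd (region K) α w p ^ 2) +
      ρ⁻¹ * (1 / ‖p.2‖ ^ 2) * w p ^ 2 := by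
    unfold dens; ring
  have h0 : 0 ≤ ρ⁻¹ * ∑ α, pd (region K) α w p ^ 2 := by positivity
  rw [e]
  linarith

lemma abs_mult_le (hn : 1 ≤ n) {ρ : ℝ} (hρ : 0 < ρ) (w : Spacetime n → ℝ) {p : Spacetime n}
    (hr : 0 < ‖p.2‖) : |mult K ρ w p| ≤ 2 * ((n : ℝ) + 1) * Real.sqrt (dens K w p) := by
  have hn1 : (1 : ℝ) ≤ n := by exact_mod_cast hn
  have hk := kap_pos hρ p
  have hkr := kap_mul_norm_le hρ p
  set δ := Real.sqrt (dens K w p) with hδ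
  have hδ0 : 0 ≤ δ := Real.sqrt_nonneg _
  have h1 : |∑ γ, coord γ p * pd (region K) γ w p| ≤ ((n : ℝ) + 1) * (‖p.2‖ * δ) := by
    have := abs_sum_le_card_mul (f := fun γ => coord γ p * pd (region K) γ w p)
      (B := ‖p.2‖ * δ) fun γ => by
        rw [abs_mul]
        exact mul_le_mul (abs_coord_le γ p) (abs_pd_le_sqrt_dens w p γ) (abs_nonneg _)
          (norm_nonneg _)
    simpa using this
  have h2 := abs_le_norm_mul_sqrt_dens (K := K) w p hr
  have h3 : |kap ρ p * ∑ γ, coord γ p * pd (region K) γ w p| ≤ ((n : ℝ) + 1) * δ := by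
    rw [abs_mul, abs_of_pos hk]
    calc _ ≤ kap ρ p * (((n : ℝ) + 1) * (‖p.2‖ * δ)) := by gcongr
      _ = (kap ρ p * ‖p.2‖) * (((n : ℝ) + 1) * δ) := by ring
      _ ≤ 1 * (((n : ℝ) + 1) * δ) := by gcongr
      _ = _ := one_mul _
  have h4 : |((n : ℝ) - 1) / 2 * kap ρ p * w p| ≤ ((n : ℝ) + 1) * δ := by
    have h0 : 0 ≤ ((n : ℝ) - 1) / 2 := by linarith
    rw [abs_mul, abs_mul, abs_of_pos hk, abs_of_nonneg h0]
    calc _ ≤ ((n : ℝ) - 1) / 2 * kap ρ p * (‖p.2‖ * δ) := by gcongr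
      _ = (kap ρ p * ‖p.2‖) * (((n : ℝ) - 1) / 2 * δ) := by ring
      _ ≤ 1 * (((n : ℝ) + 1) * δ) := by
        gcongr
        linarith
      _ = _ := one_mul _
  exact (abs_add_le _ _).trans (by linarith)

lemma abs_current_le (hn : 1 ≤ n) {ρ : ℝ} (hρ : 0 < ρ) {H : TensorField n} (w : Spacetime n → ℝ)
    {p : Spacetime n} (hr : 0 < ‖p.2‖) {A : ℝ} (hA : ∀ α β, |H p α β| ≤ A) (α : Fin (n + 1)) :
    |current K ρ H w α p| ≤ 4 * ((n : ℝ) + 1) ^ 2 * (A + 1) * dens K w p := by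
  have hn1 : (1 : ℝ) ≤ n := by exact_mod_cast hn
  have hk := kap_pos hρ p
  have hkr := kap_mul_norm_le hρ p
  have hkr0 : 0 ≤ kap ρ p * ‖p.2‖ := by positivity
  have hA0 : 0 ≤ A := (abs_nonneg _).trans (hA 0 0)
  have hS := abs_mult_le (K := K) hn hρ w hr
  have hw := abs_le_norm_mul_sqrt_dens (K := K) w p hr
  have hd := abs_pd_le_sqrt_dens (K := K) w p
  have hsq := Real.sq_sqrt (dens_nonneg (K := K) w p)
  set δ := Real.sqrt (dens K w p)
  have hδ0 : 0 ≤ δ := Real.sqrt_nonneg _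
  have hcard : ∀ {f : Fin (n + 1) → ℝ} {B : ℝ}, (∀ i, |f i| ≤ B) →
      |∑ i, f i| ≤ ((n : ℝ) + 1) * B := by
    intro f B hf
    simpa using abs_sum_le_card_mul hf
  set N : ℝ := (n : ℝ) + 1 with hN
  have hY : |∑ β, H p α β * pd (region K) β w p| ≤ N * (A * δ) := hcard fun β => by
    rw [abs_mul]; exact mul_le_mul (hA α β) (hd β) (abs_nonneg _) hA0
  have hE : |∑ μ, ∑ ν, H p μ ν * pd (region K) μ w p * pd (region K) ν w p| ≤
      N * (N * (A * δ * δ)) := hcard fun μ => hcard fun ν => by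
    rw [abs_mul, abs_mul]
    exact mul_le_mul (mul_le_mul (hA μ ν) (hd μ) (abs_nonneg _) hA0) (hd ν) (abs_nonneg _)
      (by positivity)
  have t1 : |(∑ β, H p α β * pd (region K) β w p) * mult K ρ w p| ≤ 2 * N ^ 2 * A * δ ^ 2 := by
    rw [abs_mul]
    calc _ ≤ N * (A * δ) * (2 * N * δ) := by gcongr
      _ = _ := by ring
  have hx : |coord α p * kap ρ p| ≤ 1 := by
    rw [abs_mul, abs_of_pos hk, mul_comm]
    exact (mul_le_mul_of_nonneg_left (abs_coord_le α p) hk.le).trans hkr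
  have t2 : |1 / 2 * ((coord α p * kap ρ p) *
      ∑ μ, ∑ ν, H p μ ν * pd (region K) μ w p * pd (region K) ν w p)| ≤ N ^ 2 * A * δ ^ 2 := by
    rw [abs_mul, abs_mul, abs_of_pos (by norm_num : (0 : ℝ) < 1 / 2)]
    calc _ ≤ 1 * (1 * (N * (N * (A * δ * δ)))) := by gcongr; norm_num
      _ = _ := by ring
  have t3 : |1 / 2 * (((n : ℝ) - 1) / 2) * (coord α p * kap ρ p ^ 3 * w p ^ 2)| ≤
      N * δ ^ 2 := by
    have h0 : 0 ≤ 1 / 2 * (((n : ℝ) - 1) / 2) := by linarith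
    rw [abs_mul, abs_of_nonneg h0, show coord α p * kap ρ p ^ 3 * w p ^ 2 =
      (coord α p * kap ρ p) * (kap ρ p * w p) ^ 2 by ring, abs_mul, abs_pow, abs_mul (kap ρ p),
      abs_of_pos hk]
    have : kap ρ p * |w p| ≤ δ := by
      calc _ ≤ kap ρ p * (‖p.2‖ * δ) := by gcongr
        _ = (kap ρ p * ‖p.2‖) * δ := by ring
        _ ≤ 1 * δ := by gcongr
        _ = δ := one_mul _
    calc _ ≤ N * (1 * δ ^ 2) := by
          gcongr
          linarith
      _ = _ := by ring
  have hN2 : N ≤ N ^ 2 := by nlinarith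
  have hN3 : N * δ ^ 2 ≤ N ^ 2 * δ ^ 2 := by gcongr
  have hp1 : 0 ≤ N ^ 2 * A * δ ^ 2 := by positivity
  have hp2 : 0 ≤ N ^ 2 * δ ^ 2 := by positivity
  refine (abs_add_le _ _).trans ((add_le_add_left (abs_sub _ _) _).trans ?_)
  calc
    _ ≤ 2 * N ^ 2 * A * δ ^ 2 + N ^ 2 * A * δ ^ 2 + N * δ ^ 2 := by gcongr
    _ ≤ 4 * N ^ 2 * (A + 1) * δ ^ 2 := by nlinarith
    _ = _ := by rw [hsq]

end MultiplierField

/-! ### The divergence theorem and space-time cutoffs -/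

section Divergence

lemma integral_fderiv_eq_zero_of_hasCompactSupport {E : Type*} [NormedAddCommGroup E]
    [NormedSpace ℝ E] [FiniteDimensional ℝ E] [MeasurableSpace E] [BorelSpace E]
    {μ : Measure E} [μ.IsAddHaarMeasure] {f : E → ℝ} (hf : ContDiff ℝ 1 f)
    (hc : HasCompactSupport f) (v : E) :
    Integrable (fun x => fderiv ℝ f x v) μ ∧ ∫ x, fderiv ℝ f x v ∂μ = 0 := by
  have h1 : Integrable (fun x => fderiv ℝ f x v) μ :=
    ((hf.continuous_fderiv one_ne_zero).clm_apply continuous_const).integrable_of_hasCompactSupport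
      (hc.fderiv_apply ℝ v)
  have h2 : Integrable f μ := hf.continuous.integrable_of_hasCompactSupport hc
  refine ⟨h1, ?_⟩
  have := integral_mul_fderiv_eq_neg_fderiv_mul_of_integrable (μ := μ) (f := fun _ : E => (1 : ℝ))
    (g := f) (v := v) (by simp) (by simpa using h1) (by simpa using h2)
    (fun _ _ => differentiableAt_const _) (fun x _ => hf.differentiable one_ne_zero x)
  simpa using this

instance isAddHaarMeasure_volume_spacetime :
    (volume : Measure (Spacetime n)).IsAddHaarMeasure :=
  inferInstanceAs ((volume : Measure ℝ).prod (volume : Measure (Space n))).IsAddHaarMeasure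

variable {K : Set (Space n)}

/-- The divergence theorem on an open part `Ω` of the region, for a smooth function cut off by a
test function supported in `Ω`. -/
lemma integral_pd_mul_eq_zero (hK : IsClosed K) {Ω : Set (Spacetime n)} (hΩ : IsOpen Ω)
    (hΩK : Ω ⊆ region K) {ζ B : Spacetime n → ℝ} (hζ : ContDiff ℝ ∞ ζ) (hc : HasCompactSupport ζ)
    (hsupp : tsupport ζ ⊆ Ω) (hB : SmoothOn K B) (α : Fin (n + 1)) :
    Integrable (fun p => pd (region K) α ζ p * B p + ζ p * pd (region K) α B p)
      (volume.restrict Ω) ∧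
    ∫ p in Ω, (pd (region K) α ζ p * B p + ζ p * pd (region K) α B p) = 0 := by
  set f : Spacetime n → ℝ := fun p => ζ p * B p with hf
  have hfc : HasCompactSupport f := hc.mul_right
  have hfs : tsupport f ⊆ Ω := (tsupport_mul_subset_left).trans hsupp
  have hfd : ContDiff ℝ 1 f := by
    rw [contDiff_iff_contDiffAt]
    intro p
    by_cases hp : p ∈ Ω
    · have h1 : ContDiffAt ℝ ∞ B p := hB.contDiffAt
        (Filter.mem_of_superset (hΩ.mem_nhds hp) hΩK)
      exact (hζ.contDiffAt.mul h1).of_le (by simp)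
    · have h1 : f =ᶠ[nhds p] fun _ => 0 :=
        notMem_tsupport_iff_eventuallyEq.1 fun h => hp (hfs h)
      exact contDiffAt_const.congr_of_eventuallyEq h1
  obtain ⟨i1, i2⟩ := integral_fderiv_eq_zero_of_hasCompactSupport (μ := volume) hfd hfc (dir α)
  have hζ' : SmoothOn K ζ := hζ.contDiffOn
  have e : Set.EqOn (fun p => fderiv ℝ f p (dir α))
      (fun p => pd (region K) α ζ p * B p + ζ p * pd (region K) α B p) Ω := by
    intro p hp
    have h1 := pd_eq_of_hasFDerivAt hK (hfd.differentiable one_ne_zero p).hasFDerivAt α (hΩK hp)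
    simp only
    rw [← h1, ← pd_mul hK hζ' hB α (hΩK hp)]
  refine ⟨(integrableOn_congr_fun e hΩ.measurableSet).1 i1.integrableOn, ?_⟩
  rw [← setIntegral_congr_fun hΩ.measurableSet e,
    setIntegral_eq_integral_of_forall_compl_eq_zero, i2]
  intro p hp
  have h1 : f =ᶠ[nhds p] fun _ => 0 :=
    notMem_tsupport_iff_eventuallyEq.1 fun h => hp (hfs h)
  rw [h1.fderiv_eq]
  simp

/-- A nonnegative function that is at most a function of integral zero plus `b` has integral at
most that of `b`. -/
lemma lintegral_le_of_le_add {X : Type*} [MeasurableSpace X] {μ : Measure X} {a v b : X → ℝ}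
    (ha : 0 ≤ᵐ[μ] a) (ham : AEStronglyMeasurable a μ) (hb : 0 ≤ᵐ[μ] b)
    (hbm : AEStronglyMeasurable b μ) (hv : Integrable v μ) (hv0 : ∫ x, v x ∂μ = 0)
    (h : ∀ᵐ x ∂μ, a x ≤ v x + b x) :
    ∫⁻ x, ENNReal.ofReal (a x) ∂μ ≤ ∫⁻ x, ENNReal.ofReal (b x) ∂μ := by
  by_cases hbi : Integrable b μ
  · have hai : Integrable a μ := by
      refine (hv.add hbi).mono' ham ?_
      filter_upwards [ha, h] with x h1 h2
      rw [Real.norm_of_nonneg h1]; exact h2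
    rw [← ofReal_integral_eq_lintegral_ofReal hai ha, ← ofReal_integral_eq_lintegral_ofReal hbi hb]
    refine ENNReal.ofReal_le_ofReal ?_
    calc ∫ x, a x ∂μ ≤ ∫ x, (v x + b x) ∂μ := integral_mono_ae hai (hv.add hbi) h
      _ = ∫ x, b x ∂μ := by rw [integral_add hv hbi, hv0, zero_add]
  · have : ∫⁻ x, ENNReal.ofReal (b x) ∂μ = ⊤ := by
      by_contra hne
      exact hbi ⟨hbm, (hasFiniteIntegral_iff_ofReal hb).2 (lt_top_iff_ne_top.2 hne)⟩
    rw [this]; exact le_top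

end Divergence

section Cutoff

/-- The exterior space-time domain `t > 0`, `r > R`. -/
def exterior (n : ℕ) (R : ℝ) : Set (Spacetime n) := Set.Ioi 0 ×ˢ {x | R < ‖x‖}

lemma isOpen_exterior (R : ℝ) : IsOpen (exterior n R) :=
  isOpen_Ioi.prod (isOpen_lt continuous_const continuous_norm)

lemma exterior_subset_region {K : Set (Space n)} {R R₀ : ℝ} (hKR : K ⊆ Metric.ball 0 R₀)
    (hR : R₀ ≤ R) : exterior n R ⊆ region K := by
  rintro p ⟨h1, h2⟩
  refine ⟨Set.mem_Ici.2 (le_of_lt h1), fun hK => ?_⟩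
  have := hKR hK
  rw [mem_ball_zero_iff] at this
  exact absurd (this.trans_le hR) (not_lt.2 (le_of_lt h2))

lemma deriv_smoothTransition_eq_zero {y : ℝ} (hy : y < 0 ∨ 1 < y) :
    deriv Real.smoothTransition y = 0 := by
  rcases hy with hy | hy
  · have : Real.smoothTransition =ᶠ[nhds y] fun _ => 0 := by
      filter_upwards [Iio_mem_nhds hy] with z hz
      exact Real.smoothTransition.zero_of_nonpos (le_of_lt hz)
    rw [this.deriv_eq]; simp
  · have : Real.smoothTransition =ᶠ[nhds y] fun _ => 1 := by
      filter_upwards [Ioi_mem_nhds hy] with z hz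
      exact Real.smoothTransition.one_of_one_le (le_of_lt hz)
    rw [this.deriv_eq]; simp

lemma exists_deriv_smoothTransition_bound :
    ∃ C : ℝ, 0 ≤ C ∧ ∀ y, |deriv Real.smoothTransition y| ≤ C := by
  have hc : Continuous (deriv Real.smoothTransition) :=
    (Real.smoothTransition.contDiff (n := 1)).continuous_deriv le_rfl
  obtain ⟨C, hC⟩ := isCompact_Icc.exists_bound_of_continuousOn (s := Set.Icc (0 : ℝ) 1)
    hc.continuousOn
  refine ⟨max C 0, le_max_right _ _, fun y => ?_⟩
  by_cases hy : y ∈ Set.Icc (0 : ℝ) 1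
  · exact (hC y hy).trans (le_max_left _ _)
  · rw [Set.mem_Icc, not_and_or, not_le, not_le] at hy
    rw [deriv_smoothTransition_eq_zero hy]; simp

/-- The temporal cutoff: supported in `[1/m, 2m]`, equal to `1` on `[2/m, m]`. -/
def cutTime (m : ℝ) (p : Spacetime n) : ℝ :=
  Real.smoothTransition (m * p.1 - 1) * Real.smoothTransition (2 - m⁻¹ * p.1)

/-- The spatial cutoff: supported in `2R² ≤ r² ≤ 2m²`, equal to `1` for `3R² ≤ r² ≤ m²`. -/
def cutSpace (R m : ℝ) (p : Spacetime n) : ℝ :=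
  Real.smoothTransition ((R ^ 2)⁻¹ * ‖p.2‖ ^ 2 - 2) *
    Real.smoothTransition (2 - (m ^ 2)⁻¹ * ‖p.2‖ ^ 2)

/-- A space-time cutoff, compactly supported in the exterior domain and exhausting it. -/
def cut (R m : ℝ) (p : Spacetime n) : ℝ := cutTime m p * cutSpace R m p

/-- The size in time of the derivatives of the cutoff: an approximate unit mass near `t = 0`, and
`1 / m` for `t ≤ 2 m`. -/
def cutMass (m t : ℝ) : ℝ :=
  m * (Set.Icc m⁻¹ (2 * m⁻¹)).indicator 1 t + m⁻¹ * (Set.Icc 0 (2 * m)).indicator 1 t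

lemma contDiff_cutTime (m : ℝ) : ContDiff ℝ ∞ (cutTime m : Spacetime n → ℝ) :=
  (Real.smoothTransition.contDiff.comp ((contDiff_const.mul contDiff_fst).sub contDiff_const)).mul
    (Real.smoothTransition.contDiff.comp (contDiff_const.sub (contDiff_const.mul contDiff_fst)))

lemma contDiff_cutSpace (R m : ℝ) : ContDiff ℝ ∞ (cutSpace R m : Spacetime n → ℝ) :=
  (Real.smoothTransition.contDiff.comp
    ((contDiff_const.mul contDiff_normSq).sub contDiff_const)).mul
    (Real.smoothTransition.contDiff.comp (contDiff_const.sub (contDiff_const.mul contDiff_normSq)))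

lemma contDiff_cut (R m : ℝ) : ContDiff ℝ ∞ (cut R m : Spacetime n → ℝ) :=
  (contDiff_cutTime m).mul (contDiff_cutSpace R m)

lemma cutTime_nonneg (m : ℝ) (p : Spacetime n) : 0 ≤ cutTime m p :=
  mul_nonneg (Real.smoothTransition.nonneg _) (Real.smoothTransition.nonneg _)

lemma cutSpace_nonneg (R m : ℝ) (p : Spacetime n) : 0 ≤ cutSpace R m p :=
  mul_nonneg (Real.smoothTransition.nonneg _) (Real.smoothTransition.nonneg _)

lemma cut_nonneg (R m : ℝ) (p : Spacetime n) : 0 ≤ cut R m p :=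
  mul_nonneg (cutTime_nonneg m p) (cutSpace_nonneg R m p)

lemma cutTime_le_one (m : ℝ) (p : Spacetime n) : cutTime m p ≤ 1 :=
  mul_le_one₀ (Real.smoothTransition.le_one _) (Real.smoothTransition.nonneg _)
    (Real.smoothTransition.le_one _)

lemma cutSpace_le_one (R m : ℝ) (p : Spacetime n) : cutSpace R m p ≤ 1 :=
  mul_le_one₀ (Real.smoothTransition.le_one _) (Real.smoothTransition.nonneg _)
    (Real.smoothTransition.le_one _)

lemma cut_le_one (R m : ℝ) (p : Spacetime n) : cut R m p ≤ 1 :=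
  mul_le_one₀ (cutTime_le_one m p) (cutSpace_nonneg R m p) (cutSpace_le_one R m p)

lemma cutTime_ne_zero {m : ℝ} (hm : 0 < m) {p : Spacetime n} (h : cutTime m p ≠ 0) :
    m⁻¹ ≤ p.1 ∧ p.1 ≤ 2 * m := by
  have h1 : ¬ m * p.1 - 1 ≤ 0 := fun h0 => h (by
    rw [cutTime, Real.smoothTransition.zero_of_nonpos h0, zero_mul])
  have h2 : ¬ 2 - m⁻¹ * p.1 ≤ 0 := fun h0 => h (by
    rw [cutTime, Real.smoothTransition.zero_of_nonpos h0, mul_zero])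
  push Not at h1 h2
  refine ⟨?_, ?_⟩
  · rw [inv_le_iff_one_le_mul₀ hm]; linarith
  · have : m * (2 - m⁻¹ * p.1) = 2 * m - p.1 := by field_simp
    nlinarith [mul_pos hm h2]

lemma cutSpace_ne_zero {R m : ℝ} (hR : 0 < R) (hm : 0 < m) {p : Spacetime n}
    (h : cutSpace R m p ≠ 0) : 2 * R ^ 2 ≤ ‖p.2‖ ^ 2 ∧ ‖p.2‖ ^ 2 ≤ 2 * m ^ 2 := by
  have h1 : ¬ (R ^ 2)⁻¹ * ‖p.2‖ ^ 2 - 2 ≤ 0 := fun h0 => h (by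
    rw [cutSpace, Real.smoothTransition.zero_of_nonpos h0, zero_mul])
  have h2 : ¬ 2 - (m ^ 2)⁻¹ * ‖p.2‖ ^ 2 ≤ 0 := fun h0 => h (by
    rw [cutSpace, Real.smoothTransition.zero_of_nonpos h0, mul_zero])
  push Not at h1 h2
  have hR2 : 0 < R ^ 2 := by positivity
  have hm2 : 0 < m ^ 2 := by positivity
  refine ⟨?_, ?_⟩
  · have : R ^ 2 * ((R ^ 2)⁻¹ * ‖p.2‖ ^ 2 - 2) = ‖p.2‖ ^ 2 - 2 * R ^ 2 := by field_simp
    nlinarith [mul_pos hR2 h1]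
  · have : m ^ 2 * (2 - (m ^ 2)⁻¹ * ‖p.2‖ ^ 2) = 2 * m ^ 2 - ‖p.2‖ ^ 2 := by field_simp
    nlinarith [mul_pos hm2 h2]

lemma cut_support {R m : ℝ} (hR : 0 < R) (hm : 0 < m) :
    HasCompactSupport (cut R m : Spacetime n → ℝ) ∧
      tsupport (cut R m : Spacetime n → ℝ) ⊆ exterior n R := by
  set S : Set (Spacetime n) := {p | m⁻¹ ≤ p.1 ∧ p.1 ≤ 2 * m ∧ 2 * R ^ 2 ≤ ‖p.2‖ ^ 2 ∧
    ‖p.2‖ ^ 2 ≤ 2 * m ^ 2} with hS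
  have hcl : IsClosed S := by
    simp only [hS, Set.ofPred_and]
    refine (isClosed_le continuous_const continuous_fst).inter
      ((isClosed_le continuous_fst continuous_const).inter ((isClosed_le continuous_const ?_).inter
        (isClosed_le ?_ continuous_const))) <;> fun_prop
  have hsub : Function.support (cut R m : Spacetime n → ℝ) ⊆ S := by
    intro p hp
    have h1 := cutTime_ne_zero hm (left_ne_zero_of_mul hp)
    have h2 := cutSpace_ne_zero hR hm (right_ne_zero_of_mul hp)
    exact ⟨h1.1, h1.2, h2.1, h2.2⟩
  have hts : tsupport (cut R m : Spacetime n → ℝ) ⊆ S := closure_minimal hsub hcl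
  constructor
  · refine HasCompactSupport.of_support_subset_isCompact
      (K := Set.Icc m⁻¹ (2 * m) ×ˢ Metric.closedBall 0 (2 * m))
      (isCompact_Icc.prod (isCompact_closedBall _ _)) (hsub.trans ?_)
    rintro p ⟨h1, h2, -, h4⟩
    refine ⟨⟨h1, h2⟩, ?_⟩
    rw [mem_closedBall_zero_iff]
    exact le_of_sq_le_sq (by nlinarith) (by positivity)
  · refine hts.trans ?_
    rintro p ⟨h1, -, h3, -⟩
    refine ⟨lt_of_lt_of_le (inv_pos.2 hm) h1, ?_⟩
    exact lt_of_pow_lt_pow_left₀ 2 (norm_nonneg _) (by nlinarith [pow_pos hR 2])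

lemma cut_eq_one {R m : ℝ} (hR : 0 < R) (hm : 0 < m) {p : Spacetime n} (h1 : 2 * m⁻¹ ≤ p.1)
    (h2 : p.1 ≤ m) (h3 : 3 * R ^ 2 ≤ ‖p.2‖ ^ 2) (h4 : ‖p.2‖ ^ 2 ≤ m ^ 2) : cut R m p = 1 := by
  have a1 : 1 ≤ m * p.1 - 1 := by
    have : m * (2 * m⁻¹) ≤ m * p.1 := by gcongr
    rw [mul_left_comm, mul_inv_cancel₀ hm.ne'] at this; linarith
  have a2 : 1 ≤ 2 - m⁻¹ * p.1 := by
    have : m⁻¹ * p.1 ≤ m⁻¹ * m := by gcongr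
    rw [inv_mul_cancel₀ hm.ne'] at this; linarith
  have a3 : 1 ≤ (R ^ 2)⁻¹ * ‖p.2‖ ^ 2 - 2 := by
    have : (R ^ 2)⁻¹ * (3 * R ^ 2) ≤ (R ^ 2)⁻¹ * ‖p.2‖ ^ 2 := by gcongr
    rw [mul_left_comm, inv_mul_cancel₀ (by positivity)] at this; linarith
  have a4 : 1 ≤ 2 - (m ^ 2)⁻¹ * ‖p.2‖ ^ 2 := by
    have : (m ^ 2)⁻¹ * ‖p.2‖ ^ 2 ≤ (m ^ 2)⁻¹ * m ^ 2 := by gcongr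
    rw [inv_mul_cancel₀ (by positivity)] at this; linarith
  simp [cut, cutTime, cutSpace, Real.smoothTransition.one_of_one_le, a1, a2, a3, a4]

variable {K : Set (Space n)}

lemma pd_fst (hK : IsClosed K) (α : Fin (n + 1)) {p : Spacetime n} (hp : p ∈ region K) :
    pd (region K) α (fun q => q.1) p = 1 - spatial α := by
  have h : HasFDerivAt (fun q : Spacetime n => q.1) (ContinuousLinearMap.fst ℝ ℝ (Space n)) p :=
    (ContinuousLinearMap.fst ℝ ℝ (Space n)).hasFDerivAt
  rw [pd_eq_of_hasFDerivAt hK h α hp]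
  refine Fin.cases ?_ (fun i => ?_) α
  · simp [dir_zero]
  · simp [dir_succ]

lemma pd_smoothTransition_comp (hK : IsClosed K) {f : Spacetime n → ℝ} (hf : SmoothOn K f)
    (α : Fin (n + 1)) {p : Spacetime n} (hp : p ∈ region K) :
    pd (region K) α (fun q => Real.smoothTransition (f q)) p =
      deriv Real.smoothTransition (f p) * pd (region K) α f p :=
  pd_comp hK hf α hp
    ((Real.smoothTransition.contDiff (n := 1)).differentiable one_ne_zero _).hasDerivAt

/-- The derivatives of the cutoff are bounded by `cutMass` in time, uniformly in the parameters,
apart from a bounded contribution of the annulus `r² ≤ 3R²`. -/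
lemma exists_pd_cut_bound : ∃ C : ℝ, 0 ≤ C ∧ ∀ (n : ℕ) (K : Set (Space n)), IsClosed K →
    ∀ R m : ℝ, 1 ≤ R → 1 ≤ m → ∀ (α : Fin (n + 1)) (p : Spacetime n), p ∈ region K →
      |pd (region K) α (cut R m) p| ≤
        C * ({x : Space n | ‖x‖ ^ 2 ≤ 3 * R ^ 2}.indicator 1 p.2 + cutMass m p.1) := by
  obtain ⟨C, hC0, hC⟩ := exists_deriv_smoothTransition_bound
  refine ⟨8 * C, by positivity, fun n K hK R m hR hm α p hp => ?_⟩
  have hm0 : 0 < m := by linarith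
  have hR0 : 0 < R := by linarith
  have hmi : 0 < m⁻¹ := inv_pos.2 hm0
  have hσ0 := Real.smoothTransition.nonneg
  have hσ1 := Real.smoothTransition.le_one
  -- derivatives of the four factors
  have s1 : SmoothOn K fun q => m * q.1 - 1 :=
    ((contDiff_const.mul contDiff_fst).sub contDiff_const).contDiffOn
  have s2 : SmoothOn K fun q => 2 - m⁻¹ * q.1 :=
    (contDiff_const.sub (contDiff_const.mul contDiff_fst)).contDiffOn
  have s3 : SmoothOn K fun q => (R ^ 2)⁻¹ * ‖q.2‖ ^ 2 - 2 :=
    ((contDiff_const.mul contDiff_normSq).sub contDiff_const).contDiffOn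
  have s4 : SmoothOn K fun q => 2 - (m ^ 2)⁻¹ * ‖q.2‖ ^ 2 :=
    (contDiff_const.sub (contDiff_const.mul contDiff_normSq)).contDiffOn
  have sf : SmoothOn K fun q => q.1 := contDiff_fst.contDiffOn
  have sn : SmoothOn K fun q => ‖q.2‖ ^ 2 := contDiff_normSq.contDiffOn
  have st : ∀ {f : Spacetime n → ℝ}, SmoothOn K f → SmoothOn K fun q =>
    Real.smoothTransition (f q) := fun hf => Real.smoothTransition.contDiff.comp_contDiffOn hf
  have d1 : pd (region K) α (fun q => m * q.1 - 1) p = m * (1 - spatial α) := by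
    rw [pd_sub hK (contDiffOn_const.mul sf) contDiffOn_const α hp, pd_const_mul hK sf _ α hp,
      pd_const, pd_fst hK α hp, sub_zero]
  have d2 : pd (region K) α (fun q => 2 - m⁻¹ * q.1) p = -(m⁻¹ * (1 - spatial α)) := by
    rw [pd_sub hK contDiffOn_const (contDiffOn_const.mul sf) α hp, pd_const_mul hK sf _ α hp,
      pd_const, pd_fst hK α hp, zero_sub]
  have d3 : pd (region K) α (fun q => (R ^ 2)⁻¹ * ‖q.2‖ ^ 2 - 2) p =
      (R ^ 2)⁻¹ * (2 * coord α p) := by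
    rw [pd_sub hK (contDiffOn_const.mul sn) contDiffOn_const α hp, pd_const_mul hK sn _ α hp,
      pd_const, pd_normSq hK α hp, sub_zero]
  have d4 : pd (region K) α (fun q => 2 - (m ^ 2)⁻¹ * ‖q.2‖ ^ 2) p =
      -((m ^ 2)⁻¹ * (2 * coord α p)) := by
    rw [pd_sub hK contDiffOn_const (contDiffOn_const.mul sn) α hp, pd_const_mul hK sn _ α hp,
      pd_const, pd_normSq hK α hp, zero_sub]
  have key : pd (region K) α (cut R m) p =
      ((deriv Real.smoothTransition (m * p.1 - 1) * (m * (1 - spatial α))) *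
          Real.smoothTransition (2 - m⁻¹ * p.1) +
        Real.smoothTransition (m * p.1 - 1) *
          (deriv Real.smoothTransition (2 - m⁻¹ * p.1) * (-(m⁻¹ * (1 - spatial α))))) *
        cutSpace R m p +
      cutTime m p * ((deriv Real.smoothTransition ((R ^ 2)⁻¹ * ‖p.2‖ ^ 2 - 2) *
          ((R ^ 2)⁻¹ * (2 * coord α p))) * Real.smoothTransition (2 - (m ^ 2)⁻¹ * ‖p.2‖ ^ 2) +
        Real.smoothTransition ((R ^ 2)⁻¹ * ‖p.2‖ ^ 2 - 2) *
          (deriv Real.smoothTransition (2 - (m ^ 2)⁻¹ * ‖p.2‖ ^ 2) *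
            (-((m ^ 2)⁻¹ * (2 * coord α p))))) := by
    rw [show cut R m = fun q : Spacetime n => cutTime m q * cutSpace R m q from rfl,
      pd_mul hK (contDiff_cutTime m).contDiffOn (contDiff_cutSpace R m).contDiffOn α hp,
      show cutTime m = fun q : Spacetime n => Real.smoothTransition (m * q.1 - 1) *
        Real.smoothTransition (2 - m⁻¹ * q.1) from rfl,
      show cutSpace R m = fun q : Spacetime n =>
        Real.smoothTransition ((R ^ 2)⁻¹ * ‖q.2‖ ^ 2 - 2) *
        Real.smoothTransition (2 - (m ^ 2)⁻¹ * ‖q.2‖ ^ 2) from rfl,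
      pd_mul hK (st s1) (st s2) α hp, pd_mul hK (st s3) (st s4) α hp,
      pd_smoothTransition_comp hK s1 α hp, pd_smoothTransition_comp hK s2 α hp,
      pd_smoothTransition_comp hK s3 α hp, pd_smoothTransition_comp hK s4 α hp, d1, d2, d3, d4]
  have hsp : |1 - spatial α| ≤ 1 := by
    refine Fin.cases (by simp) (fun i => by simp) α
  have hx := abs_coord_le α p
  set I0 : ℝ := (Set.Icc m⁻¹ (2 * m⁻¹)).indicator 1 p.1 with hI0
  set I1 : ℝ := (Set.Icc 0 (2 * m)).indicator 1 p.1 with hI1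
  set J : ℝ := {x : Space n | ‖x‖ ^ 2 ≤ 3 * R ^ 2}.indicator 1 p.2 with hJ
  have hI0n : 0 ≤ I0 := Set.indicator_nonneg (fun _ _ => zero_le_one) _
  have hI1n : 0 ≤ I1 := Set.indicator_nonneg (fun _ _ => zero_le_one) _
  have hJn : 0 ≤ J := Set.indicator_nonneg (fun _ _ => zero_le_one) _
  -- each derivative of the transition function is supported where the indicators are `1`
  have b1 : |deriv Real.smoothTransition (m * p.1 - 1)| ≤ C * I0 := by
    by_cases h : p.1 ∈ Set.Icc m⁻¹ (2 * m⁻¹)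
    · rw [hI0, Set.indicator_of_mem h]; simpa using hC _
    · rw [deriv_smoothTransition_eq_zero]
      · simp; positivity
      · rw [Set.mem_Icc, not_and_or, not_le, not_le] at h
        rcases h with h | h
        · left
          have := mul_lt_mul_of_pos_left h hm0
          rw [mul_inv_cancel₀ hm0.ne'] at this; linarith
        · right
          have := mul_lt_mul_of_pos_left h hm0
          rw [mul_left_comm, mul_inv_cancel₀ hm0.ne'] at this; linarith
  have ht0 : 0 ≤ p.1 := hp.1
  have b2 : |deriv Real.smoothTransition (2 - m⁻¹ * p.1)| ≤ C * I1 := by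
    by_cases h : p.1 ∈ Set.Icc 0 (2 * m)
    · rw [hI1, Set.indicator_of_mem h]; simpa using hC _
    · rw [deriv_smoothTransition_eq_zero]
      · simp; positivity
      · left
        have h' : 2 * m < p.1 := by
          by_contra h0; exact h ⟨ht0, not_lt.1 h0⟩
        have := mul_lt_mul_of_pos_left h' hmi
        rw [mul_left_comm, inv_mul_cancel₀ hm0.ne'] at this; linarith
  have b3 : |deriv Real.smoothTransition ((R ^ 2)⁻¹ * ‖p.2‖ ^ 2 - 2) *
      ((R ^ 2)⁻¹ * (2 * coord α p))| ≤ 4 * C * J := by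
    by_cases h : ‖p.2‖ ^ 2 ≤ 3 * R ^ 2
    · have hJ1 : J = 1 := by rw [hJ, Set.indicator_of_mem (by exact h)]; rfl
      have hr : ‖p.2‖ ≤ 2 * R := le_of_sq_le_sq (by nlinarith) (by positivity)
      rw [hJ1, abs_mul, abs_mul, abs_mul, abs_of_pos (by positivity : 0 < (R ^ 2)⁻¹), abs_two]
      calc _ ≤ C * ((R ^ 2)⁻¹ * (2 * (2 * R))) := by
            gcongr
            · exact hC _
            · exact hx.trans hr
        _ = 4 * C * R⁻¹ := by field_simp; norm_num
        _ ≤ 4 * C * 1 := by gcongr; exact inv_le_one_of_one_le₀ hR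
    · rw [deriv_smoothTransition_eq_zero]
      · simp; positivity
      · right
        have := mul_lt_mul_of_pos_left (not_le.1 h) (by positivity : 0 < (R ^ 2)⁻¹)
        rw [mul_left_comm, inv_mul_cancel₀ (by positivity)] at this; linarith
  have b4 : |deriv Real.smoothTransition (2 - (m ^ 2)⁻¹ * ‖p.2‖ ^ 2) *
      (-((m ^ 2)⁻¹ * (2 * coord α p)))| ≤ 4 * C * m⁻¹ := by
    by_cases h : ‖p.2‖ ^ 2 ≤ 2 * m ^ 2
    · have hr : ‖p.2‖ ≤ 2 * m := le_of_sq_le_sq (by nlinarith) (by positivity)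
      rw [abs_mul, abs_neg, abs_mul, abs_mul, abs_of_pos (by positivity : 0 < (m ^ 2)⁻¹), abs_two]
      calc _ ≤ C * ((m ^ 2)⁻¹ * (2 * (2 * m))) := by
            gcongr
            · exact hC _
            · exact hx.trans hr
        _ = 4 * C * m⁻¹ := by field_simp; norm_num
    · rw [deriv_smoothTransition_eq_zero]
      · simp; positivity
      · left
        have := mul_lt_mul_of_pos_left (not_le.1 h) (by positivity : 0 < (m ^ 2)⁻¹)
        rw [mul_left_comm, inv_mul_cancel₀ (by positivity)] at this; linarith
  have b5 : cutTime m p ≤ I1 := by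
    by_cases h : cutTime m p = 0
    · rw [h]; exact hI1n
    · have := cutTime_ne_zero hm0 h
      rw [hI1, Set.indicator_of_mem (Set.mem_Icc.2 ⟨ht0, this.2⟩)]
      exact cutTime_le_one m p
  have hab : ∀ y, |Real.smoothTransition y| ≤ 1 := fun y => by
    rw [abs_of_nonneg (hσ0 y)]; exact hσ1 y
  rw [key, cutMass]
  have t1 : |((deriv Real.smoothTransition (m * p.1 - 1) * (m * (1 - spatial α))) *
          Real.smoothTransition (2 - m⁻¹ * p.1) +
        Real.smoothTransition (m * p.1 - 1) *
          (deriv Real.smoothTransition (2 - m⁻¹ * p.1) * (-(m⁻¹ * (1 - spatial α))))) *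
        cutSpace R m p| ≤ C * (m * I0 + m⁻¹ * I1) := by
    rw [abs_mul, abs_of_nonneg (cutSpace_nonneg R m p)]
    calc _ ≤ |_| * 1 := mul_le_mul_of_nonneg_left (cutSpace_le_one R m p) (abs_nonneg _)
      _ ≤ (C * I0 * (m * 1)) * 1 + 1 * (C * I1 * (m⁻¹ * 1)) := by
        rw [mul_one]
        refine (abs_add_le _ _).trans (add_le_add ?_ ?_)
        · rw [abs_mul, abs_mul, abs_mul, abs_of_pos hm0]
          gcongr
          exact hab _
        · rw [abs_mul, abs_mul, abs_neg, abs_mul, abs_of_pos hmi]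
          gcongr
          exact hab _
      _ = _ := by ring
  have t2 : |cutTime m p * ((deriv Real.smoothTransition ((R ^ 2)⁻¹ * ‖p.2‖ ^ 2 - 2) *
          ((R ^ 2)⁻¹ * (2 * coord α p))) * Real.smoothTransition (2 - (m ^ 2)⁻¹ * ‖p.2‖ ^ 2) +
        Real.smoothTransition ((R ^ 2)⁻¹ * ‖p.2‖ ^ 2 - 2) *
          (deriv Real.smoothTransition (2 - (m ^ 2)⁻¹ * ‖p.2‖ ^ 2) *
            (-((m ^ 2)⁻¹ * (2 * coord α p)))))| ≤ 4 * C * J + I1 * (4 * C * m⁻¹) := by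
    rw [mul_add]
    refine (abs_add_le _ _).trans (add_le_add ?_ ?_)
    · rw [abs_mul, abs_mul, abs_of_nonneg (cutTime_nonneg m p)]
      calc _ ≤ 1 * (4 * C * J * 1) := by
            gcongr
            · exact cutTime_le_one m p
            · exact hab _
        _ = _ := by ring
    · rw [abs_mul, abs_mul, abs_of_nonneg (cutTime_nonneg m p)]
      calc _ ≤ I1 * (1 * (4 * C * m⁻¹)) := by
            gcongr
            exact hab _
        _ = _ := by ring
  have q1 : 0 ≤ C * (m * I0) := by positivity
  have q2 : 0 ≤ C * J := by positivity
  have q3 : 0 ≤ C * (m⁻¹ * I1) := by positivity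
  refine (abs_add_le _ _).trans ((add_le_add t1 t2).trans ?_)
  linarith

lemma lintegral_cutMass_le {m : ℝ} (hm : 1 ≤ m) :
    ∫⁻ t, ENNReal.ofReal (cutMass m t) ≤ 3 := by
  have hm0 : 0 < m := by linarith
  have hmi : 0 < m⁻¹ := inv_pos.2 hm0
  have e : ∀ t, ENNReal.ofReal (cutMass m t) =
      (Set.Icc m⁻¹ (2 * m⁻¹)).indicator (fun _ => ENNReal.ofReal m) t +
      (Set.Icc 0 (2 * m)).indicator (fun _ => ENNReal.ofReal m⁻¹) t := by
    intro t
    have hI : ∀ s : Set ℝ, 0 ≤ s.indicator (1 : ℝ → ℝ) t := fun s =>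
      Set.indicator_nonneg (fun _ _ => zero_le_one) _
    rw [cutMass, ENNReal.ofReal_add (mul_nonneg hm0.le (hI _)) (mul_nonneg hmi.le (hI _))]
    congr 1
    · by_cases h : t ∈ Set.Icc m⁻¹ (2 * m⁻¹) <;> simp [h]
    · by_cases h : t ∈ Set.Icc 0 (2 * m) <;> simp [h]
  simp only [e]
  rw [lintegral_add_left (measurable_const.indicator measurableSet_Icc),
    lintegral_indicator_const measurableSet_Icc, lintegral_indicator_const measurableSet_Icc,
    Real.volume_Icc, Real.volume_Icc, ← ENNReal.ofReal_mul hm0.le, ← ENNReal.ofReal_mul hmi.le,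
    ← ENNReal.ofReal_add (mul_nonneg hm0.le (by linarith)) (mul_nonneg hmi.le (by linarith))]
  refine ENNReal.ofReal_le_of_le_toReal (le_of_eq ?_)
  have := mul_inv_cancel₀ hm0.ne'
  simp only [ENNReal.toReal_ofNat]
  linear_combination 3 * this

lemma measurable_cutMass (m : ℝ) : Measurable (cutMass m) := by
  unfold cutMass
  exact ((measurable_one.indicator measurableSet_Icc).const_mul _).add
    ((measurable_one.indicator measurableSet_Icc).const_mul _)

lemma cutMass_nonneg {m : ℝ} (hm : 0 ≤ m) (t : ℝ) : 0 ≤ cutMass m t :=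
  add_nonneg (mul_nonneg hm (Set.indicator_nonneg (fun _ _ => zero_le_one) _))
    (mul_nonneg (inv_nonneg.2 hm) (Set.indicator_nonneg (fun _ _ => zero_le_one) _))

end Cutoff

/-! ### The exterior local energy estimate for weakly coupled systems -/

section Exterior

/-- The dyadic annulus `ρ/2 ≤ r ≤ 2ρ` in space-time. -/
def annulus (n : ℕ) (ρ : ℝ) : Set (Spacetime n) := {p | ρ / 2 ≤ ‖p.2‖ ∧ ‖p.2‖ ≤ 2 * ρ}

lemma measurableSet_annulus (ρ : ℝ) : MeasurableSet (annulus n ρ) :=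
  ((isClosed_le continuous_const (by fun_prop : Continuous fun p : Spacetime n => ‖p.2‖)).inter
    (isClosed_le (by fun_prop : Continuous fun p : Spacetime n => ‖p.2‖)
      continuous_const)).measurableSet

/-- The total energy density of a family of functions. -/
def totalDens {ι : Type*} [Fintype ι] (K : Set (Space n)) (w : ι → Spacetime n → ℝ)
    (p : Spacetime n) : ℝ := ∑ i, dens K (w i) p

/-- A family `w` solving `H^{αβ} ∂_α ∂_β w_i = f_i + O(lam |∂w|)` for `r > R`, where `H` is a
perturbation of the Minkowski metric of size `lam r` with derivatives of size `lam`. -/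
structure ExteriorSystem {ι : Type*} [Fintype ι] (K : Set (Space n)) (R A : ℝ)
    (lam : Spacetime n → ℝ) (H : TensorField n) (w f : ι → Spacetime n → ℝ) : Prop where
  closed : IsClosed K
  subset : exterior n R ⊆ region K
  one_le : 1 ≤ R
  nonneg : 0 ≤ A
  lam_nonneg : ∀ p, 0 ≤ lam p
  lam_meas : Measurable lam
  smooth_coeff : SmoothTensor K H
  symm : ∀ p ∈ exterior n R, ∀ α β, H p α β = H p β α
  dev : ∀ p ∈ exterior n R, ∀ α β, |H p α β - minkowski n α β| ≤ A * lam p * ‖p.2‖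
  deriv : ∀ p ∈ exterior n R, ∀ γ α β, |pd (region K) γ (fun q => H q α β) p| ≤ A * lam p
  bdd : ∀ p ∈ exterior n R, ∀ α β, |H p α β| ≤ A
  smooth : ∀ i, SmoothOn K (w i)
  smooth_source : ∀ i, SmoothOn K (f i)
  eq : ∀ i, ∀ p ∈ exterior n R,
    |∑ α, ∑ β, H p α β * pd (region K) α (pd (region K) β (w i)) p| ≤
      |f i p| + A * lam p * Real.sqrt (totalDens K w p)

variable {ι : Type*} [Fintype ι] {K : Set (Space n)}

lemma totalDens_nonneg (w : ι → Spacetime n → ℝ) (p : Spacetime n) : 0 ≤ totalDens K w p :=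
  Finset.sum_nonneg fun i _ => dens_nonneg (w i) p

lemma dens_le_totalDens (w : ι → Spacetime n → ℝ) (p : Spacetime n) (i : ι) :
    dens K (w i) p ≤ totalDens K w p :=
  Finset.single_le_sum (f := fun i => dens K (w i) p) (fun i _ => dens_nonneg (w i) p)
    (Finset.mem_univ i)

lemma norm_pos_of_mem_exterior {R : ℝ} (hR : 1 ≤ R) {p : Spacetime n} (hp : p ∈ exterior n R) :
    0 < ‖p.2‖ := by
  have : R < ‖p.2‖ := hp.2
  linarith

lemma continuousOn_totalDens (hK : IsClosed K) {R : ℝ} (hR : 1 ≤ R)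
    (hsub : exterior n R ⊆ region K) {w : ι → Spacetime n → ℝ} (hw : ∀ i, SmoothOn K (w i)) :
    ContinuousOn (totalDens K w) (exterior n R) := by
  refine continuousOn_finsetSum _ fun i _ => ContinuousOn.add ?_ ?_
  · exact continuousOn_finsetSum _ fun α _ => (((hw i).pd hK α).continuousOn.mono hsub).pow 2
  · refine ContinuousOn.div (((hw i).continuousOn.mono hsub).pow 2) (by fun_prop) fun p hp => ?_
    have := norm_pos_of_mem_exterior hR hp
    positivity

namespace ExteriorSystem

variable {R A : ℝ} {lam : Spacetime n → ℝ} {H : TensorField n} {w f : ι → Spacetime n → ℝ}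

/-- Pointwise form of the estimate at scale `ρ`: up to a divergence, the energy density on the
annulus of size `ρ` is controlled by the source, the perturbation and the cutoff. -/
lemma pointwise (hn : 3 ≤ n) (h : ExteriorSystem K R A lam H w f) {Cd : ℝ} (hCd : 0 ≤ Cd)
    {ρ : ℝ} (hρ : 0 < ρ) {ζ : Spacetime n → ℝ} (hζ0 : ∀ p, 0 ≤ ζ p)
    {τ : Spacetime n → ℝ} (hτ0 : ∀ p, 0 ≤ τ p)
    (hτ : ∀ p ∈ exterior n R, ∀ α, |pd (region K) α ζ p| ≤ Cd * τ p)
    {p : Spacetime n} (hp : p ∈ exterior n R) :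
    (annulus n ρ).indicator (fun p => 648⁻¹ * (ρ⁻¹ * (ζ p * totalDens K w p))) p ≤
      ∑ i, ∑ α, (pd (region K) α ζ p * current K ρ H (w i) α p +
        ζ p * pd (region K) α (current K ρ H (w i) α) p) +
      (2 * ((n : ℝ) + 1) + Fintype.card ι * (2 * ((n : ℝ) + 1)) * A + 10 * ((n : ℝ) + 1) ^ 3 * A +
        4 * ((n : ℝ) + 1) ^ 3 * (A + 1) * Cd) *
        (ζ p * ((∑ i, |f i p|) * Real.sqrt (totalDens K w p)) +
          lam p * (ζ p * totalDens K w p) + τ p * totalDens K w p) := by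
  have hK := h.closed
  have hpR := h.subset hp
  have hr := norm_pos_of_mem_exterior h.one_le hp
  have hl := h.lam_nonneg p
  have hA := h.nonneg
  have hz := hζ0 p
  set N : ℝ := (n : ℝ) + 1 with hN
  have hN0 : 0 ≤ N := by positivity
  set T := totalDens K w p with hT
  have hT0 : 0 ≤ T := totalDens_nonneg w p
  set I := ∑ i, |f i p| with hI
  have hI0 : 0 ≤ I := Finset.sum_nonneg fun i _ => abs_nonneg _
  set P : ι → ℝ := fun i => 1 / 2 * ρ ^ 2 * kap ρ p ^ 3 * ∑ α, pd (region K) α (w i) p ^ 2 +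
        3 / 2 * ρ ^ 2 * kap ρ p ^ 5 * w i p ^ 2 with hP
  have hP0 : ∀ i, 0 ≤ P i := fun i => by have := kap_pos hρ p; positivity
  have hCτ : 0 ≤ Cd * τ p := mul_nonneg hCd (hτ0 p)
  -- the estimate for one component
  have one : ∀ i, ζ p * P i ≤ ∑ α, (pd (region K) α ζ p * current K ρ H (w i) α p +
        ζ p * pd (region K) α (current K ρ H (w i) α) p) +
      (2 * N * (ζ p * (|f i p| * Real.sqrt T)) + 2 * N * A * (lam p * (ζ p * T)) +
        10 * N ^ 3 * A * (lam p * (ζ p * dens K (w i) p)) +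
        4 * N ^ 3 * (A + 1) * (Cd * τ p * dens K (w i) p)) := by
    intro i
    have h1 := le_div_current hn hK hρ h.smooth_coeff (h.smooth i) hpR hr (h.symm p hp)
      (mul_nonneg hA hl) (h.dev p hp) (h.deriv p hp)
    have hd0 := dens_nonneg (K := K) (w i) p
    have h2 : |(∑ α, ∑ β, H p α β * pd (region K) α (pd (region K) β (w i)) p) *
        mult K ρ (w i) p| ≤ 2 * N * (|f i p| * Real.sqrt T) + 2 * N * A * (lam p * T) := by
      rw [abs_mul]
      have a1 := abs_mult_le (K := K) (by omega) hρ (w i) hr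
      have a2 : Real.sqrt (dens K (w i) p) ≤ Real.sqrt T :=
        Real.sqrt_le_sqrt (dens_le_totalDens w p i)
      calc _ ≤ (|f i p| + A * lam p * Real.sqrt T) * (2 * N * Real.sqrt T) := by
            refine mul_le_mul (h.eq i p hp) (a1.trans ?_) (abs_nonneg _) (by positivity)
            gcongr
        _ = 2 * N * (|f i p| * Real.sqrt T) + 2 * N * A * (lam p * (Real.sqrt T) ^ 2) := by ring
        _ = _ := by rw [Real.sq_sqrt hT0]
    have h3 : |∑ α, pd (region K) α ζ p * current K ρ H (w i) α p| ≤
        4 * N ^ 3 * (A + 1) * (Cd * τ p * dens K (w i) p) := by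
      have := abs_sum_le_card_mul (f := fun α => pd (region K) α ζ p * current K ρ H (w i) α p)
        (B := Cd * τ p * (4 * N ^ 2 * (A + 1) * dens K (w i) p)) fun α => by
          rw [abs_mul]
          exact mul_le_mul (hτ p hp α) (abs_current_le (by omega) hρ (w i) hr (h.bdd p hp) α)
            (abs_nonneg _) hCτ
      refine this.trans (le_of_eq ?_)
      simp only [Fintype.card_fin]; push_cast; ring
    have h4 : P i ≤ ∑ α, pd (region K) α (current K ρ H (w i) α) p +
        (2 * N * (|f i p| * Real.sqrt T) + 2 * N * A * (lam p * T)) +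
        10 * N ^ 3 * (A * lam p) * dens K (w i) p := by
      have := (abs_le.1 h2).1
      refine h1.trans ?_
      rw [← hN]
      linarith
    have h5 := mul_le_mul_of_nonneg_left h4 hz
    have h6 := (abs_le.1 h3).1
    rw [Finset.sum_add_distrib, ← Finset.mul_sum]
    have e1 : ζ p * (∑ α, pd (region K) α (current K ρ H (w i) α) p +
        (2 * N * (|f i p| * Real.sqrt T) + 2 * N * A * (lam p * T)) +
        10 * N ^ 3 * (A * lam p) * dens K (w i) p) =
        ζ p * (∑ α, pd (region K) α (current K ρ H (w i) α) p) +
        2 * N * (ζ p * (|f i p| * Real.sqrt T)) + 2 * N * A * (lam p * (ζ p * T)) +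
        10 * N ^ 3 * A * (lam p * (ζ p * dens K (w i) p)) := by ring
    linarith
  have hsum := Finset.sum_le_sum fun i (_ : i ∈ Finset.univ) => one i
  have hlhs : (annulus n ρ).indicator (fun p => 648⁻¹ * (ρ⁻¹ * (ζ p * totalDens K w p))) p ≤
      ∑ i, ζ p * P i := by
    by_cases hmem : p ∈ annulus n ρ
    · rw [Set.indicator_of_mem hmem]
      have : ∀ i, ρ⁻¹ * dens K (w i) p ≤ 648 * P i := fun i => dens_le_of_annulus hρ hmem.1 hmem.2
      have h7 : ρ⁻¹ * totalDens K w p ≤ 648 * ∑ i, P i := by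
        rw [totalDens, Finset.mul_sum, Finset.mul_sum]
        exact Finset.sum_le_sum fun i _ => this i
      rw [← Finset.mul_sum]
      calc 648⁻¹ * (ρ⁻¹ * (ζ p * totalDens K w p)) =
            648⁻¹ * (ζ p * (ρ⁻¹ * totalDens K w p)) := by ring
        _ ≤ 648⁻¹ * (ζ p * (648 * ∑ i, P i)) := by gcongr
        _ = _ := by ring
    · rw [Set.indicator_of_notMem hmem]
      exact Finset.sum_nonneg fun i _ => mul_nonneg hz (hP0 i)
  refine hlhs.trans (hsum.trans ?_)
  rw [Finset.sum_add_distrib]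
  refine add_le_add le_rfl ?_
  have e2 : ∑ i, (2 * N * (ζ p * (|f i p| * Real.sqrt T)) + 2 * N * A * (lam p * (ζ p * T)) +
        10 * N ^ 3 * A * (lam p * (ζ p * dens K (w i) p)) +
        4 * N ^ 3 * (A + 1) * (Cd * τ p * dens K (w i) p)) =
      2 * N * (ζ p * (I * Real.sqrt T)) + Fintype.card ι * (2 * N) * A * (lam p * (ζ p * T)) +
        10 * N ^ 3 * A * (lam p * (ζ p * T)) + 4 * N ^ 3 * (A + 1) * (Cd * τ p * T) := by
    simp only [Finset.sum_add_distrib, ← Finset.mul_sum, ← Finset.sum_mul, Finset.sum_const,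
      Finset.card_univ, nsmul_eq_mul]
    rw [hI, hT, totalDens]
    ring
  rw [e2]
  have p1 : 0 ≤ ζ p * (I * Real.sqrt T) := by positivity
  have p2 : 0 ≤ lam p * (ζ p * T) := by positivity
  have q1 : 0 ≤ Fintype.card ι * (2 * N) * A + 10 * N ^ 3 * A := by positivity
  have q4 : 0 ≤ 4 * N ^ 3 * (A + 1) := by positivity
  have p3 : 0 ≤ τ p * T := mul_nonneg (hτ0 p) hT0
  have q5 : 0 ≤ 4 * N ^ 3 * (A + 1) * Cd := by positivity
  have q2 : 0 ≤ 2 * N := by positivity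
  nlinarith [mul_nonneg q1 p1, mul_nonneg q1 p3, mul_nonneg q5 p1, mul_nonneg q5 p2,
    mul_nonneg q2 p2, mul_nonneg q2 p3]

end ExteriorSystem

end Exterior

section ExteriorIntegrated

variable {ι : Type*} [Fintype ι] {K : Set (Space n)}

namespace ExteriorSystem

variable {R A : ℝ} {lam : Spacetime n → ℝ} {H : TensorField n} {w f : ι → Spacetime n → ℝ}

lemma aemeasurable_of_continuousOn {g : Spacetime n → ℝ} {R : ℝ}
    (hg : ContinuousOn g (exterior n R)) : AEMeasurable g (volume.restrict (exterior n R)) :=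
  hg.aemeasurable (isOpen_exterior R).measurableSet

/-- Integrated form of the estimate at scale `ρ`, before absorbing the perturbation. -/
lemma lintegral_annulus_le (hn : 3 ≤ n) (h : ExteriorSystem K R A lam H w f) {Cd : ℝ}
    (hCd : 0 ≤ Cd) {ρ : ℝ} (hρ : 0 < ρ) {ζ : Spacetime n → ℝ} (hζ0 : ∀ p, 0 ≤ ζ p)
    (hζ : ContDiff ℝ ∞ ζ) (hζc : HasCompactSupport ζ) (hζs : tsupport ζ ⊆ exterior n R)
    {τ : Spacetime n → ℝ} (hτ0 : ∀ p, 0 ≤ τ p) (hτm : Measurable τ)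
    (hτ : ∀ p ∈ exterior n R, ∀ α, |pd (region K) α ζ p| ≤ Cd * τ p) :
    ENNReal.ofReal ρ⁻¹ * ∫⁻ p in exterior n R ∩ annulus n ρ,
        ENNReal.ofReal (ζ p * totalDens K w p) ≤
      ENNReal.ofReal (648 * (2 * ((n : ℝ) + 1) + Fintype.card ι * (2 * ((n : ℝ) + 1)) * A +
        10 * ((n : ℝ) + 1) ^ 3 * A + 4 * ((n : ℝ) + 1) ^ 3 * (A + 1) * Cd)) *
      ((∫⁻ p in exterior n R,
          ENNReal.ofReal (ζ p * ((∑ i, |f i p|) * Real.sqrt (totalDens K w p)))) +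
        (∫⁻ p in exterior n R, ENNReal.ofReal (lam p) * ENNReal.ofReal (ζ p * totalDens K w p)) +
        ∫⁻ p in exterior n R, ENNReal.ofReal (τ p) * ENNReal.ofReal (totalDens K w p)) := by
  have hK := h.closed
  have hA := h.nonneg
  set C₁ : ℝ := 2 * ((n : ℝ) + 1) + Fintype.card ι * (2 * ((n : ℝ) + 1)) * A +
        10 * ((n : ℝ) + 1) ^ 3 * A + 4 * ((n : ℝ) + 1) ^ 3 * (A + 1) * Cd with hC₁
  have hC₁0 : 0 ≤ C₁ := by positivity
  have hT := continuousOn_totalDens hK h.one_le h.subset h.smooth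
  have hTm := aemeasurable_of_continuousOn hT
  have hFc : ContinuousOn (fun p => ∑ i, |f i p|) (exterior n R) :=
    continuousOn_finsetSum _ fun i _ => ((h.smooth_source i).continuousOn.mono h.subset).abs
  have hFT : ContinuousOn (fun p => ζ p * ((∑ i, |f i p|) * Real.sqrt (totalDens K w p)))
      (exterior n R) := hζ.continuous.continuousOn.mul (hFc.mul hT.sqrt)
  have hζT : ContinuousOn (fun p => ζ p * totalDens K w p) (exterior n R) :=
    hζ.continuous.continuousOn.mul hT
  have hm1 := aemeasurable_of_continuousOn hFT
  have hm2 := aemeasurable_of_continuousOn hζT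
  have hF0 : ∀ p, 0 ≤ ∑ i, |f i p| := fun p => Finset.sum_nonneg fun i _ => abs_nonneg _
  have n1 : ∀ p, 0 ≤ ζ p * ((∑ i, |f i p|) * Real.sqrt (totalDens K w p)) := fun p =>
    mul_nonneg (hζ0 p) (mul_nonneg (hF0 p) (Real.sqrt_nonneg _))
  have n2 : ∀ p, 0 ≤ ζ p * totalDens K w p := fun p => mul_nonneg (hζ0 p) (totalDens_nonneg w p)
  have n3 : ∀ p, 0 ≤ lam p * (ζ p * totalDens K w p) := fun p =>
    mul_nonneg (h.lam_nonneg p) (n2 p)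
  have n4 : ∀ p, 0 ≤ τ p * totalDens K w p := fun p => mul_nonneg (hτ0 p) (totalDens_nonneg w p)
  set v : Spacetime n → ℝ := fun p => ∑ i, ∑ α, (pd (region K) α ζ p * current K ρ H (w i) α p +
        ζ p * pd (region K) α (current K ρ H (w i) α) p) with hv
  set b : Spacetime n → ℝ := fun p => C₁ *
        (ζ p * ((∑ i, |f i p|) * Real.sqrt (totalDens K w p)) +
          lam p * (ζ p * totalDens K w p) + τ p * totalDens K w p) with hb
  have hdiv := fun i α => integral_pd_mul_eq_zero hK (isOpen_exterior R) h.subset hζ hζc hζs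
    (smoothOn_current hK hρ h.smooth_coeff (h.smooth i) α) α
  have hvi : Integrable v (volume.restrict (exterior n R)) :=
    integrable_finsetSum _ fun i _ => integrable_finsetSum _ fun α _ => (hdiv i α).1
  have hv0 : ∫ p in exterior n R, v p = 0 := by
    rw [hv, integral_finsetSum _ fun i _ => integrable_finsetSum _ fun α _ => (hdiv i α).1]
    refine Finset.sum_eq_zero fun i _ => ?_
    rw [integral_finsetSum _ fun α _ => (hdiv i α).1]
    exact Finset.sum_eq_zero fun α _ => (hdiv i α).2
  have hbm : AEMeasurable b (volume.restrict (exterior n R)) :=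
    ((hm1.add (h.lam_meas.aemeasurable.mul hm2)).add (hτm.aemeasurable.mul hTm)).const_mul _
  have key := lintegral_le_of_le_add (μ := volume.restrict (exterior n R))
    (a := (annulus n ρ).indicator fun p => 648⁻¹ * (ρ⁻¹ * (ζ p * totalDens K w p))) (v := v)
    (b := b)
    (Filter.Eventually.of_forall fun p => Set.indicator_nonneg (fun p _ => by
      have := n2 p; positivity) p)
    (((hm2.const_mul _).const_mul _).indicator (measurableSet_annulus ρ)).aestronglyMeasurable
    (Filter.Eventually.of_forall fun p =>
      mul_nonneg hC₁0 (add_nonneg (add_nonneg (n1 p) (n3 p)) (n4 p)))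
    hbm.aestronglyMeasurable hvi hv0
    ((ae_restrict_iff' (isOpen_exterior R).measurableSet).2
      (Filter.Eventually.of_forall fun p hp => h.pointwise hn hCd hρ hζ0 hτ0 hτ hp))
  have hleft : ∫⁻ p in exterior n R, ENNReal.ofReal ((annulus n ρ).indicator
      (fun p => 648⁻¹ * (ρ⁻¹ * (ζ p * totalDens K w p))) p) =
      ENNReal.ofReal 648⁻¹ * (ENNReal.ofReal ρ⁻¹ * ∫⁻ p in exterior n R ∩ annulus n ρ,
        ENNReal.ofReal (ζ p * totalDens K w p)) := by
    have e : ∀ p, ENNReal.ofReal ((annulus n ρ).indicator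
      (fun p => 648⁻¹ * (ρ⁻¹ * (ζ p * totalDens K w p))) p) = (annulus n ρ).indicator
      (fun p => ENNReal.ofReal 648⁻¹ * (ENNReal.ofReal ρ⁻¹ *
        ENNReal.ofReal (ζ p * totalDens K w p))) p := by
      intro p
      by_cases hp : p ∈ annulus n ρ
      · rw [Set.indicator_of_mem hp, Set.indicator_of_mem hp,
          ENNReal.ofReal_mul (by norm_num), ENNReal.ofReal_mul (by positivity)]
      · rw [Set.indicator_of_notMem hp, Set.indicator_of_notMem hp, ENNReal.ofReal_zero]
    simp only [e]
    rw [lintegral_indicator (measurableSet_annulus ρ),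
      Measure.restrict_restrict (measurableSet_annulus ρ), Set.inter_comm,
      lintegral_const_mul' _ _ ENNReal.ofReal_ne_top,
        lintegral_const_mul' _ _ ENNReal.ofReal_ne_top]
  have hright : ∫⁻ p in exterior n R, ENNReal.ofReal (b p) = ENNReal.ofReal C₁ *
      ((∫⁻ p in exterior n R,
          ENNReal.ofReal (ζ p * ((∑ i, |f i p|) * Real.sqrt (totalDens K w p)))) +
        (∫⁻ p in exterior n R, ENNReal.ofReal (lam p) * ENNReal.ofReal (ζ p * totalDens K w p)) +
        ∫⁻ p in exterior n R, ENNReal.ofReal (τ p) * ENNReal.ofReal (totalDens K w p)) := by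
    have e : ∀ p, ENNReal.ofReal (b p) = ENNReal.ofReal C₁ *
        (ENNReal.ofReal (ζ p * ((∑ i, |f i p|) * Real.sqrt (totalDens K w p))) +
        ENNReal.ofReal (lam p) * ENNReal.ofReal (ζ p * totalDens K w p) +
        ENNReal.ofReal (τ p) * ENNReal.ofReal (totalDens K w p)) := by
      intro p
      rw [hb, ENNReal.ofReal_mul hC₁0, ENNReal.ofReal_add (add_nonneg (n1 p) (n3 p)) (n4 p),
        ENNReal.ofReal_add (n1 p) (n3 p), ENNReal.ofReal_mul (h.lam_nonneg p),
        ENNReal.ofReal_mul (hτ0 p)]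
    have hm12 : AEMeasurable (fun p =>
        ENNReal.ofReal (ζ p * ((∑ i, |f i p|) * Real.sqrt (totalDens K w p))) +
        ENNReal.ofReal (lam p) * ENNReal.ofReal (ζ p * totalDens K w p))
        (volume.restrict (exterior n R)) :=
      hm1.ennreal_ofReal.add (h.lam_meas.aemeasurable.ennreal_ofReal.mul hm2.ennreal_ofReal)
    simp only [e]
    rw [lintegral_const_mul' _ _ ENNReal.ofReal_ne_top, lintegral_add_left' hm12,
      lintegral_add_left' hm1.ennreal_ofReal]
  rw [hleft, hright] at key
  rw [ENNReal.ofReal_mul (by norm_num : (0 : ℝ) ≤ 648), mul_assoc]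
  calc _ = ENNReal.ofReal 648 * (ENNReal.ofReal 648⁻¹ * (ENNReal.ofReal ρ⁻¹ *
        ∫⁻ p in exterior n R ∩ annulus n ρ, ENNReal.ofReal (ζ p * totalDens K w p))) := by
        rw [← mul_assoc (ENNReal.ofReal 648), ← ENNReal.ofReal_mul (by norm_num)]
        norm_num
    _ ≤ _ := mul_le_mul_right key _

/-- Slicing in time: a density whose spatial integrals are at most `E` has integral at most
`3 E` against `cutMass`. -/
lemma lintegral_cutMass_mul_le {g : Spacetime n → ℝ≥0∞} {R : ℝ}
    (hg : AEMeasurable g (volume.restrict (exterior n R))) {E : ℝ≥0∞}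
    (hE : ∀ᵐ t ∂(volume.restrict (Set.Ioi (0 : ℝ))), ∫⁻ x in {x | R < ‖x‖}, g (t, x) ≤ E)
    {m : ℝ} (hm : 1 ≤ m) :
    ∫⁻ p in exterior n R, ENNReal.ofReal (cutMass m p.1) * g p ≤ 3 * E := by
  have hmu : volume.restrict (exterior n R) = (volume.restrict (Set.Ioi (0 : ℝ))).prod
      ((volume : Measure (Space n)).restrict {x | R < ‖x‖}) := by
    rw [Measure.prod_restrict]; rfl
  have hc : AEMeasurable (fun p : Spacetime n => ENNReal.ofReal (cutMass m p.1) * g p)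
      (volume.restrict (exterior n R)) :=
    ((measurable_cutMass m).comp measurable_fst).ennreal_ofReal.aemeasurable.mul hg
  rw [hmu] at hc ⊢
  rw [lintegral_prod _ hc]
  calc _ ≤ ∫⁻ t in Set.Ioi (0 : ℝ), ENNReal.ofReal (cutMass m t) * E := by
        refine lintegral_mono_ae ?_
        filter_upwards [hE] with t ht
        rw [lintegral_const_mul' _ _ ENNReal.ofReal_ne_top]
        exact mul_le_mul_right ht _
    _ ≤ ∫⁻ t, ENNReal.ofReal (cutMass m t) * E := lintegral_mono' Measure.restrict_le_self le_rfl
    _ = (∫⁻ t, ENNReal.ofReal (cutMass m t)) * E :=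
        lintegral_mul_const _ (measurable_cutMass m).ennreal_ofReal
    _ ≤ _ := mul_le_mul_left (lintegral_cutMass_le hm) _

/-- The exterior local energy estimate. If the perturbation weight `lam` is small in the sense of
`hab`, it is absorbed: for the cut off densities the dyadic supremum is finite because the cutoff
has compact support. -/
theorem local_energy_estimate (hn : 3 ≤ n) (A : ℝ) (hA : 0 ≤ A) (ι : Type*) [Fintype ι] :
    ∃ δ : ℝ, 0 < δ ∧ ∃ C : ℝ≥0, ∀ (K : Set (Space n)) (R : ℝ) (lam : Spacetime n → ℝ)
      (H : TensorField n) (w f : ι → Spacetime n → ℝ), ExteriorSystem K R A lam H w f →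
      (∀ g : Spacetime n → ℝ≥0∞, AEMeasurable g (volume.restrict (exterior n R)) →
        ∫⁻ p in exterior n R, ENNReal.ofReal (lam p) * g p ≤
          ENNReal.ofReal δ * ⨆ j : ℕ, ENNReal.ofReal ((2 : ℝ) ^ j)⁻¹ *
            ∫⁻ p in exterior n R ∩ annulus n (2 ^ j), g p) →
      ∀ E : ℝ≥0∞, (∀ᵐ t ∂(volume.restrict (Set.Ioi (0 : ℝ))),
        ∫⁻ x in {x | R < ‖x‖}, ENNReal.ofReal (totalDens K w (t, x)) ≤ E) →
      ∀ j : ℕ, ENNReal.ofReal ((2 : ℝ) ^ j)⁻¹ *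
        ∫⁻ p in (exterior n R ∩ {p | 3 * R ^ 2 ≤ ‖p.2‖ ^ 2}) ∩ annulus n (2 ^ j),
          ENNReal.ofReal (totalDens K w p) ≤
        C * ((∫⁻ p in exterior n R,
            ENNReal.ofReal ((∑ i, |f i p|) * Real.sqrt (totalDens K w p))) +
          (∫⁻ p in exterior n R ∩ {p | ‖p.2‖ ^ 2 ≤ 3 * R ^ 2},
            ENNReal.ofReal (totalDens K w p)) + E) := by
  obtain ⟨Cd, hCd, hcut⟩ := exists_pd_cut_bound
  set C₂ : ℝ := 648 * (2 * ((n : ℝ) + 1) + Fintype.card ι * (2 * ((n : ℝ) + 1)) * A +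
        10 * ((n : ℝ) + 1) ^ 3 * A + 4 * ((n : ℝ) + 1) ^ 3 * (A + 1) * Cd) with hC₂
  have hC₂0 : 0 < C₂ := by positivity
  refine ⟨1 / (2 * C₂), by positivity, 2 * C₂.toNNReal * 3, ?_⟩
  intro K R lam H w f h hab E hE j
  have hK := h.closed
  have hR0 : 0 < R := by linarith [h.one_le]
  have hT := continuousOn_totalDens hK h.one_le h.subset h.smooth
  have hTm := aemeasurable_of_continuousOn hT
  set X := ∫⁻ p in exterior n R, ENNReal.ofReal ((∑ i, |f i p|) * Real.sqrt (totalDens K w p))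
    with hX
  set W := ∫⁻ p in exterior n R ∩ {p | ‖p.2‖ ^ 2 ≤ 3 * R ^ 2}, ENNReal.ofReal (totalDens K w p)
    with hW
  have hF0 : ∀ p, 0 ≤ ∑ i, |f i p| := fun p => Finset.sum_nonneg fun i _ => abs_nonneg _
  have hJm : MeasurableSet {p : Spacetime n | ‖p.2‖ ^ 2 ≤ 3 * R ^ 2} :=
    (isClosed_le (by fun_prop) continuous_const).measurableSet
  -- the estimate for the cut off density, uniformly in the cutoff parameter
  have cutoff : ∀ m : ℝ, 1 ≤ m → ENNReal.ofReal ((2 : ℝ) ^ j)⁻¹ *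
      ∫⁻ p in exterior n R ∩ annulus n (2 ^ j), ENNReal.ofReal (cut R m p * totalDens K w p) ≤
      2 * (ENNReal.ofReal C₂ * (X + (W + 3 * E))) := by
    intro m hm
    have hm0 : 0 < m := by linarith
    obtain ⟨hc, hs⟩ := cut_support (n := n) hR0 hm0
    set τ : Spacetime n → ℝ := fun p =>
      {x : Space n | ‖x‖ ^ 2 ≤ 3 * R ^ 2}.indicator 1 p.2 + cutMass m p.1 with hτ
    have hI0 : ∀ p : Spacetime n, (0 : ℝ) ≤ {x : Space n | ‖x‖ ^ 2 ≤ 3 * R ^ 2}.indicator 1 p.2 :=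
      fun p => Set.indicator_nonneg (fun _ _ => zero_le_one) _
    have hIm : Measurable fun p : Spacetime n =>
        ({x : Space n | ‖x‖ ^ 2 ≤ 3 * R ^ 2}.indicator 1 p.2 : ℝ) :=
      (measurable_one.indicator (isClosed_le (by fun_prop) continuous_const).measurableSet).comp
        measurable_snd
    have hτ0 : ∀ p, 0 ≤ τ p := fun p => add_nonneg (hI0 p) (cutMass_nonneg hm0.le _)
    have hτm : Measurable τ := hIm.add ((measurable_cutMass m).comp measurable_fst)
    have est := fun i : ℕ => lintegral_annulus_le hn h hCd (ρ := 2 ^ i) (by positivity)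
      (cut_nonneg R m) (contDiff_cut R m) hc hs hτ0 hτm
      (fun p hp α => hcut n K hK R m h.one_le hm α p (h.subset hp))
    have b1 : (∫⁻ p in exterior n R, ENNReal.ofReal (cut R m p *
        ((∑ i, |f i p|) * Real.sqrt (totalDens K w p)))) ≤ X := by
      refine lintegral_mono fun p => ENNReal.ofReal_le_ofReal ?_
      exact mul_le_of_le_one_left (mul_nonneg (hF0 p) (Real.sqrt_nonneg _)) (cut_le_one R m p)
    have b3 : ∫⁻ p in exterior n R, ENNReal.ofReal (τ p) * ENNReal.ofReal (totalDens K w p) ≤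
        W + 3 * E := by
      have e : ∀ p, ENNReal.ofReal (τ p) * ENNReal.ofReal (totalDens K w p) =
          {p : Spacetime n | ‖p.2‖ ^ 2 ≤ 3 * R ^ 2}.indicator
            (fun p => ENNReal.ofReal (totalDens K w p)) p +
          ENNReal.ofReal (cutMass m p.1) * ENNReal.ofReal (totalDens K w p) := by
        intro p
        rw [hτ, ENNReal.ofReal_add (hI0 p) (cutMass_nonneg hm0.le _), add_mul]
        congr 1
        by_cases hp : ‖p.2‖ ^ 2 ≤ 3 * R ^ 2
        · rw [Set.indicator_of_mem (by exact hp), Set.indicator_of_mem (by exact hp)]; simp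
        · rw [Set.indicator_of_notMem (by exact hp), Set.indicator_of_notMem (by exact hp)]; simp
      simp only [e]
      rw [lintegral_add_left' (hTm.ennreal_ofReal.indicator hJm), lintegral_indicator hJm,
        Measure.restrict_restrict hJm, Set.inter_comm]
      exact add_le_add le_rfl (lintegral_cutMass_mul_le hTm.ennreal_ofReal hE hm)
    set M := ⨆ i : ℕ, ENNReal.ofReal ((2 : ℝ) ^ i)⁻¹ *
      ∫⁻ p in exterior n R ∩ annulus n (2 ^ i), ENNReal.ofReal (cut R m p * totalDens K w p)
      with hM
    have hζT : ContinuousOn (fun p => cut R m p * totalDens K w p) (exterior n R) :=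
      (contDiff_cut R m).continuous.continuousOn.mul hT
    have hMtop : M ≠ ⊤ := by
      have hi : IntegrableOn (fun p => cut R m p * totalDens K w p) (exterior n R) := by
        have h1 : IntegrableOn (fun p => cut R m p * totalDens K w p)
            (tsupport (cut R m : Spacetime n → ℝ)) :=
          (hζT.mono hs).integrableOn_compact hc
        refine (h1.integrable_of_forall_notMem_eq_zero fun p hp => ?_).integrableOn
        rw [image_eq_zero_of_notMem_tsupport hp, zero_mul]
      have h2 : ∫⁻ p in exterior n R, ENNReal.ofReal (cut R m p * totalDens K w p) ≠ ⊤ := by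
        have := (hasFiniteIntegral_iff_ofReal (Filter.Eventually.of_forall fun p =>
          mul_nonneg (cut_nonneg R m p) (totalDens_nonneg w p))).1 hi.2
        exact this.ne
      refine ne_top_of_le_ne_top h2 (iSup_le fun i => ?_)
      have h3 : ENNReal.ofReal ((2 : ℝ) ^ i)⁻¹ ≤ 1 :=
        ENNReal.ofReal_le_one.2 (inv_le_one_of_one_le₀ (one_le_pow₀ one_le_two))
      exact (mul_le_of_le_one_left zero_le h3).trans
        (lintegral_mono_set Set.inter_subset_left)
    have hle : M ≤ ENNReal.ofReal C₂ * (X + (W + 3 * E)) + 2⁻¹ * M := by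
      refine iSup_le fun i => (est i).trans ?_
      have b2 := hab _ (aemeasurable_of_continuousOn hζT).ennreal_ofReal
      calc _ ≤ ENNReal.ofReal C₂ * (X + ENNReal.ofReal (1 / (2 * C₂)) * M + (W + 3 * E)) :=
            mul_le_mul_right (add_le_add (add_le_add b1 b2) b3) _
        _ = ENNReal.ofReal C₂ * (X + (W + 3 * E)) +
            (ENNReal.ofReal C₂ * ENNReal.ofReal (1 / (2 * C₂))) * M := by ring
        _ = _ := by
          rw [← ENNReal.ofReal_mul hC₂0.le, show C₂ * (1 / (2 * C₂)) = 2⁻¹ by field_simp,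
            ENNReal.ofReal_inv_of_pos two_pos, ENNReal.ofReal_ofNat]
    have hhalf : 2⁻¹ * M ≤ ENNReal.ofReal C₂ * (X + (W + 3 * E)) := by
      have h2 : 2⁻¹ * M ≠ ⊤ := ENNReal.mul_ne_top (by simp) hMtop
      have h3 : 2⁻¹ * M + 2⁻¹ * M = M := by rw [← add_mul, ENNReal.inv_two_add_inv_two, one_mul]
      refine (ENNReal.add_le_add_iff_right h2).1 ?_
      rw [h3]; exact hle
    calc _ ≤ M := le_iSup (fun i : ℕ => ENNReal.ofReal ((2 : ℝ) ^ i)⁻¹ *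
          ∫⁻ p in exterior n R ∩ annulus n (2 ^ i),
            ENNReal.ofReal (cut R m p * totalDens K w p)) j
      _ = 2 * (2⁻¹ * M) := by
          rw [← mul_assoc, ENNReal.mul_inv_cancel two_ne_zero ENNReal.ofNat_ne_top, one_mul]
      _ ≤ _ := mul_le_mul_right hhalf _
  -- exhausting the exterior domain
  set S : Set (Spacetime n) :=
    (exterior n R ∩ {p | 3 * R ^ 2 ≤ ‖p.2‖ ^ 2}) ∩ annulus n (2 ^ j) with hS
  have hSm : MeasurableSet S := ((isOpen_exterior R).measurableSet.inter
    (isClosed_le continuous_const (by fun_prop)).measurableSet).inter (measurableSet_annulus _)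
  have hSsub : S ⊆ exterior n R ∩ annulus n (2 ^ j) := fun p hp => ⟨hp.1.1, hp.2⟩
  have hfat : ∫⁻ p in S, ENNReal.ofReal (totalDens K w p) ≤ Filter.liminf
      (fun m : ℕ => ∫⁻ p in S, ENNReal.ofReal (cut R (m + 1) p * totalDens K w p))
      Filter.atTop := by
    refine le_trans (lintegral_mono_ae ?_) (lintegral_liminf_le' fun m => ?_)
    · filter_upwards [ae_restrict_mem hSm] with p hp
      have hp1 : 0 < p.1 := hp.1.1.1
      have hev : ∀ᶠ m : ℕ in Filter.atTop,
          cut R (m + 1) p * totalDens K w p = totalDens K w p := by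
        have l1 : Filter.Tendsto (fun m : ℕ => (m : ℝ) + 1) Filter.atTop Filter.atTop :=
          Filter.tendsto_atTop_add_const_right _ _ tendsto_natCast_atTop_atTop
        filter_upwards [l1.eventually_ge_atTop (2 * p.1⁻¹), l1.eventually_ge_atTop p.1,
          l1.eventually_ge_atTop ‖p.2‖, l1.eventually_ge_atTop 1] with m h1 h2 h3 h4
        have hm0 : (0 : ℝ) < m + 1 := by linarith
        rw [cut_eq_one hR0 hm0 _ h2 hp.1.2 (by gcongr), one_mul]
        rw [← div_eq_mul_inv, div_le_iff₀ hm0]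
        rw [← div_eq_mul_inv, div_le_iff₀ hp1] at h1
        linarith
      rw [Filter.Tendsto.liminf_eq]
      refine (Filter.tendsto_congr' ?_).2 tendsto_const_nhds
      filter_upwards [hev] with m hm
      rw [hm]
    · exact ((aemeasurable_of_continuousOn ((contDiff_cut R _).continuous.continuousOn.mul
        hT)).ennreal_ofReal).mono_measure (Measure.restrict_mono (fun p hp => hp.1.1) le_rfl)
  have hpow : (0 : ℝ) < 2 ^ j := by positivity
  have hbd : ∀ m : ℕ, ∫⁻ p in S, ENNReal.ofReal (cut R (m + 1) p * totalDens K w p) ≤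
      ENNReal.ofReal (2 ^ j) * (2 * (ENNReal.ofReal C₂ * (X + (W + 3 * E)))) := by
    intro m
    have h1 := cutoff (m + 1) (by linarith [(Nat.cast_nonneg m : (0 : ℝ) ≤ m)])
    calc _ ≤ ∫⁻ p in exterior n R ∩ annulus n (2 ^ j),
          ENNReal.ofReal (cut R (m + 1) p * totalDens K w p) := lintegral_mono_set hSsub
      _ = ENNReal.ofReal (2 ^ j) * (ENNReal.ofReal ((2 : ℝ) ^ j)⁻¹ *
          ∫⁻ p in exterior n R ∩ annulus n (2 ^ j),
            ENNReal.ofReal (cut R (m + 1) p * totalDens K w p)) := by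
          rw [← mul_assoc, ← ENNReal.ofReal_mul hpow.le, mul_inv_cancel₀ hpow.ne',
            ENNReal.ofReal_one, one_mul]
      _ ≤ _ := mul_le_mul_right h1 _
  have hlim : ∫⁻ p in S, ENNReal.ofReal (totalDens K w p) ≤
      ENNReal.ofReal (2 ^ j) * (2 * (ENNReal.ofReal C₂ * (X + (W + 3 * E)))) := by
    refine hfat.trans ?_
    have := Filter.liminf_le_liminf (f := Filter.atTop) (Filter.Eventually.of_forall hbd)
    simpa using this
  calc _ ≤ ENNReal.ofReal ((2 : ℝ) ^ j)⁻¹ *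
        (ENNReal.ofReal (2 ^ j) * (2 * (ENNReal.ofReal C₂ * (X + (W + 3 * E))))) :=
        mul_le_mul_right hlim _
    _ = 2 * (ENNReal.ofReal C₂ * (X + (W + 3 * E))) := by
        rw [← mul_assoc, ← ENNReal.ofReal_mul (by positivity), inv_mul_cancel₀ hpow.ne',
          ENNReal.ofReal_one, one_mul]
    _ ≤ 2 * (ENNReal.ofReal C₂ * (3 * X + (3 * W + 3 * E))) := by
        gcongr <;> exact le_mul_of_one_le_left zero_le (by norm_num)
    _ = _ := by
        push_cast
        rw [ENNReal.ofReal]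
        ring

end ExteriorSystem

end ExteriorIntegrated

/-! ### Hardy's inequality on time slices -/

section Hardy

variable {K : Set (Space n)}

lemma pd_cutSpace (hK : IsClosed K) (R m : ℝ) (α : Fin (n + 1)) {p : Spacetime n}
    (hp : p ∈ region K) : pd (region K) α (cutSpace R m) p =
      (deriv Real.smoothTransition ((R ^ 2)⁻¹ * ‖p.2‖ ^ 2 - 2) *
          ((R ^ 2)⁻¹ * (2 * coord α p))) * Real.smoothTransition (2 - (m ^ 2)⁻¹ * ‖p.2‖ ^ 2) +
        Real.smoothTransition ((R ^ 2)⁻¹ * ‖p.2‖ ^ 2 - 2) *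
          (deriv Real.smoothTransition (2 - (m ^ 2)⁻¹ * ‖p.2‖ ^ 2) *
            (-((m ^ 2)⁻¹ * (2 * coord α p)))) := by
  have s3 : SmoothOn K fun q => (R ^ 2)⁻¹ * ‖q.2‖ ^ 2 - 2 :=
    ((contDiff_const.mul contDiff_normSq).sub contDiff_const).contDiffOn
  have s4 : SmoothOn K fun q => 2 - (m ^ 2)⁻¹ * ‖q.2‖ ^ 2 :=
    (contDiff_const.sub (contDiff_const.mul contDiff_normSq)).contDiffOn
  have sn : SmoothOn K fun q => ‖q.2‖ ^ 2 := contDiff_normSq.contDiffOn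
  have st : ∀ {f : Spacetime n → ℝ}, SmoothOn K f → SmoothOn K fun q =>
    Real.smoothTransition (f q) := fun hf => Real.smoothTransition.contDiff.comp_contDiffOn hf
  have d3 : pd (region K) α (fun q => (R ^ 2)⁻¹ * ‖q.2‖ ^ 2 - 2) p =
      (R ^ 2)⁻¹ * (2 * coord α p) := by
    rw [pd_sub hK (contDiffOn_const.mul sn) contDiffOn_const α hp, pd_const_mul hK sn _ α hp,
      pd_const, pd_normSq hK α hp, sub_zero]
  have d4 : pd (region K) α (fun q => 2 - (m ^ 2)⁻¹ * ‖q.2‖ ^ 2) p =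
      -((m ^ 2)⁻¹ * (2 * coord α p)) := by
    rw [pd_sub hK contDiffOn_const (contDiffOn_const.mul sn) α hp, pd_const_mul hK sn _ α hp,
      pd_const, pd_normSq hK α hp, zero_sub]
  rw [show cutSpace R m = fun q : Spacetime n =>
      Real.smoothTransition ((R ^ 2)⁻¹ * ‖q.2‖ ^ 2 - 2) *
      Real.smoothTransition (2 - (m ^ 2)⁻¹ * ‖q.2‖ ^ 2) from rfl, pd_mul hK (st s3) (st s4) α hp,
    pd_smoothTransition_comp hK s3 α hp, pd_smoothTransition_comp hK s4 α hp, d3, d4]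

/-- The divergence theorem on a time slice. -/
lemma integral_slice_pd_mul_eq_zero (hK : IsClosed K) {R : ℝ} (hsub : exterior n R ⊆ region K)
    {t : ℝ} (ht : 0 < t) {ζ B : Spacetime n → ℝ} (hζ : ContDiff ℝ ∞ ζ)
    (hc : HasCompactSupport fun x => ζ (t, x))
    (hsupp : tsupport (fun x => ζ (t, x)) ⊆ {x | R < ‖x‖}) (hB : SmoothOn K B) (i : Fin n) :
    Integrable (fun x => pd (region K) i.succ ζ (t, x) * B (t, x) +
        ζ (t, x) * pd (region K) i.succ B (t, x)) (volume.restrict {x | R < ‖x‖}) ∧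
    ∫ x in {x | R < ‖x‖}, (pd (region K) i.succ ζ (t, x) * B (t, x) +
        ζ (t, x) * pd (region K) i.succ B (t, x)) = 0 := by
  have hO : IsOpen {x : Space n | R < ‖x‖} := isOpen_lt continuous_const continuous_norm
  set f : Space n → ℝ := fun x => ζ (t, x) * B (t, x) with hf
  have hfc : HasCompactSupport f := hc.mul_right
  have hfs : tsupport f ⊆ {x | R < ‖x‖} :=
    (tsupport_mul_subset_left (f := fun x => ζ (t, x)) (g := fun x => B (t, x))).trans hsupp
  have hζB : ∀ x ∈ {x : Space n | R < ‖x‖}, ContDiffAt ℝ ∞ (fun p => ζ p * B p) (t, x) := by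
    intro x hx
    have hmem : (t, x) ∈ exterior n R := ⟨ht, hx⟩
    exact hζ.contDiffAt.mul (hB.contDiffAt
      (Filter.mem_of_superset ((isOpen_exterior R).mem_nhds hmem) hsub))
  have hfd : ContDiff ℝ 1 f := by
    rw [contDiff_iff_contDiffAt]
    intro x
    by_cases hx : x ∈ {x : Space n | R < ‖x‖}
    · exact ((hζB x hx).comp x (contDiff_const.prodMk contDiff_id).contDiffAt).of_le (by simp)
    · have h1 : f =ᶠ[nhds x] fun _ => 0 :=
        notMem_tsupport_iff_eventuallyEq.1 fun h => hx (hfs h)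
      exact contDiffAt_const.congr_of_eventuallyEq h1
  obtain ⟨i1, i2⟩ := integral_fderiv_eq_zero_of_hasCompactSupport (μ := volume) hfd hfc
    (EuclideanSpace.single i 1)
  have e : Set.EqOn (fun x => fderiv ℝ f x (EuclideanSpace.single i 1))
      (fun x => pd (region K) i.succ ζ (t, x) * B (t, x) +
        ζ (t, x) * pd (region K) i.succ B (t, x)) {x | R < ‖x‖} := by
    intro x hx
    have hmem : (t, x) ∈ region K := hsub ⟨ht, hx⟩
    have h1 := ((hζB x hx).differentiableAt (by simp)).hasFDerivAt
    have h2 : HasFDerivAt f ((fderiv ℝ (fun p => ζ p * B p) (t, x)).comp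
        (ContinuousLinearMap.inr ℝ ℝ (Space n))) x :=
      h1.comp x (hasFDerivAt_prodMk_right t x)
    simp only
    rw [h2.fderiv, ← pd_mul hK hζ.contDiffOn hB i.succ hmem,
      pd_eq_of_hasFDerivAt hK h1 i.succ hmem, dir_succ]
    simp
  refine ⟨(integrableOn_congr_fun e hO.measurableSet).1 i1.integrableOn, ?_⟩
  rw [← setIntegral_congr_fun hO.measurableSet e,
    setIntegral_eq_integral_of_forall_compl_eq_zero, i2]
  intro p hp
  have h1 : f =ᶠ[nhds p] fun _ => 0 :=
    notMem_tsupport_iff_eventuallyEq.1 fun h => hp (hfs h)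
  rw [h1.fderiv_eq]
  simp

lemma deriv_smoothTransition_nonneg (y : ℝ) : 0 ≤ deriv Real.smoothTransition y :=
  Real.smoothTransition.monotone.deriv_nonneg

/-- The spatial energy density `∑ |∂_α w|²` of all first derivatives. -/
def gradSq (K : Set (Space n)) (w : Spacetime n → ℝ) (p : Spacetime n) : ℝ :=
  ∑ α, pd (region K) α w p ^ 2

lemma gradSq_nonneg (w : Spacetime n → ℝ) (p : Spacetime n) : 0 ≤ gradSq K w p :=
  Finset.sum_nonneg fun _ _ => sq_nonneg _

/-- Pointwise form of Hardy's inequality, with the field `x κ² w²`, `κ = (r² + 1)^{-1/2}`. The inner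
part of the cutoff is radially increasing, hence has a favourable sign; the outer part costs
`m⁻² w²`. -/
lemma hardy_pointwise (hn : 3 ≤ n) (hK : IsClosed K) {R m : ℝ} (hm : 0 < m)
    {Cd : ℝ} (hCd : ∀ y, |deriv Real.smoothTransition y| ≤ Cd)
    {w : Spacetime n → ℝ} (hw : SmoothOn K w) {p : Spacetime n} (hp : p ∈ region K) :
    1 / 2 * (cutSpace R m p * (kap 1 p ^ 2 * w p ^ 2)) ≤
      ∑ i : Fin n, (pd (region K) i.succ (cutSpace R m) p *
          (coord i.succ p * kap 1 p ^ 2 * w p ^ 2) +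
        cutSpace R m p * pd (region K) i.succ
          (fun q => coord i.succ q * kap 1 q ^ 2 * w q ^ 2) p) +
      (2 * gradSq K w p + 4 * Cd * (m ^ 2)⁻¹ * w p ^ 2) := by
  have hn3 : (3 : ℝ) ≤ n := by exact_mod_cast hn
  have hκ : SmoothOn K (kap 1) := (contDiff_kap one_pos).contDiffOn
  have hx : ∀ α, SmoothOn K (coord α) := fun α => (contDiff_coord α).contDiffOn
  have hpB : ∀ i : Fin n, pd (region K) i.succ
      (fun q => coord i.succ q * kap 1 q ^ 2 * w q ^ 2) p =
      kap 1 p ^ 2 * w p ^ 2 - 2 * kap 1 p ^ 4 * w p ^ 2 * p.2 i ^ 2 +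
        2 * kap 1 p ^ 2 * w p * (p.2 i * pd (region K) i.succ w p) := by
    intro i
    rw [pd_mul hK ((hx _).mul (hκ.pow 2)) (hw.pow 2) _ hp, pd_mul hK (hx _) (hκ.pow 2) _ hp,
      pd_pow hK hκ 2 _ hp, pd_pow hK hw 2 _ hp, pd_coord hK _ _ hp, pd_kap hK one_pos _ hp,
      if_pos rfl, coord_succ, spatial_succ]
    push_cast
    ring
  have hk := kap_pos one_pos p
  have hksq := kap_sq_mul one_pos p
  have hkr := kap_mul_norm_le one_pos p
  set κ := kap 1 p
  set η := cutSpace R m p with hη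
  have hη0 : 0 ≤ η := cutSpace_nonneg R m p
  have hη1 : η ≤ 1 := cutSpace_le_one R m p
  have hr2 : ∑ i, p.2 i ^ 2 = ‖p.2‖ ^ 2 := (EuclideanSpace.norm_sq_eq (x := p.2)).symm ▸ by simp
  set xd := ∑ i, p.2 i * pd (region K) i.succ w p with hxd
  set Dη : ℝ := deriv Real.smoothTransition ((R ^ 2)⁻¹ * ‖p.2‖ ^ 2 - 2) * ((R ^ 2)⁻¹ * 2) *
      Real.smoothTransition (2 - (m ^ 2)⁻¹ * ‖p.2‖ ^ 2) -
    Real.smoothTransition ((R ^ 2)⁻¹ * ‖p.2‖ ^ 2 - 2) *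
      (deriv Real.smoothTransition (2 - (m ^ 2)⁻¹ * ‖p.2‖ ^ 2) * ((m ^ 2)⁻¹ * 2)) with hDη
  have hsum : ∑ i : Fin n, (pd (region K) i.succ (cutSpace R m) p *
          (coord i.succ p * κ ^ 2 * w p ^ 2) +
        η * pd (region K) i.succ (fun q => coord i.succ q * kap 1 q ^ 2 * w q ^ 2) p) =
      Dη * ‖p.2‖ ^ 2 * (κ ^ 2 * w p ^ 2) + η * (n * (κ ^ 2 * w p ^ 2) -
        2 * κ ^ 4 * w p ^ 2 * ‖p.2‖ ^ 2 + 2 * κ ^ 2 * w p * xd) := by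
    have e : ∀ i : Fin n, pd (region K) i.succ (cutSpace R m) p *
          (coord i.succ p * κ ^ 2 * w p ^ 2) +
        η * pd (region K) i.succ (fun q => coord i.succ q * kap 1 q ^ 2 * w q ^ 2) p =
        Dη * (κ ^ 2 * w p ^ 2) * p.2 i ^ 2 + η * (κ ^ 2 * w p ^ 2) -
        η * (2 * κ ^ 4 * w p ^ 2) * p.2 i ^ 2 +
        η * (2 * κ ^ 2 * w p) * (p.2 i * pd (region K) i.succ w p) := by
      intro i
      rw [hpB, pd_cutSpace hK R m _ hp, coord_succ, hDη]
      ring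
    rw [Finset.sum_congr rfl fun i _ => e i, Finset.sum_add_distrib, Finset.sum_sub_distrib,
      Finset.sum_add_distrib]
    simp only [Finset.sum_const, Finset.card_univ, Fintype.card_fin, nsmul_eq_mul]
    simp only [← Finset.mul_sum, hr2, ← hxd]
    ring
  rw [hsum]
  -- the cutoff
  have hcut : -(4 * Cd * (m ^ 2)⁻¹ * w p ^ 2) ≤ Dη * ‖p.2‖ ^ 2 * (κ ^ 2 * w p ^ 2) := by
    have hm2 : 0 < (m ^ 2)⁻¹ := by positivity
    have h1 : 0 ≤ deriv Real.smoothTransition ((R ^ 2)⁻¹ * ‖p.2‖ ^ 2 - 2) * ((R ^ 2)⁻¹ * 2) *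
        Real.smoothTransition (2 - (m ^ 2)⁻¹ * ‖p.2‖ ^ 2) :=
      mul_nonneg (mul_nonneg (deriv_smoothTransition_nonneg _) (by positivity))
        (Real.smoothTransition.nonneg _)
    have h2 : Real.smoothTransition ((R ^ 2)⁻¹ * ‖p.2‖ ^ 2 - 2) *
      (deriv Real.smoothTransition (2 - (m ^ 2)⁻¹ * ‖p.2‖ ^ 2) * ((m ^ 2)⁻¹ * 2)) ≤
        1 * (Cd * ((m ^ 2)⁻¹ * 2)) := by
      refine mul_le_mul (Real.smoothTransition.le_one _) ?_
        (mul_nonneg (deriv_smoothTransition_nonneg _) (by positivity)) zero_le_one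
      exact mul_le_mul_of_nonneg_right ((le_abs_self _).trans (hCd _)) (by positivity)
    have h3 : -(Cd * ((m ^ 2)⁻¹ * 2)) ≤ Dη := by linarith
    have h4 : (κ * ‖p.2‖) ^ 2 ≤ 1 := pow_le_one₀ (by positivity) hkr
    have hC0 : 0 ≤ Cd := (abs_nonneg _).trans (hCd 0)
    have h5 : 0 ≤ (κ * ‖p.2‖) ^ 2 * w p ^ 2 := by positivity
    have h6 : (κ * ‖p.2‖) ^ 2 * w p ^ 2 ≤ 1 * w p ^ 2 := by gcongr
    have h7 : 0 ≤ Cd * (m ^ 2)⁻¹ := by positivity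
    calc -(4 * Cd * (m ^ 2)⁻¹ * w p ^ 2) ≤
          -(Cd * ((m ^ 2)⁻¹ * 2)) * ((κ * ‖p.2‖) ^ 2 * w p ^ 2) := by
            nlinarith [mul_le_mul_of_nonneg_left h6 h7, mul_nonneg h7 (sq_nonneg (w p))]
      _ ≤ Dη * ((κ * ‖p.2‖) ^ 2 * w p ^ 2) := mul_le_mul_of_nonneg_right h3 h5
      _ = _ := by ring
  -- Cauchy-Schwarz
  have hxd2 : xd ^ 2 ≤ ‖p.2‖ ^ 2 * gradSq K w p := by
    have h1 := Finset.sum_mul_sq_le_sq_mul_sq Finset.univ (fun i => p.2 i)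
      fun i : Fin n => pd (region K) i.succ w p
    rw [hr2] at h1
    refine h1.trans (mul_le_mul_of_nonneg_left ?_ (by positivity))
    rw [gradSq, Fin.sum_univ_succ]
    exact le_add_of_nonneg_left (sq_nonneg _)
  have hG0 := gradSq_nonneg (K := K) w p
  have hy : (κ * xd) ^ 2 ≤ gradSq K w p := by
    have h4 : (κ * ‖p.2‖) ^ 2 ≤ 1 := pow_le_one₀ (by positivity) hkr
    calc (κ * xd) ^ 2 = κ ^ 2 * xd ^ 2 := by ring
      _ ≤ κ ^ 2 * (‖p.2‖ ^ 2 * gradSq K w p) := by gcongr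
      _ = (κ * ‖p.2‖) ^ 2 * gradSq K w p := by ring
      _ ≤ 1 * gradSq K w p := by gcongr
      _ = _ := one_mul _
  have hmain : 1 / 2 * (κ ^ 2 * w p ^ 2) - 2 * gradSq K w p ≤ n * (κ ^ 2 * w p ^ 2) -
        2 * κ ^ 4 * w p ^ 2 * ‖p.2‖ ^ 2 + 2 * κ ^ 2 * w p * xd := by
    have h1 : 2 * κ ^ 4 * w p ^ 2 * ‖p.2‖ ^ 2 = 2 * κ ^ 2 * w p ^ 2 * (κ ^ 2 * ‖p.2‖ ^ 2) := by ring
    have h2 : κ ^ 2 * ‖p.2‖ ^ 2 ≤ 1 := by nlinarith [pow_pos hk 2]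
    have h3 : 2 * κ ^ 2 * w p ^ 2 * (κ ^ 2 * ‖p.2‖ ^ 2) ≤ 2 * κ ^ 2 * w p ^ 2 * 1 := by gcongr
    have h4 : 0 ≤ (n - 3) * (κ ^ 2 * w p ^ 2) := mul_nonneg (by linarith) (by positivity)
    have h5 : -(1 / 2 * (κ ^ 2 * w p ^ 2) + 2 * (κ * xd) ^ 2) ≤ 2 * κ ^ 2 * w p * xd := by
      nlinarith [sq_nonneg (κ * w p + 2 * (κ * xd))]
    linarith
  have h8 := mul_le_mul_of_nonneg_left hmain hη0
  have h9 : η * (2 * gradSq K w p) ≤ 1 * (2 * gradSq K w p) := by gcongr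
  linarith

/-- Hardy's inequality on a time slice of the exterior region, without boundary conditions on the
inner boundary. Square integrability only serves to discard the contribution of infinity. -/
theorem hardy_slice (hn : 3 ≤ n) (hK : IsClosed K) {R : ℝ} (hR : 1 ≤ R)
    (hsub : exterior n R ⊆ region K) {w : Spacetime n → ℝ} (hw : SmoothOn K w) {t : ℝ}
    (ht : 0 < t) (hL2 : ∫⁻ x in {x | R < ‖x‖}, ENNReal.ofReal (w (t, x) ^ 2) ≠ ⊤) :
    ∫⁻ x in {x | 3 * R ^ 2 ≤ ‖x‖ ^ 2}, ENNReal.ofReal (w (t, x) ^ 2 / ‖x‖ ^ 2) ≤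
      8 * ∫⁻ x in {x | R < ‖x‖}, ENNReal.ofReal (gradSq K w (t, x)) := by
  obtain ⟨Cd, hCd0, hCd⟩ := exists_deriv_smoothTransition_bound
  have hR0 : 0 < R := by linarith
  have hO : IsOpen {x : Space n | R < ‖x‖} := isOpen_lt continuous_const continuous_norm
  have hslice : ∀ {g : Spacetime n → ℝ}, ContinuousOn g (exterior n R) →
      ContinuousOn (fun x => g (t, x)) {x | R < ‖x‖} := fun hg =>
    hg.comp (by fun_prop) fun x hx => ⟨ht, hx⟩
  have hwc : ContinuousOn (fun x => w (t, x)) {x | R < ‖x‖} :=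
    hslice (hw.continuousOn.mono hsub)
  have hgc : ContinuousOn (fun x => gradSq K w (t, x)) {x | R < ‖x‖} :=
    hslice (continuousOn_finsetSum _ fun α _ => ((hw.pd hK α).continuousOn.mono hsub).pow 2)
  have hηc : ∀ m : ℝ, Continuous fun x : Space n => cutSpace R m (t, x) := fun m =>
    (contDiff_cutSpace R m).continuous.comp (by fun_prop)
  have hκc : Continuous fun x : Space n => kap 1 (t, x) :=
    (contDiff_kap one_pos).continuous.comp (by fun_prop)
  have hac : ∀ m : ℝ, ContinuousOn (fun x => 1 / 2 * (cutSpace R m (t, x) *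
      (kap 1 (t, x) ^ 2 * w (t, x) ^ 2))) {x | R < ‖x‖} := fun m =>
    continuousOn_const.mul ((hηc m).continuousOn.mul ((hκc.continuousOn.pow 2).mul (hwc.pow 2)))
  set G := ∫⁻ x in {x | R < ‖x‖}, ENNReal.ofReal (gradSq K w (t, x)) with hG
  set Q := ∫⁻ x in {x | R < ‖x‖}, ENNReal.ofReal (w (t, x) ^ 2) with hQ
  have est : ∀ m : ℝ, 0 < m → ∫⁻ x in {x | R < ‖x‖}, ENNReal.ofReal (1 / 2 *
      (cutSpace R m (t, x) * (kap 1 (t, x) ^ 2 * w (t, x) ^ 2))) ≤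
      2 * G + ENNReal.ofReal (4 * Cd * (m ^ 2)⁻¹) * Q := by
    intro m hm
    have hsupp : Function.support (fun x : Space n => cutSpace R m (t, x)) ⊆
        {x | 2 * R ^ 2 ≤ ‖x‖ ^ 2} ∩ Metric.closedBall 0 (2 * m) := by
      intro x hx
      have := cutSpace_ne_zero hR0 hm (p := (t, x)) hx
      refine ⟨this.1, ?_⟩
      rw [mem_closedBall_zero_iff]
      exact le_of_sq_le_sq (by nlinarith [this.2]) (by positivity)
    have hc : HasCompactSupport fun x : Space n => cutSpace R m (t, x) :=
      HasCompactSupport.of_support_subset_isCompact (isCompact_closedBall _ _)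
        (hsupp.trans Set.inter_subset_right)
    have hs : tsupport (fun x : Space n => cutSpace R m (t, x)) ⊆ {x | R < ‖x‖} := by
      refine (closure_minimal (hsupp.trans Set.inter_subset_left)
        (isClosed_le continuous_const (by fun_prop))).trans fun x hx => ?_
      exact lt_of_pow_lt_pow_left₀ 2 (norm_nonneg _)
        (lt_of_lt_of_le (by nlinarith [pow_pos hR0 2]) hx)
    have hBs : ∀ i : Fin n, SmoothOn K fun q => coord i.succ q * kap 1 q ^ 2 * w q ^ 2 := fun i =>
      ((contDiff_coord _).contDiffOn.mul ((contDiff_kap one_pos).contDiffOn.pow 2)).mul (hw.pow 2)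
    have hdiv := fun i : Fin n => integral_slice_pd_mul_eq_zero hK hsub ht
      (contDiff_cutSpace R m) hc hs (hBs i) i
    have hbc : ContinuousOn (fun x => 2 * gradSq K w (t, x) +
        4 * Cd * (m ^ 2)⁻¹ * w (t, x) ^ 2) {x | R < ‖x‖} :=
      (continuousOn_const.mul hgc).add (continuousOn_const.mul (hwc.pow 2))
    refine (lintegral_le_of_le_add (μ := volume.restrict {x | R < ‖x‖}) (v := fun x =>
        ∑ i : Fin n, (pd (region K) i.succ (cutSpace R m) (t, x) *
          (coord i.succ (t, x) * kap 1 (t, x) ^ 2 * w (t, x) ^ 2) +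
        cutSpace R m (t, x) * pd (region K) i.succ
          (fun q => coord i.succ q * kap 1 q ^ 2 * w q ^ 2) (t, x)))
      (Filter.Eventually.of_forall fun x => ?_) ((hac m).aestronglyMeasurable hO.measurableSet)
      (Filter.Eventually.of_forall fun x => ?_) (hbc.aestronglyMeasurable hO.measurableSet)
      (integrable_finsetSum _ fun i _ => (hdiv i).1) ?_
      ((ae_restrict_iff' hO.measurableSet).2 (Filter.Eventually.of_forall fun x hx =>
        hardy_pointwise hn hK hm hCd hw (hsub ⟨ht, hx⟩)))).trans (le_of_eq ?_)
    · have := cutSpace_nonneg R m (t, x)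
      exact mul_nonneg (by norm_num) (mul_nonneg this (by positivity))
    · have := gradSq_nonneg (K := K) w (t, x)
      simp only [Pi.zero_apply]; positivity
    · rw [integral_finsetSum _ fun i _ => (hdiv i).1]
      exact Finset.sum_eq_zero fun i _ => (hdiv i).2
    · have e : ∀ x, ENNReal.ofReal (2 * gradSq K w (t, x) + 4 * Cd * (m ^ 2)⁻¹ * w (t, x) ^ 2) =
          2 * ENNReal.ofReal (gradSq K w (t, x)) +
          ENNReal.ofReal (4 * Cd * (m ^ 2)⁻¹) * ENNReal.ofReal (w (t, x) ^ 2) := by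
        intro x
        have h1 := gradSq_nonneg (K := K) w (t, x)
        have h2 : 0 ≤ 4 * Cd * (m ^ 2)⁻¹ := by positivity
        rw [ENNReal.ofReal_add (by positivity) (by positivity), ENNReal.ofReal_mul two_pos.le,
          ENNReal.ofReal_mul h2, ENNReal.ofReal_ofNat]
      simp only [e]
      rw [lintegral_add_left' ((hgc.aemeasurable hO.measurableSet).ennreal_ofReal.const_mul _),
        lintegral_const_mul' _ _ ENNReal.ofNat_ne_top,
        lintegral_const_mul' _ _ ENNReal.ofReal_ne_top]
  set S : Set (Space n) := {x | 3 * R ^ 2 ≤ ‖x‖ ^ 2} with hS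
  have hSm : MeasurableSet S := (isClosed_le continuous_const (by fun_prop)).measurableSet
  have hSsub : S ⊆ {x | R < ‖x‖} := fun x hx =>
    lt_of_pow_lt_pow_left₀ 2 (norm_nonneg _) (lt_of_lt_of_le (by nlinarith [pow_pos hR0 2]) hx)
  have hlim : Filter.Tendsto
      (fun m : ℕ => 2 * G + ENNReal.ofReal (4 * Cd * (((m : ℝ) + 1) ^ 2)⁻¹) * Q)
      Filter.atTop (nhds (2 * G + ENNReal.ofReal (4 * Cd * 0) * Q)) := by
    refine tendsto_const_nhds.add (ENNReal.Tendsto.mul_const ?_ (Or.inr hL2))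
    refine ENNReal.tendsto_ofReal (tendsto_const_nhds.mul ?_)
    have l1 : Filter.Tendsto (fun m : ℕ => (m : ℝ) + 1) Filter.atTop Filter.atTop :=
      Filter.tendsto_atTop_add_const_right _ _ tendsto_natCast_atTop_atTop
    exact ((Filter.tendsto_pow_atTop two_ne_zero).comp l1).inv_tendsto_atTop
  have hfat : ∫⁻ x in S, ENNReal.ofReal (1 / 2 * (kap 1 (t, x) ^ 2 * w (t, x) ^ 2)) ≤
      2 * G := by
    calc _ ≤ Filter.liminf (fun m : ℕ => ∫⁻ x in S, ENNReal.ofReal (1 / 2 *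
          (cutSpace R ((m : ℝ) + 1) (t, x) * (kap 1 (t, x) ^ 2 * w (t, x) ^ 2)))) Filter.atTop := by
          refine le_trans (lintegral_mono_ae ?_) (lintegral_liminf_le' fun m => ?_)
          · filter_upwards [ae_restrict_mem hSm] with x hx
            have l1 : Filter.Tendsto (fun m : ℕ => (m : ℝ) + 1) Filter.atTop Filter.atTop :=
              Filter.tendsto_atTop_add_const_right _ _ tendsto_natCast_atTop_atTop
            rw [Filter.Tendsto.liminf_eq]
            refine (Filter.tendsto_congr' ?_).2 tendsto_const_nhds
            filter_upwards [l1.eventually_ge_atTop ‖x‖, l1.eventually_ge_atTop 1] with m h1 h2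
            have hm0 : (0 : ℝ) < m + 1 := by linarith
            have hone : cutSpace R ((m : ℝ) + 1) (t, x) = 1 := by
              have hx' : 3 * R ^ 2 ≤ ‖x‖ ^ 2 := hx
              have h3 : ‖x‖ ^ 2 ≤ ((m : ℝ) + 1) ^ 2 := by gcongr
              have a3 : 1 ≤ (R ^ 2)⁻¹ * ‖x‖ ^ 2 - 2 := by
                have : (R ^ 2)⁻¹ * (3 * R ^ 2) ≤ (R ^ 2)⁻¹ * ‖x‖ ^ 2 := by gcongr
                rw [mul_left_comm, inv_mul_cancel₀ (by positivity)] at this; linarith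
              have a4 : 1 ≤ 2 - (((m : ℝ) + 1) ^ 2)⁻¹ * ‖x‖ ^ 2 := by
                have : (((m : ℝ) + 1) ^ 2)⁻¹ * ‖x‖ ^ 2 ≤
                  (((m : ℝ) + 1) ^ 2)⁻¹ * ((m : ℝ) + 1) ^ 2 := by gcongr
                rw [inv_mul_cancel₀ (by positivity)] at this; linarith
              simp [cutSpace, Real.smoothTransition.one_of_one_le, a3, a4]
            rw [hone, one_mul]
          · exact (((hac _).mono hSsub).aemeasurable hSm).ennreal_ofReal
      _ ≤ Filter.liminf (fun m : ℕ => 2 * G +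
          ENNReal.ofReal (4 * Cd * (((m : ℝ) + 1) ^ 2)⁻¹) * Q) Filter.atTop := by
          refine Filter.liminf_le_liminf (Filter.Eventually.of_forall fun m => ?_)
          exact (lintegral_mono_set hSsub).trans (est _ (by positivity))
      _ = 2 * G := by rw [hlim.liminf_eq]; simp
  calc ∫⁻ x in S, ENNReal.ofReal (w (t, x) ^ 2 / ‖x‖ ^ 2) ≤
        ∫⁻ x in S, 4 * ENNReal.ofReal (1 / 2 * (kap 1 (t, x) ^ 2 * w (t, x) ^ 2)) := by
        refine setLIntegral_mono' hSm fun x hx => ?_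
        have h4 : (4 : ℝ≥0∞) = ENNReal.ofReal 4 := by simp
        rw [h4, ← ENNReal.ofReal_mul (by norm_num)]
        refine ENNReal.ofReal_le_ofReal ?_
        have hx1 : 1 ≤ ‖x‖ ^ 2 := le_trans (by nlinarith) (show 3 * R ^ 2 ≤ ‖x‖ ^ 2 from hx)
        have hk := kap_sq_mul one_pos ((t, x) : Spacetime n)
        simp only [one_pow] at hk
        have hk0 := sq_nonneg (kap 1 ((t, x) : Spacetime n))
        rw [div_le_iff₀ (by linarith)]
        have : 1 ≤ 2 * kap 1 (t, x) ^ 2 * ‖x‖ ^ 2 := by nlinarith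
        nlinarith [mul_le_mul_of_nonneg_right this (sq_nonneg (w (t, x)))]
    _ = 4 * ∫⁻ x in S, ENNReal.ofReal (1 / 2 * (kap 1 (t, x) ^ 2 * w (t, x) ^ 2)) :=
        lintegral_const_mul' _ _ ENNReal.ofNat_ne_top
    _ ≤ 4 * (2 * G) := mul_le_mul_right hfat _
    _ = 8 * G := by rw [← mul_assoc]; norm_num

end Hardy

/-! ### The weight of an asymptotically flat metric -/

section Weight

variable {K : Set (Space n)} {φ : ℕ → Space n → ℝ} {c : ℕ → ℝ} {x : Space n}

lemma IsDyadicPartition.abs_le_one (hφ : IsDyadicPartition φ) (j : ℕ) (x : Space n) :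
    |φ j x| ≤ 1 := by
  have h := le_hasSum (hφ.sum_sq x) j fun _ _ => sq_nonneg _
  exact (sq_le_one_iff_abs_le_one _).1 h

lemma IsDyadicPartition.norm_le (hφ : IsDyadicPartition φ) {j : ℕ} (h : φ j x ≠ 0) :
    ‖x‖ ≤ 2 ^ (j + 1) := by
  by_contra! h'
  exact h (hφ.zero_of_lt j x h')

lemma IsDyadicPartition.le_norm (hφ : IsDyadicPartition φ) (hx : 1 ≤ ‖x‖) {j : ℕ}
    (h : φ j x ≠ 0) : (2 : ℝ) ^ j ≤ 2 * ‖x‖ := by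
  rcases j with _ | j
  · simp only [pow_zero]; linarith
  · by_contra! h'
    refine h (hφ.zero_of_gt j x ?_)
    rw [pow_succ] at h'
    linarith

lemma IsDyadicPartition.eq_zero_of_lt (hφ : IsDyadicPartition φ) {J j : ℕ} (hj : j < J)
    (hx : (2 : ℝ) ^ J < ‖x‖) : φ j x = 0 :=
  hφ.zero_of_lt j x ((pow_le_pow_right₀ one_le_two (by omega)).trans_lt hx)

/-- A finite `ℓ^s_1 L^∞` norm bounds a continuous function at every point of the exterior, not
only almost everywhere. -/
lemma exists_summable_bound {R₀ : ℝ} (hsub : exterior n R₀ ⊆ region K)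
    (hφ : IsDyadicPartition φ) {s : ℝ} {f : Spacetime n → ℝ} (hf : ContinuousOn f (region K))
    (h : normEll1Linf φ K s f < ⊤) :
    ∃ b : ℕ → ℝ, (∀ j, 0 ≤ b j) ∧ Summable b ∧ ∀ (j : ℕ), ∀ p ∈ exterior n R₀,
      (2 : ℝ) ^ ((j : ℝ) * s) * |φ j p.2 * f p| ≤ b j := by
  rw [normEll1Linf] at h
  refine ⟨fun j => (dyad j s * eLpNorm (fun p => φ j p.2 * f p) ⊤
    (volume.restrict (region K))).toReal, fun j => ENNReal.toReal_nonneg,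
    ENNReal.summable_toReal h.ne, fun j p hp => ?_⟩
  set e := eLpNorm (fun p => φ j p.2 * f p) ⊤ (volume.restrict (region K)) with he
  have hc : ContinuousOn (fun p : Spacetime n => ‖φ j p.2 * f p‖ₑ) (exterior n R₀) := by
    refine continuous_enorm.comp_continuousOn (ContinuousOn.mul ?_ (hf.mono hsub))
    exact ((hφ.smooth j).continuous.comp continuous_snd).continuousOn
  have hle : ‖φ j p.2 * f p‖ₑ ≤ e := by
    by_contra! hlt
    have hU : IsOpen (exterior n R₀ ∩ (fun p : Spacetime n => ‖φ j p.2 * f p‖ₑ) ⁻¹' Set.Ioi e) :=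
      hc.isOpen_inter_preimage (isOpen_exterior R₀) isOpen_Ioi
    have hae : ∀ᵐ q ∂(volume.restrict (region K)), ‖φ j q.2 * f q‖ₑ ≤ e := by
      rw [he, eLpNorm_exponent_top]
      exact ae_le_eLpNormEssSup
    have h0 : volume (exterior n R₀ ∩
        (fun p : Spacetime n => ‖φ j p.2 * f p‖ₑ) ⁻¹' Set.Ioi e) = 0 := by
      have h1 := ae_restrict_of_ae_restrict_of_subset hsub hae
      rw [ae_restrict_iff' (isOpen_exterior R₀).measurableSet] at h1
      refine measure_mono_null ?_ h1
      rintro q ⟨hq1, hq2⟩ h2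
      exact absurd (h2 hq1) (not_le.2 hq2)
    exact (Set.eq_empty_iff_forall_notMem.1 ((hU.measure_eq_zero_iff volume).1 h0) p) ⟨hp, hlt⟩
  have hpos : (0 : ℝ) < 2 ^ ((j : ℝ) * s) := Real.rpow_pos_of_pos two_pos _
  have h2 : dyad j s * ‖φ j p.2 * f p‖ₑ ≤ dyad j s * e := by gcongr
  have h3 := ENNReal.toReal_mono (ENNReal.ne_top_of_tsum_ne_top h.ne j) h2
  rwa [dyad, ENNReal.toReal_mul, ENNReal.toReal_ofReal hpos.le, toReal_enorm,
    Real.norm_eq_abs] at h3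

lemma exists_tensor_bound (hK : IsClosed K) {R₀ : ℝ} (hsub : exterior n R₀ ⊆ region K)
    (hφ : IsDyadicPartition φ) {h : TensorField n} {σ : ℕ} (hs : SmoothTensor K h)
    (hd : DecaysAtRate φ K σ h) (m : ℕ) :
    ∃ c : ℕ → ℝ, (∀ j, 0 ≤ c j) ∧ Summable c ∧ ∀ j, ∀ p ∈ exterior n R₀, ∀ α β,
      |φ j p.2 * h p α β| ≤ c j ∧ ∀ L : List (Fin (n + 1)), L ≠ [] → L.length ≤ m →
        |φ j p.2 * wordDeriv K L (fun q => h q α β) p| ≤ ((2 : ℝ) ^ j)⁻¹ * c j := by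
  have hsm : ∀ (a : Fin (n + 1) → ℕ) (α β : Fin (n + 1)),
      ContinuousOn (mpd (region K) a fun p => h p α β) (region K) := by
    intro a α β
    obtain ⟨W, -, -, h3⟩ := exists_word_eq_mpd K a
    rw [h3]
    exact (SmoothOn.wordDeriv hK (hs α β) W).continuousOn
  choose b hb0 hbs hb using fun a α β => exists_summable_bound hsub hφ (hsm a α β) (hd a α β)
  set T : Finset (Fin (n + 1) → ℕ) := Fintype.piFinset fun _ => Finset.range (m + 1)
  have hle : ∀ a ∈ T, ∀ α β j, b a α β j ≤ ∑ a ∈ T, ∑ α, ∑ β, b a α β j := by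
    intro a ha α β j
    have h1 := Finset.single_le_sum (f := fun β => b a α β j) (fun β _ => hb0 a α β j)
      (Finset.mem_univ β)
    have h2 := Finset.single_le_sum (f := fun α => ∑ β, b a α β j)
      (fun α _ => Finset.sum_nonneg fun β _ => hb0 a α β j) (Finset.mem_univ α)
    have h3 := Finset.single_le_sum (f := fun a => ∑ α, ∑ β, b a α β j)
      (fun a _ => Finset.sum_nonneg fun α _ => Finset.sum_nonneg fun β _ => hb0 a α β j) ha
    exact h1.trans (h2.trans h3)
  refine ⟨fun j => ∑ a ∈ T, ∑ α, ∑ β, b a α β j, fun j => Finset.sum_nonneg fun a _ =>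
    Finset.sum_nonneg fun α _ => Finset.sum_nonneg fun β _ => hb0 a α β j,
    summable_sum fun a _ => summable_sum fun α _ => summable_sum fun β _ => hbs a α β, ?_⟩
  intro j p hp α β
  constructor
  · refine le_trans ?_ (hle 0 (by simp [T]) α β j)
    refine le_trans ?_ (hb 0 α β j p hp)
    have h0 : mpd (region K) 0 (fun p => h p α β) = fun p => h p α β := by
      obtain ⟨W, h1, -, h3⟩ := exists_word_eq_mpd K (0 : Fin (n + 1) → ℕ)
      have : W = [] := by simpa using h1
      rw [h3, this, wordDeriv_nil]
    rw [h0]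
    exact le_mul_of_one_le_left (abs_nonneg _)
      (Real.one_le_rpow one_le_two (by positivity))
  · intro L hL hLm
    have ha : (fun i => L.count i) ∈ T := by
      simp only [T, Fintype.mem_piFinset, Finset.mem_range]
      exact fun i => Nat.lt_succ_of_le (List.count_le_length.trans hLm)
    have h1 := (hb _ α β j p hp).trans (hle _ ha α β j)
    rw [← wordDeriv_eqOn_mpd hK L (hs α β) (hsub hp)] at h1
    rw [inv_mul_eq_div, le_div_iff₀ (by positivity), mul_comm]
    refine le_trans (mul_le_mul_of_nonneg_right ?_ (abs_nonneg _)) h1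
    rw [← Real.rpow_natCast]
    refine Real.rpow_le_rpow_of_exponent_le one_le_two (le_mul_of_one_le_right (by positivity) ?_)
    have : 1 ≤ ∑ i, L.count i + σ := by
      rw [sum_count_eq_length]
      have := List.length_pos_of_ne_nil hL
      omega
    exact_mod_cast this

/-- The dyadic profile of an asymptotically flat metric: one summable sequence controls the
deviation from the Minkowski metric and, with a gain of `2^{-j}`, all derivatives up to order
`m`. The two parts of the metric play the same role here, and the first need not be radial. -/
lemma IsAsymptoticallyFlat.exists_profile (hK : IsClosed K) {R₀ : ℝ}
    (hsub : exterior n R₀ ⊆ region K) (hφ : IsDyadicPartition φ) {g : TensorField n}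
    (hflat : IsAsymptoticallyFlat φ K g) (m : ℕ) :
    ∃ c : ℕ → ℝ, (∀ j, 0 ≤ c j) ∧ Summable c ∧ ∀ j, ∀ p ∈ exterior n R₀, ∀ α β,
      |φ j p.2 * (g p α β - minkowski n α β)| ≤ c j ∧
      ∀ L : List (Fin (n + 1)), L ≠ [] → L.length ≤ m →
        |φ j p.2 * wordDeriv K L (fun q => g q α β) p| ≤ ((2 : ℝ) ^ j)⁻¹ * c j := by
  obtain ⟨g₁, g₂, hg, hs₁, hs₂, -, hd₁, hd₂⟩ := hflat
  obtain ⟨c₁, hc₁, hcs₁, hb₁⟩ := exists_tensor_bound hK hsub hφ hs₁ hd₁ m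
  obtain ⟨c₂, hc₂, hcs₂, hb₂⟩ := exists_tensor_bound hK hsub hφ hs₂ hd₂ m
  refine ⟨fun j => c₁ j + c₂ j, fun j => add_nonneg (hc₁ j) (hc₂ j), hcs₁.add hcs₂, ?_⟩
  intro j p hp α β
  obtain ⟨h1, h1'⟩ := hb₁ j p hp α β
  obtain ⟨h2, h2'⟩ := hb₂ j p hp α β
  constructor
  · have e : φ j p.2 * (g p α β - minkowski n α β) =
        φ j p.2 * g₁ p α β + φ j p.2 * g₂ p α β := by
      rw [hg p (hsub hp)]
      simp only [Matrix.add_apply]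
      ring
    rw [e]
    exact (abs_add_le _ _).trans (add_le_add h1 h2)
  · intro L hL hLm
    have e1 : Set.EqOn (fun q => g q α β)
        (fun q => minkowski n α β + (g₁ q α β + g₂ q α β)) (region K) := by
      intro q hq
      simp only [hg q hq, Matrix.add_apply]
      ring
    have e2 : wordDeriv K L (fun q => g q α β) p =
        wordDeriv K L (fun q => g₁ q α β) p + wordDeriv K L (fun q => g₂ q α β) p := by
      rw [wordDeriv_congr e1 L (hsub hp), wordDeriv_add hK L contDiffOn_const
        ((hs₁ α β).add (hs₂ α β)) (hsub hp), wordDeriv_const _ hL]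
      simp only [zero_add]
      exact wordDeriv_add hK L (hs₁ α β) (hs₂ α β) (hsub hp)
    rw [e2, mul_add, mul_add]
    exact (abs_add_le _ _).trans (add_le_add (h1' L hL hLm) (h2' L hL hLm))

/-- The weight `∑_j 2^{-j} c_j |φ_j|` of a dyadic profile `c`. -/
def weight (φ : ℕ → Space n → ℝ) (c : ℕ → ℝ) (x : Space n) : ℝ :=
  ∑' j, |φ j x| * (((2 : ℝ) ^ j)⁻¹ * c j)

lemma weight_term_nonneg (hc : ∀ j, 0 ≤ c j) (j : ℕ) (x : Space n) :
    0 ≤ |φ j x| * (((2 : ℝ) ^ j)⁻¹ * c j) := by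
  have := hc j
  positivity

lemma weight_nonneg (hc : ∀ j, 0 ≤ c j) (x : Space n) : 0 ≤ weight φ c x :=
  tsum_nonneg fun j => weight_term_nonneg hc j x

lemma weight_term_le (hφ : IsDyadicPartition φ) (hc : ∀ j, 0 ≤ c j) (j : ℕ) (x : Space n) :
    |φ j x| * (((2 : ℝ) ^ j)⁻¹ * c j) ≤ c j := by
  have h1 : ((2 : ℝ) ^ j)⁻¹ ≤ 1 := inv_le_one_of_one_le₀ (one_le_pow₀ one_le_two)
  have h2 : ((2 : ℝ) ^ j)⁻¹ * c j ≤ c j := mul_le_of_le_one_left (hc j) h1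
  exact (mul_le_of_le_one_left (by have := hc j; positivity) (hφ.abs_le_one j x)).trans h2

lemma summable_weight (hφ : IsDyadicPartition φ) (hc : ∀ j, 0 ≤ c j) (hs : Summable c)
    (x : Space n) : Summable fun j => |φ j x| * (((2 : ℝ) ^ j)⁻¹ * c j) :=
  Summable.of_nonneg_of_le (fun j => weight_term_nonneg hc j x)
    (fun j => weight_term_le hφ hc j x) hs

lemma continuous_weight (hφ : IsDyadicPartition φ) (hc : ∀ j, 0 ≤ c j) (hs : Summable c) :
    Continuous (weight φ c) := by
  refine continuous_tsum (fun j => ((hφ.smooth j).continuous.abs).mul continuous_const) hs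
    fun j x => ?_
  rw [Real.norm_of_nonneg (weight_term_nonneg hc j x)]
  exact weight_term_le hφ hc j x

/-- As `∑ φ_j² = 1` and `φ_j² ≤ |φ_j|`, dyadic bounds add up to a bound by the weight. -/
lemma abs_le_tsum_of_dyadic (hφ : IsDyadicPartition φ) {v : ℝ} {b : ℕ → ℝ}
    (hb : Summable fun j => |φ j x| * b j) (h : ∀ j, |φ j x * v| ≤ b j) :
    |v| ≤ ∑' j, |φ j x| * b j := by
  have h1 : HasSum (fun j => φ j x ^ 2 * |v|) |v| := by
    simpa using (hφ.sum_sq x).mul_right |v|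
  rw [← h1.tsum_eq]
  refine h1.summable.tsum_le_tsum (fun j => ?_) hb
  rw [← sq_abs, sq, mul_assoc, ← abs_mul]
  exact mul_le_mul_of_nonneg_left (h j) (abs_nonneg _)

lemma abs_le_weight (hφ : IsDyadicPartition φ) (hc : ∀ j, 0 ≤ c j) (hs : Summable c) {v : ℝ}
    (h : ∀ j, |φ j x * v| ≤ ((2 : ℝ) ^ j)⁻¹ * c j) : |v| ≤ weight φ c x :=
  abs_le_tsum_of_dyadic hφ (summable_weight hφ hc hs x) h

lemma abs_le_norm_mul_weight (hφ : IsDyadicPartition φ) (hc : ∀ j, 0 ≤ c j) (hs : Summable c)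
    (hx : 1 ≤ ‖x‖) {v : ℝ} (h : ∀ j, |φ j x * v| ≤ c j) : |v| ≤ 2 * ‖x‖ * weight φ c x := by
  have h0 := (summable_weight hφ hc hs x).mul_left (2 * ‖x‖)
  have h1 : ∀ j, |φ j x| * c j ≤ 2 * ‖x‖ * (|φ j x| * (((2 : ℝ) ^ j)⁻¹ * c j)) := by
    intro j
    by_cases hj : φ j x = 0
    · simp [hj]
    have h2 := hφ.le_norm hx hj
    have h3 : 1 ≤ 2 * ‖x‖ * ((2 : ℝ) ^ j)⁻¹ := by
      rw [← div_eq_mul_inv]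
      exact (one_le_div (by positivity)).2 h2
    have h4 : 0 ≤ |φ j x| * c j := mul_nonneg (abs_nonneg _) (hc j)
    calc |φ j x| * c j ≤ 2 * ‖x‖ * ((2 : ℝ) ^ j)⁻¹ * (|φ j x| * c j) :=
          le_mul_of_one_le_left h4 h3
      _ = _ := by ring
  have h5 : Summable fun j => |φ j x| * c j :=
    Summable.of_nonneg_of_le (fun j => mul_nonneg (abs_nonneg _) (hc j)) h1 h0
  refine (abs_le_tsum_of_dyadic hφ h5 h).trans ?_
  rw [weight, ← tsum_mul_left]
  exact h5.tsum_le_tsum h1 h0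

lemma norm_mul_weight_le_tail (hφ : IsDyadicPartition φ) (hc : ∀ j, 0 ≤ c j) (hs : Summable c)
    {J : ℕ} (hx : (2 : ℝ) ^ J < ‖x‖) : ‖x‖ * weight φ c x ≤ 2 * ∑' j, c (j + J) := by
  have hsum := summable_weight hφ hc hs x
  have h0 : ∑ j ∈ Finset.range J, |φ j x| * (((2 : ℝ) ^ j)⁻¹ * c j) = 0 :=
    Finset.sum_eq_zero fun j hj => by
      rw [hφ.eq_zero_of_lt (Finset.mem_range.1 hj) hx]; simp
  have hJ := (summable_nat_add_iff J).2 hsum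
  rw [weight, ← hsum.sum_add_tsum_nat_add J, h0, zero_add, ← tsum_mul_left, ← tsum_mul_left]
  refine (hJ.mul_left _).tsum_le_tsum (fun j => ?_) (((summable_nat_add_iff J).2 hs).mul_left _)
  by_cases hj : φ (j + J) x = 0
  · simpa [hj] using hc (j + J)
  have h1 := hφ.norm_le hj
  rw [pow_succ] at h1
  have h2 : ‖x‖ * ((2 : ℝ) ^ (j + J))⁻¹ ≤ 2 := by
    rw [← div_eq_mul_inv, div_le_iff₀ (by positivity)]; linarith
  have hcj := hc (j + J)
  calc ‖x‖ * (|φ (j + J) x| * (((2 : ℝ) ^ (j + J))⁻¹ * c (j + J)))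
      = |φ (j + J) x| * ((‖x‖ * ((2 : ℝ) ^ (j + J))⁻¹) * c (j + J)) := by ring
    _ ≤ 1 * (2 * c (j + J)) := by
        gcongr
        exact hφ.abs_le_one _ _
    _ = _ := one_mul _

/-- The weight is a small multiplier on the local energy space far out: each `φ_j` lives in one
dyadic annulus, and the profile is summable. -/
lemma lintegral_weight_mul_le (hφ : IsDyadicPartition φ) (hc : ∀ j, 0 ≤ c j) (hs : Summable c)
    {J : ℕ} {R : ℝ} (hR : (2 : ℝ) ^ J ≤ R) {g : Spacetime n → ℝ≥0∞}
    (hg : AEMeasurable g (volume.restrict (exterior n R))) :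
    ∫⁻ p in exterior n R, ENNReal.ofReal (weight φ c p.2) * g p ≤
      ENNReal.ofReal (∑' j, c (j + J)) * ⨆ j : ℕ, ENNReal.ofReal ((2 : ℝ) ^ j)⁻¹ *
        ∫⁻ p in exterior n R ∩ annulus n (2 ^ j), g p := by
  set S := ⨆ j : ℕ, ENNReal.ofReal ((2 : ℝ) ^ j)⁻¹ *
    ∫⁻ p in exterior n R ∩ annulus n (2 ^ j), g p with hS
  have hm := (isOpen_exterior (n := n) R).measurableSet
  have h1R : (1 : ℝ) ≤ R := (one_le_pow₀ one_le_two).trans hR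
  have e1 : ∀ p : Spacetime n, ENNReal.ofReal (weight φ c p.2) * g p =
      ∑' j, ENNReal.ofReal (|φ j p.2| * (((2 : ℝ) ^ j)⁻¹ * c j)) * g p := by
    intro p
    rw [weight, ENNReal.ofReal_tsum_of_nonneg (fun j => weight_term_nonneg hc j p.2)
      (summable_weight hφ hc hs p.2), ENNReal.tsum_mul_right]
  have hmeas : ∀ j : ℕ, AEMeasurable (fun p : Spacetime n =>
      ENNReal.ofReal (|φ j p.2| * (((2 : ℝ) ^ j)⁻¹ * c j)) * g p)
      (volume.restrict (exterior n R)) := by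
    intro j
    refine AEMeasurable.mul ?_ hg
    have : Continuous fun p : Spacetime n => |φ j p.2| * (((2 : ℝ) ^ j)⁻¹ * c j) :=
      (((hφ.smooth j).continuous.comp continuous_snd).abs).mul continuous_const
    exact this.measurable.ennreal_ofReal.aemeasurable
  simp only [e1]
  rw [lintegral_tsum hmeas]
  have hzero : ∀ j ∈ Finset.range J, ∫⁻ p in exterior n R,
      ENNReal.ofReal (|φ j p.2| * (((2 : ℝ) ^ j)⁻¹ * c j)) * g p = 0 := by
    intro j hj
    rw [← lintegral_zero (μ := volume.restrict (exterior n R))]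
    refine setLIntegral_congr_fun hm fun p hp => ?_
    simp [hφ.eq_zero_of_lt (Finset.mem_range.1 hj) (hR.trans_lt hp.2)]
  have hterm : ∀ j, ∫⁻ p in exterior n R,
      ENNReal.ofReal (|φ j p.2| * (((2 : ℝ) ^ j)⁻¹ * c j)) * g p ≤ ENNReal.ofReal (c j) * S := by
    intro j
    calc ∫⁻ p in exterior n R, ENNReal.ofReal (|φ j p.2| * (((2 : ℝ) ^ j)⁻¹ * c j)) * g p
        ≤ ∫⁻ p in exterior n R, (annulus n (2 ^ j)).indicator
            (fun p => ENNReal.ofReal (((2 : ℝ) ^ j)⁻¹ * c j) * g p) p := by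
          refine setLIntegral_mono' hm fun p hp => ?_
          have hp1 : 1 ≤ ‖p.2‖ := h1R.trans (le_of_lt hp.2)
          by_cases hj : φ j p.2 = 0
          · simp [hj]
          · have hpa : p ∈ annulus n (2 ^ j) := by
              have h1 := hφ.le_norm hp1 hj
              have h2 := hφ.norm_le hj
              rw [pow_succ] at h2
              exact ⟨by linarith, by linarith⟩
            rw [Set.indicator_of_mem hpa]
            refine mul_le_mul' (ENNReal.ofReal_le_ofReal ?_) le_rfl
            exact mul_le_of_le_one_left (mul_nonneg (by positivity) (hc j)) (hφ.abs_le_one _ _)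
      _ = ∫⁻ p in exterior n R ∩ annulus n (2 ^ j),
            ENNReal.ofReal (((2 : ℝ) ^ j)⁻¹ * c j) * g p := by
          rw [lintegral_indicator (measurableSet_annulus _),
            Measure.restrict_restrict (measurableSet_annulus _), Set.inter_comm]
      _ = ENNReal.ofReal (c j) * (ENNReal.ofReal ((2 : ℝ) ^ j)⁻¹ *
            ∫⁻ p in exterior n R ∩ annulus n (2 ^ j), g p) := by
          rw [lintegral_const_mul' _ _ ENNReal.ofReal_ne_top, mul_comm _ (c j),
            ENNReal.ofReal_mul (hc j), mul_assoc]
      _ ≤ ENNReal.ofReal (c j) * S := by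
          gcongr
          exact le_iSup (fun j : ℕ => ENNReal.ofReal ((2 : ℝ) ^ j)⁻¹ *
            ∫⁻ p in exterior n R ∩ annulus n (2 ^ j), g p) j
  rw [← ENNReal.summable.sum_add_tsum_nat_add' (k := J), Finset.sum_eq_zero hzero, zero_add,
    ENNReal.ofReal_tsum_of_nonneg (fun j => hc _) ((summable_nat_add_iff J).2 hs),
    ← ENNReal.tsum_mul_right]
  exact ENNReal.tsum_le_tsum fun j => hterm _

lemma minkowski_mul_self : minkowski n * minkowski n = 1 := by
  rw [minkowski, Matrix.diagonal_mul_diagonal, ← Matrix.diagonal_one]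
  congr 1
  ext i
  refine Fin.cases ?_ (fun i => ?_) i <;> simp

lemma abs_minkowski_le (α β : Fin (n + 1)) : |minkowski n α β| ≤ 1 := by
  rw [minkowski, Matrix.diagonal_apply]
  split_ifs with h
  · refine Fin.cases ?_ (fun i => ?_) α <;> simp
  · simp

lemma exists_det_le (n : ℕ) : ∃ ε : ℝ, 0 < ε ∧ ∀ A : Matrix (Fin (n + 1)) (Fin (n + 1)) ℝ,
    (∀ α β, |A α β - minkowski n α β| ≤ ε) → 1 / 2 ≤ -A.det := by
  have hc : Continuous fun B : Fin (n + 1) → Fin (n + 1) → ℝ => (Matrix.of B).det :=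
    Continuous.matrix_det continuous_id
  obtain ⟨ε, hε, h⟩ := Metric.continuousAt_iff.1
    (hc.continuousAt (x := fun α β => minkowski n α β)) (1 / 2) (by norm_num)
  refine ⟨ε / 2, by positivity, fun A hA => ?_⟩
  have h1 := h (x := fun α β => A α β) (by
    refine lt_of_le_of_lt ((dist_pi_le_iff (by positivity)).2 fun α =>
      (dist_pi_le_iff (by positivity)).2 fun β => ?_) (half_lt_self hε)
    rw [Real.dist_eq]
    exact hA α β)
  have e1 : (Matrix.of fun α β => minkowski n α β).det = -1 := det_minkowski n
  have e2 : (Matrix.of fun α β => A α β).det = A.det := rfl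
  rw [e1, e2, Real.dist_eq, abs_lt] at h1
  linarith [h1.1, h1.2]

/-- `g⁻¹ - m = -g⁻¹ (g - m) m`. -/
lemma abs_inv_sub_minkowski_le {A : Matrix (Fin (n + 1)) (Fin (n + 1)) ℝ} (hA : IsUnit A.det)
    {B ε : ℝ} (hB : ∀ α β, |A⁻¹ α β| ≤ B) (hε : ∀ α β, |A α β - minkowski n α β| ≤ ε)
    (α β : Fin (n + 1)) :
    |A⁻¹ α β - minkowski n α β| ≤ ((n : ℝ) + 1) ^ 2 * (B * ε) := by
  have e : A⁻¹ - minkowski n = A⁻¹ * (minkowski n - A) * minkowski n := by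
    rw [Matrix.mul_sub, Matrix.sub_mul, Matrix.mul_assoc, minkowski_mul_self,
      Matrix.nonsing_inv_mul A hA, Matrix.mul_one, Matrix.one_mul]
  have hB0 : 0 ≤ B := (abs_nonneg _).trans (hB 0 0)
  have hε0 : 0 ≤ ε := (abs_nonneg _).trans (hε 0 0)
  have hcard : ∀ {f : Fin (n + 1) → ℝ} {b : ℝ}, (∀ i, |f i| ≤ b) →
      |∑ i, f i| ≤ ((n : ℝ) + 1) * b := by
    intro f b hf
    simpa using abs_sum_le_card_mul hf
  rw [← Matrix.sub_apply, e, Matrix.mul_apply]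
  have h1 : ∀ γ, |(A⁻¹ * (minkowski n - A)) α γ| ≤ ((n : ℝ) + 1) * (B * ε) := by
    intro γ
    rw [Matrix.mul_apply]
    refine hcard fun i => ?_
    rw [abs_mul, Matrix.sub_apply, abs_sub_comm]
    exact mul_le_mul (hB _ _) (hε _ _) (abs_nonneg _) hB0
  refine (hcard fun γ => ?_).trans (le_of_eq (by ring :
    ((n : ℝ) + 1) * (((n : ℝ) + 1) * (B * ε) * 1) = _))
  rw [abs_mul]
  exact mul_le_mul (h1 γ) (abs_minkowski_le _ _) (abs_nonneg _) (by positivity)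

/-- Far out, an asymptotically flat metric is a symbol metric for the weight of its profile. -/
theorem IsAsymptoticallyFlat.exists_symbolMetric (hK : IsClosed K) {R₀ : ℝ}
    (hKR : K ⊆ Metric.ball 0 R₀) (hφ : IsDyadicPartition φ) {g : TensorField n}
    (hg : IsLorentzianMetric K g) (hflat : IsAsymptoticallyFlat φ K g) (m : ℕ) :
    ∃ c : ℕ → ℝ, (∀ j, 0 ≤ c j) ∧ Summable c ∧ ∃ R : ℝ, 1 ≤ R ∧ R₀ ≤ R ∧
      SymbolMetric K (exterior n R) (fun p => weight φ c p.2) m g ∧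
      ∃ A : ℝ, 0 ≤ A ∧ ∀ p ∈ exterior n R, ∀ α β,
        |(g p)⁻¹ α β - minkowski n α β| ≤ A * weight φ c p.2 * ‖p.2‖ := by
  obtain ⟨c, hc, hs, hb⟩ :=
    hflat.exists_profile hK (exterior_subset_region hKR le_rfl) hφ (m + 1)
  obtain ⟨ε, hε, hdet⟩ := exists_det_le n
  have hlim := tendsto_sum_nat_add c
  obtain ⟨J, hJ⟩ := (hlim.eventually (gt_mem_nhds (show (0 : ℝ) < min (ε / 4) (1 / 2) by
    positivity))).exists
  obtain ⟨hJ1, hJ2⟩ := lt_min_iff.1 hJ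
  set R : ℝ := max R₀ (2 ^ J)
  have hR1 : 1 ≤ R := (one_le_pow₀ one_le_two).trans (le_max_right _ _)
  have hsub : exterior n R ⊆ region K := exterior_subset_region hKR (le_max_left _ _)
  have hb' : ∀ p ∈ exterior n R, p ∈ exterior n R₀ := fun p hp =>
    ⟨hp.1, show R₀ < ‖p.2‖ from lt_of_le_of_lt (le_max_left _ _) hp.2⟩
  have hn1 : ∀ p ∈ exterior n R, 1 ≤ ‖p.2‖ := fun p hp => hR1.trans (le_of_lt hp.2)
  have htail : ∀ p ∈ exterior n R, ‖p.2‖ * weight φ c p.2 ≤ 2 * ∑' j, c (j + J) := fun p hp =>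
    norm_mul_weight_le_tail hφ hc hs ((le_max_right _ _).trans_lt hp.2)
  have hle1 : ∀ p ∈ exterior n R, weight φ c p.2 ≤ 1 := fun p hp =>
    (le_mul_of_one_le_left (weight_nonneg hc _) (hn1 p hp)).trans
      ((htail p hp).trans (by linarith))
  have hdev : ∀ p ∈ exterior n R, ∀ α β,
      |g p α β - minkowski n α β| ≤ 2 * ‖p.2‖ * weight φ c p.2 := fun p hp α β =>
    abs_le_norm_mul_weight hφ hc hs (hn1 p hp) fun j => (hb j p (hb' p hp) α β).1
  have hsmall : ∀ p ∈ exterior n R, ∀ α β, |g p α β - minkowski n α β| ≤ ε := fun p hp α β =>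
    (hdev p hp α β).trans (by linarith [htail p hp])
  have hSM : SymbolMetric K (exterior n R) (fun p => weight φ c p.2) m g := by
    refine ⟨hg, hK, hsub, fun p _ => weight_nonneg hc _, hle1, fun α β => ⟨hg.1 α β, ?_, ?_⟩,
      1 / 2, by norm_num, fun p hp => hdet _ (hsmall p hp)⟩
    · refine ⟨ε + 1, fun p hp => ?_⟩
      have h1 := abs_add_le (g p α β - minkowski n α β) (minkowski n α β)
      rw [sub_add_cancel] at h1
      exact h1.trans (add_le_add (hsmall p hp α β) (abs_minkowski_le α β))
    · refine fun γ => ⟨1, zero_le_one, fun L hL p hp => ?_⟩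
      rw [one_mul, ← wordDeriv_cons]
      exact abs_le_weight hφ hc hs fun j => (hb j p (hb' p hp) α β).2 _ (by simp)
        (by simpa using hL)
  refine ⟨c, hc, hs, R, hR1, le_max_left _ _, hSM, ?_⟩
  choose B hB using fun α β => (hSM.inv α β).bdd
  set B' : ℝ := ∑ α, ∑ β, |B α β|
  have hBB : ∀ p ∈ exterior n R, ∀ α β, |(g p)⁻¹ α β| ≤ B' := by
    intro p hp α β
    refine (hB α β p hp).trans ((le_abs_self _).trans ?_)
    exact (Finset.single_le_sum (f := fun β => |B α β|) (fun _ _ => abs_nonneg _)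
      (Finset.mem_univ β)).trans (Finset.single_le_sum (f := fun α => ∑ β, |B α β|)
      (fun _ _ => Finset.sum_nonneg fun _ _ => abs_nonneg _) (Finset.mem_univ α))
  have hB0 : 0 ≤ B' := Finset.sum_nonneg fun _ _ => Finset.sum_nonneg fun _ _ => abs_nonneg _
  refine ⟨((n : ℝ) + 1) ^ 2 * (B' * 2), by positivity, fun p hp α β => ?_⟩
  have hu : IsUnit (g p).det := by
    have := hdet _ (hsmall p hp)
    exact isUnit_iff_ne_zero.2 (by linarith)
  refine (abs_inv_sub_minkowski_le hu (hBB p hp) (hdev p hp) α β).trans (le_of_eq ?_)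
  ring

end Weight

/-! ### Mixed norms as integrals over space-time -/

section Norms

variable {K : Set (Space n)}

lemma measurableSet_region (hK : IsClosed K) : MeasurableSet (region K) :=
  measurableSet_Ici.prod hK.isOpen_compl.measurableSet

/-- The initial slice is a null set. -/
lemma volume_restrict_region_inter (K : Set (Space n)) (S : Set (Spacetime n)) :
    (volume : Measure (Spacetime n)).restrict (region K ∩ S) =
      volume.restrict (Set.Ioi 0 ×ˢ Kᶜ ∩ S) := by
  refine Measure.restrict_congr_set (Filter.EventuallyEq.inter ?_ Filter.EventuallyEq.rfl)
  rw [Measure.volume_eq_prod]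
  exact Measure.set_prod_ae_eq Ioi_ae_eq_Ici.symm Filter.EventuallyEq.rfl

lemma volume_restrict_region (K : Set (Space n)) :
    (volume : Measure (Spacetime n)).restrict (region K) =
      (volume.restrict (Set.Ioi 0)).prod (volume.restrict Kᶜ) := by
  rw [Measure.prod_restrict, ← Measure.volume_eq_prod]
  simpa using volume_restrict_region_inter K Set.univ

lemma volume_restrict_exterior (R : ℝ) :
    (volume : Measure (Spacetime n)).restrict (exterior n R) =
      (volume.restrict (Set.Ioi 0)).prod (volume.restrict {x | R < ‖x‖}) := by
  rw [Measure.prod_restrict, ← Measure.volume_eq_prod]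
  rfl

lemma subset_compl_of_exterior_subset {R : ℝ} (hsub : exterior n R ⊆ region K) :
    {x : Space n | R < ‖x‖} ⊆ Kᶜ := fun x hx =>
  (hsub (show ((1 : ℝ), x) ∈ exterior n R from ⟨Set.mem_Ioi.2 one_pos, hx⟩)).2

lemma enorm_sq_eq (a : ℝ) : ‖a‖ₑ ^ 2 = ENNReal.ofReal (a ^ 2) := by
  rw [← sq_abs, ENNReal.ofReal_pow (abs_nonneg a), ← Real.norm_eq_abs, ofReal_norm]

lemma eLpNorm_two_sq {α ε : Type*} [MeasurableSpace α] [ENorm ε] (μ : Measure α) (f : α → ε) :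
    eLpNorm f 2 μ ^ 2 = ∫⁻ x, ‖f x‖ₑ ^ 2 ∂μ := by
  have := eLpNorm_nnreal_pow_eq_lintegral (μ := μ) (f := f) (p := 2) two_ne_zero
  simpa [ENNReal.rpow_ofNat] using this

lemma normL2_sq (f : Space n → ℝ) :
    normL2 K f ^ 2 = ∫⁻ x in Kᶜ, ENNReal.ofReal (f x ^ 2) := by
  simp only [normL2, eLpNorm_two_sq, enorm_sq_eq]

lemma normLqL2_two_sq {f : Spacetime n → ℝ} (hf : AEMeasurable f (volume.restrict (region K))) :
    normLqL2 K 2 f ^ 2 = ∫⁻ p in region K, ENNReal.ofReal (f p ^ 2) := by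
  rw [volume_restrict_region] at hf ⊢
  rw [lintegral_prod _ (hf.pow_const 2).ennreal_ofReal, normLqL2, eLpNorm_two_sq,
    ← restrict_Ioi_eq_restrict_Ici]
  simp only [enorm_eq_self, normL2_sq]

lemma normLqL2_one (f : Spacetime n → ℝ) :
    normLqL2 K 1 f = ∫⁻ t in Set.Ioi 0, normL2 K fun x => f (t, x) := by
  rw [normLqL2, eLpNorm_one_eq_lintegral_enorm, ← restrict_Ioi_eq_restrict_Ici]
  simp only [enorm_eq_self]

lemma ae_normL2_le (f : Spacetime n → ℝ) : ∀ᵐ t ∂(volume.restrict (Set.Ioi (0 : ℝ))),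
    normL2 K (fun x => f (t, x)) ≤ normLqL2 K ⊤ f := by
  rw [normLqL2, eLpNorm_exponent_top, ← restrict_Ioi_eq_restrict_Ici]
  exact ae_le_eLpNormEssSup (f := fun t => normL2 K fun x => f (t, x))

lemma setLIntegral_sq_le {S : Set (Spacetime n)} (hS : S ⊆ region K) (hSm : MeasurableSet S)
    {f h : Spacetime n → ℝ} (hh : AEMeasurable h (volume.restrict (region K))) {C : ℝ}
    (hfh : ∀ p ∈ S, f p ^ 2 ≤ C * h p ^ 2) :
    ∫⁻ p in S, ENNReal.ofReal (f p ^ 2) ≤ ENNReal.ofReal C * normLqL2 K 2 h ^ 2 := by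
  rw [normLqL2_two_sq hh, ← lintegral_const_mul' _ _ ENNReal.ofReal_ne_top]
  refine (setLIntegral_mono' hSm fun p hp => ?_).trans (lintegral_mono_set hS)
  rw [← ENNReal.ofReal_mul' (sq_nonneg _)]
  exact ENNReal.ofReal_le_ofReal (hfh p hp)

lemma lintegral_mul_sq_le {α : Type*} [MeasurableSpace α] {μ : Measure α} {f g : α → ℝ≥0∞}
    (hf : AEMeasurable f μ) (hg : AEMeasurable g μ) :
    (∫⁻ a, f a * g a ∂μ) ^ 2 ≤ (∫⁻ a, f a ^ 2 ∂μ) * ∫⁻ a, g a ^ 2 ∂μ := by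
  have h := ENNReal.lintegral_mul_le_Lp_mul_Lq μ Real.HolderConjugate.two_two hf hg
  simp only [Pi.mul_apply, ENNReal.rpow_ofNat] at h
  refine (pow_le_pow_left' h 2).trans (le_of_eq ?_)
  have e : ∀ a : ℝ≥0∞, (a ^ (1 / 2 : ℝ)) ^ 2 = a := fun a => by
    rw [← ENNReal.rpow_natCast, ← ENNReal.rpow_mul]; norm_num
  rw [mul_pow, e, e]

lemma le_of_sq_le_sq {a b : ℝ≥0∞} (h : a ^ 2 ≤ b ^ 2) : a ≤ b :=
  (ENNReal.pow_le_pow_left_iff two_ne_zero).1 h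

/-- Cauchy–Schwarz in space, then `L^1` times `L^∞` in time. -/
lemma lintegral_mul_sqrt_le {R : ℝ} (hsub : exterior n R ⊆ region K) {f T : Spacetime n → ℝ}
    (hf : ContinuousOn f (exterior n R)) (hT : ContinuousOn T (exterior n R))
    (hT0 : ∀ p, 0 ≤ T p) {B : ℝ≥0∞} (hB : B ≠ ⊤)
    (hTB : ∀ᵐ t ∂(volume.restrict (Set.Ioi (0 : ℝ))),
      ∫⁻ x in {x | R < ‖x‖}, ENNReal.ofReal (T (t, x)) ≤ B ^ 2) :
    ∫⁻ p in exterior n R, ENNReal.ofReal (|f p| * Real.sqrt (T p)) ≤ normLqL2 K 1 f * B := by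
  have hm : MeasurableSet {x : Space n | R < ‖x‖} :=
    (isOpen_lt continuous_const continuous_norm).measurableSet
  have h1 : AEMeasurable (fun p => |f p| * Real.sqrt (T p)) (volume.restrict (exterior n R)) :=
    (hf.abs.mul hT.sqrt).aemeasurable (isOpen_exterior R).measurableSet
  rw [volume_restrict_exterior] at h1 ⊢
  rw [lintegral_prod _ h1.ennreal_ofReal, normLqL2_one, ← lintegral_mul_const' _ _ hB]
  refine lintegral_mono_ae ?_
  filter_upwards [hTB, self_mem_ae_restrict measurableSet_Ioi] with t ht ht0
  have hslice : ∀ {g : Spacetime n → ℝ}, ContinuousOn g (exterior n R) →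
      AEMeasurable (fun x => g (t, x)) (volume.restrict {x : Space n | R < ‖x‖}) := fun hg =>
    (hg.comp (by fun_prop : ContinuousOn (fun x : Space n => (t, x)) {x | R < ‖x‖})
      fun x hx => ⟨ht0, hx⟩).aemeasurable hm
  refine le_of_sq_le_sq ?_
  have h2 := lintegral_mul_sq_le (hslice hf.abs).ennreal_ofReal (hslice hT.sqrt).ennreal_ofReal
  simp only [← ENNReal.ofReal_mul (abs_nonneg _)] at h2
  rw [mul_pow, normL2_sq]
  refine h2.trans (mul_le_mul' ?_ ?_)
  · simp only [← ENNReal.ofReal_pow (abs_nonneg _), sq_abs]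
    exact lintegral_mono_set (subset_compl_of_exterior_subset hsub)
  · simp only [← ENNReal.ofReal_pow (Real.sqrt_nonneg _), Real.sq_sqrt (hT0 _)]
    exact ht

lemma dyad_neg_half_sq (j : ℕ) : dyad j (-1 / 2) ^ 2 = ENNReal.ofReal ((2 : ℝ) ^ j)⁻¹ := by
  rw [dyad, ← ENNReal.ofReal_pow (by positivity), ← Real.rpow_natCast, ← Real.rpow_mul two_pos.le,
    ← Real.rpow_natCast, ← Real.rpow_neg two_pos.le]
  congr 2
  push_cast
  ring

lemma dyad_neg_three_half_sq (j : ℕ) :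
    dyad j (-3 / 2) ^ 2 = ENNReal.ofReal (((2 : ℝ) ^ j)⁻¹ ^ 3) := by
  rw [dyad, ← ENNReal.ofReal_pow (by positivity), ← Real.rpow_natCast, ← Real.rpow_mul two_pos.le,
    ← Real.rpow_natCast 2 j, ← Real.rpow_neg two_pos.le, ← Real.rpow_natCast _ 3,
    ← Real.rpow_mul two_pos.le]
  congr 2
  push_cast
  ring

lemma normEllInfL2_le {φ : ℕ → Space n → ℝ} (hφ : IsDyadicPartition φ) {s : ℝ}
    {f : Spacetime n → ℝ} (hf : AEMeasurable f (volume.restrict (region K))) {B : ℝ≥0∞}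
    (h : ∀ j, dyad j s ^ 2 * ∫⁻ p in region K, ENNReal.ofReal ((φ j p.2 * f p) ^ 2) ≤ B ^ 2) :
    normEllInfL2 φ K s f ≤ B := by
  refine iSup_le fun j => le_of_sq_le_sq ?_
  rw [mul_pow, normLqL2_two_sq]
  · exact h j
  · exact (((hφ.smooth j).continuous.comp continuous_snd).measurable.aemeasurable).mul hf

lemma le_sumUpTo {d k : ℕ} (G : (Fin d → ℕ) → ℝ≥0∞) {a : Fin d → ℕ} (ha : ∑ i, a i ≤ k) :
    G a ≤ sumUpTo d k G := by
  rw [sumUpTo]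
  refine le_trans ?_ (Finset.single_le_sum (f := fun j =>
    ∑ a ∈ (Finset.univ : Finset (Fin d)).piAntidiag j, G a) (fun _ _ => zero_le)
    (Finset.mem_range.2 (Nat.lt_succ_of_le ha)))
  exact Finset.single_le_sum (f := G) (fun _ _ => zero_le) (by simp [Finset.mem_piAntidiag])

lemma exists_sumUpTo_le (d k : ℕ) : ∃ c : ℝ≥0, ∀ (G : (Fin d → ℕ) → ℝ≥0∞) (B : ℝ≥0∞),
    (∀ a : Fin d → ℕ, ∑ i, a i ≤ k → G a ≤ B) → sumUpTo d k G ≤ c * B := by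
  refine ⟨∑ j ∈ Finset.range (k + 1), ((Finset.univ : Finset (Fin d)).piAntidiag j).card,
    fun G B h => ?_⟩
  rw [sumUpTo, ENNReal.ofNNReal_finsetSum, Finset.sum_mul]
  refine Finset.sum_le_sum fun j hj => ?_
  refine (Finset.sum_le_card_nsmul _ _ B fun a ha => h a ?_).trans (by simp)
  exact (Finset.mem_piAntidiag.1 ha).1.le.trans (Nat.lt_succ_iff.1 (Finset.mem_range.1 hj))

lemma mpd_zero (M : Set (Spacetime n)) (f : Spacetime n → ℝ) : mpd M 0 f = f := by
  simp [mpd]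

lemma spd_zero (f : Space n → ℝ) : spd 0 f = f := by
  simp [spd]

end Norms

/-! ### Solutions in the exterior region -/

section Solutions

variable {K : Set (Space n)}

lemma hasDerivAt_time_slice {R : ℝ} (hsub : exterior n R ⊆ region K) {u : Spacetime n → ℝ}
    (hu : SmoothOn K u) {p : Spacetime n} (hp : p ∈ exterior n R) :
    HasDerivAt (fun s => u (s, p.2)) (pd (region K) 0 u p) p.1 := by
  have hmem : region K ∈ nhds p :=
    Filter.mem_of_superset ((isOpen_exterior R).mem_nhds hp) hsub
  have h1 : HasFDerivAt u (fderivWithin ℝ u (region K) p) p :=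
    ((hu.differentiableOn (by simp) p (hsub hp)).hasFDerivWithinAt).hasFDerivAt hmem
  have h2 : HasDerivAt (fun s : ℝ => (s, p.2)) ((1, 0) : Spacetime n) p.1 :=
    (hasDerivAt_id _).prodMk (hasDerivAt_const _ _)
  exact h1.comp_hasDerivAt p.1 h2

/-- The slices of `u` stay in `L²`: the fundamental theorem of calculus in time. This is what
makes Hardy's inequality available for `u` itself. -/
lemma lintegral_slice_sq_ne_top (hK : IsClosed K) {R : ℝ} (hsub : exterior n R ⊆ region K)
    {u : Spacetime n → ℝ} (hu : SmoothOn K u) (h0 : normL2 K (fun x => u (0, x)) ≠ ⊤)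
    (h1 : normLqL2 K ⊤ (pd (region K) 0 u) ≠ ⊤) {t : ℝ} (ht : 0 < t) :
    ∫⁻ x in {x | R < ‖x‖}, ENNReal.ofReal (u (t, x) ^ 2) ≠ ⊤ := by
  have hKc := subset_compl_of_exterior_subset hsub
  have hm : MeasurableSet {x : Space n | R < ‖x‖} :=
    (isOpen_lt continuous_const continuous_norm).measurableSet
  set v := pd (region K) 0 u with hv
  have hvc : ContinuousOn v (region K) := (hu.pd hK 0).continuousOn
  have hpt : ∀ x ∈ {x : Space n | R < ‖x‖}, ENNReal.ofReal (u (t, x) ^ 2) ≤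
      2 * ENNReal.ofReal (u (0, x) ^ 2) +
        2 * ENNReal.ofReal t * ∫⁻ s in Set.Ioc 0 t, ENNReal.ofReal (v (s, x) ^ 2) := by
    intro x hx
    have hmaps : ∀ s ∈ Set.Icc 0 t, (s, x) ∈ region K := fun s hs => ⟨hs.1, hKc hx⟩
    have hc1 : ContinuousOn (fun s => u (s, x)) (Set.Icc 0 t) :=
      hu.continuousOn.comp (by fun_prop) hmaps
    have hc2 : ContinuousOn (fun s => v (s, x)) (Set.Icc 0 t) := hvc.comp (by fun_prop) hmaps
    have hftc := intervalIntegral.integral_eq_sub_of_hasDerivAt_of_le ht.le hc1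
      (fun s hs => hasDerivAt_time_slice (p := (s, x)) hsub hu ⟨hs.1, hx⟩)
      (hc2.intervalIntegrable_of_Icc ht.le)
    have hE : ‖u (t, x) - u (0, x)‖ₑ ^ 2 ≤
        ENNReal.ofReal t * ∫⁻ s in Set.Ioc 0 t, ENNReal.ofReal (v (s, x) ^ 2) := by
      rw [← hftc, intervalIntegral.integral_of_le ht.le]
      refine (pow_le_pow_left' (enorm_integral_le_lintegral_enorm _) 2).trans ?_
      have hmv : AEMeasurable (fun s => v (s, x)) (volume.restrict (Set.Ioc 0 t)) :=
        (hc2.mono Set.Ioc_subset_Icc_self).aemeasurable measurableSet_Ioc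
      have := lintegral_mul_sq_le (g := fun _ => 1) hmv.enorm aemeasurable_const
      simp only [mul_one, one_pow, lintegral_const, Measure.restrict_apply_univ, Real.volume_Ioc,
        sub_zero, one_mul, enorm_sq_eq] at this
      rwa [mul_comm]
    have hsq : u (t, x) ^ 2 ≤ 2 * u (0, x) ^ 2 + 2 * (u (t, x) - u (0, x)) ^ 2 := by
      nlinarith [sq_nonneg (u (t, x) - 2 * u (0, x))]
    calc ENNReal.ofReal (u (t, x) ^ 2)
        ≤ ENNReal.ofReal (2 * u (0, x) ^ 2 + 2 * (u (t, x) - u (0, x)) ^ 2) :=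
          ENNReal.ofReal_le_ofReal hsq
      _ = 2 * ENNReal.ofReal (u (0, x) ^ 2) + 2 * ‖u (t, x) - u (0, x)‖ₑ ^ 2 := by
          rw [ENNReal.ofReal_add (by positivity) (by positivity), ENNReal.ofReal_mul two_pos.le,
            ENNReal.ofReal_mul two_pos.le, enorm_sq_eq, ENNReal.ofReal_ofNat]
      _ ≤ _ := by
          rw [mul_assoc 2 (ENNReal.ofReal t)]
          gcongr
  have hm0 : AEMeasurable (fun x => 2 * ENNReal.ofReal (u (0, x) ^ 2))
      (volume.restrict {x : Space n | R < ‖x‖}) := by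
    have : ContinuousOn (fun x => u (0, x)) {x : Space n | R < ‖x‖} :=
      hu.continuousOn.comp (by fun_prop) fun x hx => ⟨Set.mem_Ici.2 le_rfl, hKc hx⟩
    exact ((this.aemeasurable hm).pow_const 2).ennreal_ofReal.const_mul _
  have hswap : ∫⁻ x in {x : Space n | R < ‖x‖}, ∫⁻ s in Set.Ioc 0 t,
      ENNReal.ofReal (v (s, x) ^ 2) =
      ∫⁻ s in Set.Ioc 0 t, ∫⁻ x in {x : Space n | R < ‖x‖}, ENNReal.ofReal (v (s, x) ^ 2) := by
    refine (lintegral_lintegral_swap ?_).symm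
    rw [Measure.prod_restrict, ← Measure.volume_eq_prod]
    refine ContinuousOn.aemeasurable ?_ (measurableSet_Ioc.prod hm) |>.ennreal_ofReal
    exact (hvc.mono fun p hp => ⟨Set.mem_Ici.2 (le_of_lt hp.1.1), hKc hp.2⟩).pow 2
  have hV : ∫⁻ s in Set.Ioc 0 t, ∫⁻ x in {x : Space n | R < ‖x‖}, ENNReal.ofReal (v (s, x) ^ 2) ≤
      normLqL2 K ⊤ v ^ 2 * ENNReal.ofReal t := by
    have h2 := ae_restrict_of_ae_restrict_of_subset
      (Set.Ioc_subset_Ioi_self : Set.Ioc 0 t ⊆ Set.Ioi 0) (ae_normL2_le (K := K) v)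
    refine (lintegral_mono_ae (g := fun _ => normLqL2 K ⊤ v ^ 2) ?_).trans (le_of_eq ?_)
    · filter_upwards [h2] with s hs
      exact (lintegral_mono_set hKc).trans
        ((normL2_sq _).symm.le.trans (pow_le_pow_left' hs 2))
    · simp
  have hfin : 2 * normL2 K (fun x => u (0, x)) ^ 2 +
      2 * ENNReal.ofReal t * (normLqL2 K ⊤ v ^ 2 * ENNReal.ofReal t) < ⊤ := by finiteness
  refine (((setLIntegral_mono' hm hpt).trans ?_).trans_lt hfin).ne
  rw [lintegral_add_left' hm0, lintegral_const_mul' _ _ (by simp),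
    lintegral_const_mul' _ _ (by finiteness), hswap, normL2_sq]
  gcongr

/-- The space-time multi-indices of order at most `k`. -/
def multiIndices (n k : ℕ) : Finset (Fin (n + 1) → ℕ) :=
  {a ∈ Fintype.piFinset fun _ => Finset.range (k + 1) | ∑ i, a i ≤ k}

lemma mem_multiIndices {k : ℕ} {a : Fin (n + 1) → ℕ} :
    a ∈ multiIndices n k ↔ ∑ i, a i ≤ k := by
  simp only [multiIndices, Finset.mem_filter, Fintype.mem_piFinset, Finset.mem_range,
    and_iff_right_iff_imp]
  exact fun h i => Nat.lt_succ_of_le ((Finset.single_le_sum (fun _ _ => Nat.zero_le _)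
    (Finset.mem_univ i)).trans h)

lemma SmoothOn.mpd (hK : IsClosed K) {f : Spacetime n → ℝ} (hf : SmoothOn K f)
    (a : Fin (n + 1) → ℕ) : SmoothOn K (mpd (region K) a f) := by
  obtain ⟨W, -, -, h3⟩ := exists_word_eq_mpd K a
  rw [h3]
  exact SmoothOn.wordDeriv hK hf W

lemma abs_pd_wordDeriv_le (hK : IsClosed K) {k : ℕ} {u : Spacetime n → ℝ} (hu : SmoothOn K u)
    (γ : Fin (n + 1)) {L : List (Fin (n + 1))} (hL : L.length ≤ k) {p : Spacetime n}
    (hp : p ∈ region K) : |pd (region K) γ (wordDeriv K L u) p| ≤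
      Real.sqrt (totalDens K (fun a : multiIndices n k => mpd (region K) a u) p) := by
  have ha : (fun i => L.count i) ∈ multiIndices n k :=
    mem_multiIndices.2 ((sum_count_eq_length L).le.trans hL)
  rw [pd_congr (wordDeriv_eqOn_mpd hK L hu) γ hp]
  exact (abs_pd_le_sqrt_dens _ _ _).trans (Real.sqrt_le_sqrt
    (dens_le_totalDens (fun a : multiIndices n k => mpd (region K) a u) p ⟨_, ha⟩))

/-- Far out, the derivatives up to order `k` of a solution form an exterior system. -/
theorem SymbolMetric.exists_exteriorSystem {Ra : ℝ} {lam : Spacetime n → ℝ} {k : ℕ}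
    {g : TensorField n} (h : SymbolMetric K (exterior n Ra) lam k g) (hlam : ∀ p, 0 ≤ lam p)
    (hlm : Measurable lam) {A₀ : ℝ} (hA₀ : 0 ≤ A₀)
    (hdev : ∀ p ∈ exterior n Ra, ∀ α β,
      |(g p)⁻¹ α β - minkowski n α β| ≤ A₀ * lam p * ‖p.2‖) :
    ∃ A : ℝ, 0 ≤ A ∧ ∀ R, Ra ≤ R → 1 ≤ R → ∀ u F, SmoothOn K u →
      Set.EqOn (box K g u) F (region K) →
      ExteriorSystem K R A lam (fun p => (g p)⁻¹)
        (fun a : multiIndices n k => mpd (region K) a u)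
        (fun a : multiIndices n k => mpd (region K) a F) := by
  have hK := h.closed
  choose B hB using fun α β => (h.inv α β).bdd
  choose D hD0 hD using fun α β γ => (h.inv α β).deriv γ
  obtain ⟨C, hC0, hC⟩ := h.exists_commutator_bound le_rfl
  obtain ⟨b, hbs, -, hbox⟩ := h.exists_box_eq
  set B' : ℝ := ∑ α, ∑ β, |B α β|
  set D' : ℝ := ∑ α, ∑ β, ∑ γ, D α β γ
  have hB0 : 0 ≤ B' := Finset.sum_nonneg fun _ _ => Finset.sum_nonneg fun _ _ => abs_nonneg _
  have hD0' : 0 ≤ D' := Finset.sum_nonneg fun α _ => Finset.sum_nonneg fun β _ =>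
    Finset.sum_nonneg fun γ _ => hD0 α β γ
  have hBle : ∀ α β, B α β ≤ B' := fun α β => (le_abs_self _).trans <|
    (Finset.single_le_sum (f := fun β => |B α β|) (fun _ _ => abs_nonneg _)
      (Finset.mem_univ β)).trans (Finset.single_le_sum (f := fun α => ∑ β, |B α β|)
      (fun _ _ => Finset.sum_nonneg fun _ _ => abs_nonneg _) (Finset.mem_univ α))
  have hDle : ∀ α β γ, D α β γ ≤ D' := fun α β γ =>
    (Finset.single_le_sum (f := fun γ => D α β γ) (fun γ _ => hD0 α β γ)
      (Finset.mem_univ γ)).trans <|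
    (Finset.single_le_sum (f := fun β => ∑ γ, D α β γ)
      (fun β _ => Finset.sum_nonneg fun γ _ => hD0 α β γ) (Finset.mem_univ β)).trans
    (Finset.single_le_sum (f := fun α => ∑ β, ∑ γ, D α β γ) (fun α _ => Finset.sum_nonneg
      fun β _ => Finset.sum_nonneg fun γ _ => hD0 α β γ) (Finset.mem_univ α))
  refine ⟨A₀ + B' + D' + C, by positivity, fun R hR hR1 u F hu hF => ?_⟩
  have hsubR : exterior n R ⊆ exterior n Ra := fun p hp =>
    ⟨hp.1, show Ra < ‖p.2‖ from lt_of_le_of_lt hR hp.2⟩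
  have hFs : SmoothOn K F := by
    refine ContDiffOn.congr (f := fun p =>
        ∑ α, ∑ β, (g p)⁻¹ α β * pd (region K) α (pd (region K) β u) p +
        ∑ β, b β p * pd (region K) β u p) ?_ fun p hp => (hF hp).symm.trans (hbox u hu p hp)
    refine ContDiffOn.add (ContDiffOn.sum fun α _ => ContDiffOn.sum fun β _ => ?_)
      (ContDiffOn.sum fun β _ => (hbs β).mul (hu.pd hK β))
    exact (h.inv α β).smooth.mul ((hu.pd hK β).pd hK α)
  refine ⟨hK, hsubR.trans h.subset, hR1, by positivity, hlam, hlm,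
    fun α β => (h.inv α β).smooth, fun p hp α β => ?_, fun p hp α β => ?_, fun p hp γ α β => ?_,
    fun p hp α β => ?_, fun a => SmoothOn.mpd hK hu _, fun a => SmoothOn.mpd hK hFs _, ?_⟩
  · exact h.lorentz.inv_symm (h.subset (hsubR hp)) α β
  · refine (hdev p (hsubR hp) α β).trans ?_
    gcongr
    · exact hlam p
    · linarith
  · refine (hD α β γ [] (Nat.zero_le _) p (hsubR hp)).trans ?_
    exact mul_le_mul_of_nonneg_right (by linarith [hDle α β γ]) (hlam p)
  · exact (hB α β p (hsubR hp)).trans (by linarith [hBle α β])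
  · intro a p hp
    have hpK := h.subset (hsubR hp)
    obtain ⟨W, hW1, -, hW3⟩ := exists_word_eq_mpd K (a : Fin (n + 1) → ℕ)
    have hWk : W.length ≤ k := by rw [hW1]; exact mem_multiIndices.1 a.2
    have h1 := hC u hu W hWk p (hsubR hp) _ fun γ L' hL' => abs_pd_wordDeriv_le hK hu γ hL' hpK
    rw [wordDeriv_congr hF W hpK, ← hW3, ← hW3] at h1
    have h2 := abs_sub_abs_le_abs_sub
      (∑ α, ∑ β, (g p)⁻¹ α β * pd (region K) α (pd (region K) β (mpd (region K) a u)) p)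
      (mpd (region K) a F p)
    have h3 : C * lam p * Real.sqrt (totalDens K
        (fun a : multiIndices n k => mpd (region K) a u) p) ≤
        (A₀ + B' + D' + C) * lam p * Real.sqrt (totalDens K
        (fun a : multiIndices n k => mpd (region K) a u) p) := by
      gcongr
      · exact hlam p
      · linarith
    linarith

end Solutions

/-! ### Transfer between the local energy norms and the exterior estimate -/

section Transfer

variable {K : Set (Space n)} {R₁ N : ℝ} {k : ℕ} {u : Spacetime n → ℝ} {a : Fin (n + 1) → ℕ}

lemma normLqL2_top_pd_le_weakNorm (ha : ∑ i, a i ≤ k) (α : Fin (n + 1)) :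
    normLqL2 K ⊤ (pd (region K) α (mpd (region K) a u)) ≤ weakNorm K R₁ N k u := by
  refine le_trans ?_ (le_sumUpTo _ ha)
  refine le_add_right (le_add_right ?_)
  exact Finset.single_le_sum (f := fun α => normLqL2 K ⊤ (pd (region K) α (mpd (region K) a u)))
    (fun _ _ => zero_le) (Finset.mem_univ α)

/-- The weighted derivative `⟨r⟩^{-N} ∂_α w`, restricted to `r ≥ R₁`. -/
def weightedPd (K : Set (Space n)) (R₁ N : ℝ) (α : Fin (n + 1)) (w : Spacetime n → ℝ) :
    Spacetime n → ℝ :=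
  Set.indicator {p | R₁ ≤ ‖p.2‖} fun p => (1 + ‖p.2‖ ^ 2) ^ (-N / 2) * pd (region K) α w p

lemma normLqL2_weightedPd_le_weakNorm (ha : ∑ i, a i ≤ k) (α : Fin (n + 1)) :
    normLqL2 K 2 (weightedPd K R₁ N α (mpd (region K) a u)) ≤ weakNorm K R₁ N k u := by
  refine le_trans ?_ (le_sumUpTo _ ha)
  refine le_add_right (le_add_left ?_)
  exact Finset.single_le_sum
    (f := fun α => normLqL2 K 2 (weightedPd K R₁ N α (mpd (region K) a u)))
    (fun _ _ => zero_le) (Finset.mem_univ α)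

lemma normLqL2_weighted_le_weakNorm (ha : ∑ i, a i ≤ k) :
    normLqL2 K 2 (fun p => (1 + ‖p.2‖ ^ 2) ^ ((-N - 1) / 2) * mpd (region K) a u p) ≤
      weakNorm K R₁ N k u :=
  le_trans (le_add_left le_rfl) (le_sumUpTo _ ha)

lemma continuous_bracket_rpow (s : ℝ) :
    Continuous fun p : Spacetime n => (1 + ‖p.2‖ ^ 2) ^ s :=
  Continuous.rpow_const (by fun_prop) fun p => Or.inl (by positivity)

lemma aemeasurable_weighted (hK : IsClosed K) (s : ℝ) {w : Spacetime n → ℝ} (hw : SmoothOn K w) :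
    AEMeasurable (fun p => (1 + ‖p.2‖ ^ 2) ^ s * w p) (volume.restrict (region K)) :=
  ((continuous_bracket_rpow s).continuousOn.mul hw.continuousOn).aemeasurable
    (measurableSet_region hK)

lemma aemeasurable_weightedPd (hK : IsClosed K) (α : Fin (n + 1)) {w : Spacetime n → ℝ}
    (hw : SmoothOn K w) :
    AEMeasurable (weightedPd K R₁ N α w) (volume.restrict (region K)) :=
  (aemeasurable_weighted hK _ (hw.pd hK α)).indicator
    (isClosed_le continuous_const (by fun_prop)).measurableSet

/-- On a bounded range of radii the polynomial weights are irrelevant. -/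
lemma exists_one_le_mul_bracket (ρ s : ℝ) : ∃ C : ℝ≥0, ∀ r : ℝ, r ^ 2 ≤ ρ →
    1 ≤ C * ((1 + r ^ 2) ^ s) ^ 2 := by
  refine ⟨Real.toNNReal (((1 + |ρ|) ^ |s|) ^ 2), fun r hr => ?_⟩
  rw [Real.coe_toNNReal _ (by positivity), ← mul_pow]
  refine one_le_pow₀ ?_
  have h1 : 1 ≤ 1 + r ^ 2 := by nlinarith [sq_nonneg r]
  have h2 : 1 + r ^ 2 ≤ 1 + |ρ| := by linarith [le_abs_self ρ]
  calc (1 : ℝ) = (1 + r ^ 2) ^ |s| * (1 + r ^ 2) ^ (-|s|) := by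
        rw [← Real.rpow_add (by linarith)]; simp
    _ ≤ (1 + |ρ|) ^ |s| * (1 + r ^ 2) ^ s := by
        gcongr
        exact neg_abs_le s

lemma mpd_eqOn_pd_mpd (hK : IsClosed K) (hu : SmoothOn K u) (a : Fin (n + 1) → ℕ) :
    a = 0 ∨ ∃ (α : Fin (n + 1)) (b : Fin (n + 1) → ℕ), ∑ i, b i ≤ ∑ i, a i ∧
      Set.EqOn (mpd (region K) a u) (pd (region K) α (mpd (region K) b u)) (region K) := by
  obtain ⟨W, h1, h2, h3⟩ := exists_word_eq_mpd K a
  rcases List.eq_nil_or_concat' W with rfl | ⟨L, α, rfl⟩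
  · exact Or.inl (funext fun i => (h2 i).symm.trans (by simp))
  · refine Or.inr ⟨α, fun i => L.count i, ?_, ?_⟩
    · rw [sum_count_eq_length, ← h1]; simp
    · rw [h3, wordDeriv_append]
      exact pd_congr (wordDeriv_eqOn_mpd hK L hu) α

/-- The energies of the time slices, including the Hardy term, are controlled by the weak norm. -/
lemma ae_lintegral_totalDens_le (hn : 3 ≤ n) (hK : IsClosed K) {Rh R : ℝ} (hRh : 1 ≤ Rh)
    (hR : 2 * Rh ≤ R) (hsub : exterior n Rh ⊆ region K) (hu : SmoothOn K u)
    (h0 : normL2 K (fun x => u (0, x)) ≠ ⊤) (hW : weakNorm K R₁ N k u ≠ ⊤) :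
    ∀ᵐ t ∂(volume.restrict (Set.Ioi (0 : ℝ))), ∫⁻ x in {x | R < ‖x‖},
      ENNReal.ofReal (totalDens K (fun a : multiIndices n k => mpd (region K) a u) (t, x)) ≤
        ((((multiIndices n k).card * (9 * (n + 1)) : ℕ) : ℝ≥0∞) * weakNorm K R₁ N k u) ^ 2 := by
  set W := weakNorm K R₁ N k u
  have hKc := subset_compl_of_exterior_subset hsub
  have hO : IsOpen {x : Space n | Rh < ‖x‖} := isOpen_lt continuous_const continuous_norm
  have hOR : IsOpen {x : Space n | R < ‖x‖} := isOpen_lt continuous_const continuous_norm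
  have hss : {x : Space n | R < ‖x‖} ⊆ {x | Rh < ‖x‖} := fun x hx => by
    have hx' : R < ‖x‖ := hx
    exact (by linarith : Rh < ‖x‖)
  have hslices : ∀ᵐ t ∂(volume.restrict (Set.Ioi (0 : ℝ))), ∀ (a : multiIndices n k)
      (α : Fin (n + 1)),
      normL2 K (fun x => pd (region K) α (mpd (region K) a u) (t, x)) ≤ W := by
    rw [ae_all_iff]
    intro a
    rw [ae_all_iff]
    intro α
    filter_upwards [ae_normL2_le (K := K) (pd (region K) α (mpd (region K) a u))] with t ht
    exact ht.trans (normLqL2_top_pd_le_weakNorm (mem_multiIndices.1 a.2) α)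
  filter_upwards [hslices, self_mem_ae_restrict measurableSet_Ioi] with t ht ht0
  have hsm : ∀ a, SmoothOn K (mpd (region K) a u) := fun a => SmoothOn.mpd hK hu a
  have hcont : ∀ {g : Spacetime n → ℝ}, ContinuousOn g (region K) →
      ContinuousOn (fun x => g (t, x)) {x | Rh < ‖x‖} := fun hg =>
    hg.comp (by fun_prop) fun x hx => ⟨Set.mem_Ici.2 (le_of_lt ht0), hKc hx⟩
  have hpd : ∀ (a : multiIndices n k) (α : Fin (n + 1)), ∫⁻ x in {x | Rh < ‖x‖},
      ENNReal.ofReal (pd (region K) α (mpd (region K) a u) (t, x) ^ 2) ≤ W ^ 2 := fun a α =>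
    (lintegral_mono_set hKc).trans ((normL2_sq _).symm.le.trans (pow_le_pow_left' (ht a α) 2))
  have hgrad : ∀ a : multiIndices n k, ∫⁻ x in {x | Rh < ‖x‖},
      ENNReal.ofReal (gradSq K (mpd (region K) a u) (t, x)) ≤ (n + 1 : ℕ) * W ^ 2 := by
    intro a
    simp only [gradSq, ENNReal.ofReal_sum_of_nonneg fun _ _ => sq_nonneg _]
    rw [lintegral_finsetSum' _ fun α _ => ((hcont
      ((hsm a).pd hK α).continuousOn).aemeasurable hO.measurableSet).pow_const 2 |>.ennreal_ofReal]
    refine (Finset.sum_le_sum fun α _ => hpd a α).trans (by simp)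
  have hL2 : ∀ a : multiIndices n k, ∫⁻ x in {x | Rh < ‖x‖},
      ENNReal.ofReal (mpd (region K) a u (t, x) ^ 2) ≠ ⊤ := by
    intro a
    have hak := mem_multiIndices.1 a.2
    rcases mpd_eqOn_pd_mpd hK hu a with ha | ⟨α, b, hb, hab⟩
    · rw [ha, mpd_zero]
      have h1 : normLqL2 K ⊤ (pd (region K) 0 u) ≤ W := by
        have := normLqL2_top_pd_le_weakNorm (K := K) (R₁ := R₁) (N := N) (u := u) hak 0
        rwa [ha, mpd_zero] at this
      exact lintegral_slice_sq_ne_top hK hsub hu h0 (ne_top_of_le_ne_top hW h1) ht0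
    · refine ne_top_of_le_ne_top (ENNReal.pow_ne_top hW (n := 2)) (le_trans (le_of_eq ?_)
        (hpd ⟨b, mem_multiIndices.2 (hb.trans hak)⟩ α))
      refine setLIntegral_congr_fun hO.measurableSet fun x hx => ?_
      simp only [hab (show (t, x) ∈ region K from ⟨Set.mem_Ici.2 (le_of_lt ht0), hKc hx⟩)]
  have hdens : ∀ a : multiIndices n k, ∫⁻ x in {x | R < ‖x‖},
      ENNReal.ofReal (dens K (mpd (region K) a u) (t, x)) ≤ (9 * (n + 1) : ℕ) * W ^ 2 := by
    intro a
    have h2 := hardy_slice hn hK hRh hsub (hsm a) ht0 (hL2 a)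
    have e : ∀ x : Space n, ENNReal.ofReal (dens K (mpd (region K) a u) (t, x)) =
        ENNReal.ofReal (gradSq K (mpd (region K) a u) (t, x)) +
        ENNReal.ofReal (mpd (region K) a u (t, x) ^ 2 / ‖x‖ ^ 2) := fun x =>
      ENNReal.ofReal_add (gradSq_nonneg _ _) (by positivity)
    simp only [e]
    have hgm : AEMeasurable (fun x => gradSq K (mpd (region K) a u) (t, x))
        (volume.restrict {x : Space n | R < ‖x‖}) :=
      ((continuousOn_finsetSum _ fun α _ =>
        (hcont ((hsm a).pd hK α).continuousOn).pow 2).mono hss).aemeasurable hOR.measurableSet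
    rw [lintegral_add_left' hgm.ennreal_ofReal]
    have h3 : {x : Space n | R < ‖x‖} ⊆ {x | 3 * Rh ^ 2 ≤ ‖x‖ ^ 2} := fun x hx => by
      have hx' : R < ‖x‖ := hx
      have : 3 * Rh ^ 2 ≤ ‖x‖ ^ 2 := by nlinarith
      exact this
    calc _ ≤ (n + 1 : ℕ) * W ^ 2 + 8 * ((n + 1 : ℕ) * W ^ 2) := by
          refine add_le_add ((lintegral_mono_set hss).trans (hgrad a)) ?_
          refine (lintegral_mono_set h3).trans (h2.trans ?_)
          gcongr
          exact hgrad a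
      _ = _ := by push_cast; ring
  simp only [totalDens, ENNReal.ofReal_sum_of_nonneg fun _ _ => dens_nonneg _ _]
  have hdm : ∀ a : multiIndices n k, AEMeasurable
      (fun x => ENNReal.ofReal (dens K (mpd (region K) a u) (t, x)))
      (volume.restrict {x : Space n | R < ‖x‖}) := by
    intro a
    refine (ContinuousOn.aemeasurable ?_ hOR.measurableSet).ennreal_ofReal
    refine ContinuousOn.add ((continuousOn_finsetSum _ fun α _ =>
        (hcont ((hsm a).pd hK α).continuousOn).pow 2).mono hss) ?_
    refine ContinuousOn.div (((hcont (hsm a).continuousOn).pow 2).mono hss) (by fun_prop) ?_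
    intro x hx
    have hx' : R < ‖x‖ := hx
    have : 0 < ‖x‖ := by linarith
    positivity
  rw [lintegral_finsetSum' _ fun a _ => hdm a]
  refine (Finset.sum_le_sum fun a _ => hdens a).trans ?_
  set q : ℕ := (multiIndices n k).card * (9 * (n + 1)) with hq
  have h4 : (q : ℝ≥0∞) ≤ (q : ℝ≥0∞) ^ 2 := by
    exact_mod_cast Nat.le_self_pow two_ne_zero q
  rw [mul_pow]
  refine le_trans (le_of_eq ?_) (mul_le_mul_left h4 (W ^ 2))
  simp only [Finset.sum_const, Finset.card_univ, Fintype.card_coe, nsmul_eq_mul, hq]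
  push_cast
  ring

/-- Near the obstacle the weak norm controls the density. -/
lemma exists_lintegral_near_le (hK : IsClosed K) {R : ℝ} (hR : 1 ≤ R) (hR1 : R₁ ≤ R) (N : ℝ)
    (k : ℕ) (hsub : exterior n R ⊆ region K) : ∃ C : ℝ≥0, ∀ u, SmoothOn K u →
      ∫⁻ p in exterior n R ∩ {p | ‖p.2‖ ^ 2 ≤ 3 * R ^ 2},
        ENNReal.ofReal (totalDens K (fun a : multiIndices n k => mpd (region K) a u) p) ≤
      C * weakNorm K R₁ N k u ^ 2 := by
  obtain ⟨C₁, hC₁⟩ := exists_one_le_mul_bracket (3 * R ^ 2) (-N / 2)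
  obtain ⟨C₂, hC₂⟩ := exists_one_le_mul_bracket (3 * R ^ 2) ((-N - 1) / 2)
  refine ⟨(multiIndices n k).card * ((n + 1) * C₁ + C₂), fun u hu => ?_⟩
  set W := weakNorm K R₁ N k u
  set S := exterior n R ∩ {p : Spacetime n | ‖p.2‖ ^ 2 ≤ 3 * R ^ 2} with hS
  have hSK : S ⊆ region K := Set.inter_subset_left.trans hsub
  have hSm : MeasurableSet S := (isOpen_exterior R).measurableSet.inter
    (isClosed_le (by fun_prop) continuous_const).measurableSet
  have hsm : ∀ a, SmoothOn K (mpd (region K) a u) := fun a => SmoothOn.mpd hK hu a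
  have hr : ∀ p ∈ S, R < ‖p.2‖ := fun p hp => hp.1.2
  have h1 : ∀ (a : multiIndices n k) (α : Fin (n + 1)), ∫⁻ p in S,
      ENNReal.ofReal (pd (region K) α (mpd (region K) a u) p ^ 2) ≤ C₁ * W ^ 2 := by
    intro a α
    have := setLIntegral_sq_le hSK hSm (f := pd (region K) α (mpd (region K) a u))
      (aemeasurable_weightedPd (R₁ := R₁) (N := N) hK α (hsm a)) (C := C₁) fun p hp => by
        have hmem : p ∈ {p : Spacetime n | R₁ ≤ ‖p.2‖} := hR1.trans (hr p hp).le
        rw [weightedPd, Set.indicator_of_mem hmem, mul_pow, ← mul_assoc]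
        exact le_mul_of_one_le_left (sq_nonneg _) (hC₁ _ hp.2)
    rw [ENNReal.ofReal_coe_nnreal] at this
    refine this.trans ?_
    gcongr
    exact normLqL2_weightedPd_le_weakNorm (mem_multiIndices.1 a.2) α
  have h2 : ∀ a : multiIndices n k, ∫⁻ p in S,
      ENNReal.ofReal (mpd (region K) a u p ^ 2 / ‖p.2‖ ^ 2) ≤ C₂ * W ^ 2 := by
    intro a
    have := setLIntegral_sq_le hSK hSm (f := fun p => mpd (region K) a u p / ‖p.2‖)
      (aemeasurable_weighted hK ((-N - 1) / 2) (hsm a)) (C := C₂) fun p hp => by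
        rw [mul_pow, ← mul_assoc, div_pow]
        refine (div_le_self (sq_nonneg _) (one_le_pow₀ (hR.trans (hr p hp).le))).trans ?_
        exact le_mul_of_one_le_left (sq_nonneg _) (hC₂ _ hp.2)
    simp only [ENNReal.ofReal_coe_nnreal, div_pow] at this
    refine this.trans ?_
    gcongr
    exact normLqL2_weighted_le_weakNorm (mem_multiIndices.1 a.2)
  have hpm : ∀ (a : multiIndices n k) (α : Fin (n + 1)), AEMeasurable
      (fun p => ENNReal.ofReal (pd (region K) α (mpd (region K) a u) p ^ 2))
      (volume.restrict S) := fun a α =>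
    (((((hsm a).pd hK α).continuousOn.mono hSK).aemeasurable hSm).pow_const 2).ennreal_ofReal
  have hdens : ∀ a : multiIndices n k, ∫⁻ p in S,
      ENNReal.ofReal (dens K (mpd (region K) a u) p) ≤ ((n + 1) * C₁ + C₂) * W ^ 2 := by
    intro a
    have e : ∀ p : Spacetime n, ENNReal.ofReal (dens K (mpd (region K) a u) p) =
        ∑ α, ENNReal.ofReal (pd (region K) α (mpd (region K) a u) p ^ 2) +
        ENNReal.ofReal (mpd (region K) a u p ^ 2 / ‖p.2‖ ^ 2) := fun p => by
      rw [dens, ENNReal.ofReal_add (Finset.sum_nonneg fun _ _ => sq_nonneg _) (by positivity),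
        ENNReal.ofReal_sum_of_nonneg fun _ _ => sq_nonneg _]
    simp only [e]
    rw [lintegral_add_left' (Finset.aemeasurable_fun_sum _ fun α _ => hpm a α),
      lintegral_finsetSum' _ fun α _ => hpm a α, add_mul]
    refine add_le_add ((Finset.sum_le_sum fun α _ => h1 a α).trans (le_of_eq ?_)) (h2 a)
    simp [mul_assoc]
  simp only [totalDens, ENNReal.ofReal_sum_of_nonneg fun _ _ => dens_nonneg _ _]
  rw [lintegral_finsetSum' _ fun a _ => ?_]
  · refine (Finset.sum_le_sum fun a _ => hdens a).trans (le_of_eq ?_)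
    simp [mul_assoc]
  · refine (ContinuousOn.aemeasurable ?_ hSm).ennreal_ofReal
    refine ContinuousOn.add (continuousOn_finsetSum _ fun α _ =>
      (((hsm a).pd hK α).continuousOn.mono hSK).pow 2) (ContinuousOn.div
        (((hsm a).continuousOn.mono hSK).pow 2) (by fun_prop) fun p hp => ?_)
    have : 0 < ‖p.2‖ := by linarith [hr p hp]
    positivity

/-- A local energy norm is controlled by a weighted norm for bounded radii and by the exterior
estimate for large radii. -/
lemma normEllInfL2_le_of_near_far {φ : ℕ → Space n → ℝ} (hφ : IsDyadicPartition φ)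
    (hK : IsClosed K) {R : ℝ} (hR : 1 ≤ R) {s : ℝ} {d : ℕ → ℝ}
    (hd : ∀ j, dyad j s ^ 2 = ENNReal.ofReal (d j)) (hd0 : ∀ j, 0 ≤ d j) (hd1 : ∀ j, d j ≤ 1)
    {f h T : Spacetime n → ℝ} (hf : AEMeasurable f (volume.restrict (region K)))
    (hh : AEMeasurable h (volume.restrict (region K))) {Cn Cf Cw M : ℝ≥0}
    (hnear : ∀ p ∈ region K, ‖p.2‖ ^ 2 ≤ 3 * R ^ 2 → f p ^ 2 ≤ Cn * h p ^ 2)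
    (hfar : ∀ j : ℕ, ∀ p ∈ exterior n R ∩ annulus n (2 ^ j),
      d j * f p ^ 2 ≤ Cf * (((2 : ℝ) ^ j)⁻¹ * T p)) {D : ℝ≥0∞}
    (hT : ∀ j : ℕ, ENNReal.ofReal ((2 : ℝ) ^ j)⁻¹ *
        ∫⁻ p in (exterior n R ∩ {p | 3 * R ^ 2 ≤ ‖p.2‖ ^ 2}) ∩ annulus n (2 ^ j),
          ENNReal.ofReal (T p) ≤ M * D ^ 2)
    (hW : normLqL2 K 2 h ≤ Cw * D) :
    normEllInfL2 φ K s f ≤ ((1 + Cn * Cw ^ 2 + Cf * M : ℝ≥0) : ℝ≥0∞) * D := by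
  refine normEllInfL2_le hφ hf fun j => ?_
  rw [hd]
  have hφf : ∀ p : Spacetime n, (φ j p.2 * f p) ^ 2 ≤ f p ^ 2 := fun p => by
    rw [mul_pow]
    exact mul_le_of_le_one_left (sq_nonneg _) ((sq_le_one_iff_abs_le_one _).2 (hφ.abs_le_one _ _))
  set Sn : Set (Spacetime n) := region K ∩ {p | ‖p.2‖ ^ 2 ≤ 3 * R ^ 2}
  set Sf : Set (Spacetime n) := exterior n R ∩ {p | 3 * R ^ 2 ≤ ‖p.2‖ ^ 2} with hSf
  have hSnm : MeasurableSet Sn := (measurableSet_region hK).inter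
    (isClosed_le (by fun_prop) continuous_const).measurableSet
  have hSfm : MeasurableSet Sf := (isOpen_exterior R).measurableSet.inter
    (isClosed_le continuous_const (by fun_prop)).measurableSet
  have hsplit : ∫⁻ p in region K, ENNReal.ofReal ((φ j p.2 * f p) ^ 2) ≤
      (∫⁻ p in Sn, ENNReal.ofReal ((φ j p.2 * f p) ^ 2)) +
        ∫⁻ p in Sf, ENNReal.ofReal ((φ j p.2 * f p) ^ 2) := by
    have h1 : region K ⊆ Sn ∪ region K ∩ {p | 3 * R ^ 2 ≤ ‖p.2‖ ^ 2} := fun p hp =>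
      (le_total (‖p.2‖ ^ 2) (3 * R ^ 2)).imp (fun h => ⟨hp, h⟩) fun h => ⟨hp, h⟩
    refine ((lintegral_mono_set h1).trans (lintegral_union_le _ _ _)).trans ?_
    refine add_le_add le_rfl ?_
    rw [volume_restrict_region_inter]
    refine lintegral_mono_set fun p hp => ⟨⟨hp.1.1, ?_⟩, hp.2⟩
    have h2 : 3 * R ^ 2 ≤ ‖p.2‖ ^ 2 := hp.2
    exact (lt_of_pow_lt_pow_left₀ 2 (norm_nonneg _) (by nlinarith) : R < ‖p.2‖)
  have hn1 : ∫⁻ p in Sn, ENNReal.ofReal ((φ j p.2 * f p) ^ 2) ≤ Cn * (Cw * D) ^ 2 := by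
    refine (setLIntegral_sq_le Set.inter_subset_left hSnm hh (C := Cn)
      fun p hp => (hφf p).trans (hnear p hp.1 hp.2)).trans ?_
    rw [ENNReal.ofReal_coe_nnreal]
    gcongr
  have hf1 : ENNReal.ofReal (d j) * ∫⁻ p in Sf, ENNReal.ofReal ((φ j p.2 * f p) ^ 2) ≤
      Cf * (M * D ^ 2) := by
    refine le_trans ?_ (mul_le_mul_right (hT j) (Cf : ℝ≥0∞))
    rw [← lintegral_const_mul' _ _ ENNReal.ofReal_ne_top,
      ← lintegral_const_mul' _ _ ENNReal.ofReal_ne_top,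
      ← lintegral_const_mul' _ _ ENNReal.coe_ne_top, Set.inter_comm,
      ← Measure.restrict_restrict (measurableSet_annulus _),
      ← lintegral_indicator (measurableSet_annulus _)]
    refine setLIntegral_mono' hSfm fun p hp => ?_
    by_cases hj : φ j p.2 = 0
    · simp [hj]
    have hp1 : 1 ≤ ‖p.2‖ := hR.trans (le_of_lt hp.1.2)
    have hpa : p ∈ annulus n (2 ^ j) := by
      have h1 := hφ.le_norm hp1 hj
      have h2 := hφ.norm_le hj
      rw [pow_succ] at h2
      exact ⟨by linarith, by linarith⟩
    rw [Set.indicator_of_mem hpa, ← ENNReal.ofReal_coe_nnreal, ← ENNReal.ofReal_mul (hd0 j),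
      ← ENNReal.ofReal_mul (by positivity), ← ENNReal.ofReal_mul (NNReal.coe_nonneg _)]
    exact ENNReal.ofReal_le_ofReal ((mul_le_mul_of_nonneg_left (hφf p) (hd0 j)).trans
      (hfar j p ⟨hp.1, hpa⟩))
  have hle1 : ENNReal.ofReal (d j) ≤ 1 := ENNReal.ofReal_le_one.2 (hd1 j)
  set c : ℝ≥0 := Cn * Cw ^ 2 + Cf * M with hc
  calc ENNReal.ofReal (d j) * ∫⁻ p in region K, ENNReal.ofReal ((φ j p.2 * f p) ^ 2)
      ≤ ENNReal.ofReal (d j) * ((∫⁻ p in Sn, ENNReal.ofReal ((φ j p.2 * f p) ^ 2)) +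
        ∫⁻ p in Sf, ENNReal.ofReal ((φ j p.2 * f p) ^ 2)) := by gcongr
    _ ≤ Cn * (Cw * D) ^ 2 + Cf * (M * D ^ 2) := by
        rw [mul_add]
        exact add_le_add ((mul_le_of_le_one_left' hle1).trans hn1) hf1
    _ = (c : ℝ≥0∞) * D ^ 2 := by
        rw [hc]; push_cast; ring
    _ ≤ (((1 + Cn * Cw ^ 2 + Cf * M : ℝ≥0) : ℝ≥0∞) * D) ^ 2 := by
        rw [mul_pow, add_assoc, ← hc]
        refine mul_le_mul_left ?_ _
        have : c ≤ (1 + c) ^ 2 := by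
          rw [add_sq]
          nlinarith [c.coe_nonneg, sq_nonneg c, zero_le (a := c)]
        exact_mod_cast this

end Transfer

/-! ### From the weak bound to the local energy hypothesis -/

section Conclusion

variable {K : Set (Space n)} {φ : ℕ → Space n → ℝ} {g : TensorField n}
  {𝒮 : Set (Spacetime n → ℝ)} {R₀ R₁ N : ℝ} {ψ : Space n → ℝ}

/-- Outside a large ball the energy density of `∂^{≤ k} u` is bounded by the data, uniformly over
dyadic annuli. -/
theorem exists_exterior_estimate (hn : 3 ≤ n) (hK : IsClosed K) (hKR : K ⊆ Metric.ball 0 R₀)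
    (hR₁ : R₀ ≤ R₁) (hφ : IsDyadicPartition φ) (hg : IsLorentzianMetric K g)
    (hflat : IsAsymptoticallyFlat φ K g) {k : ℕ} {Cw : ℝ≥0}
    (hw : ∀ u ∈ 𝒮, ∀ F, IsSolution K g u F → weakNorm K R₁ N k u ≤ Cw * dataNorm K k u F) :
    ∃ R : ℝ, 1 ≤ R ∧ R₁ ≤ R ∧ ∃ M : ℝ≥0, ∀ u ∈ 𝒮, ∀ F, IsSolution K g u F →
      dataNorm K k u F ≠ ⊤ → ∀ j : ℕ, ENNReal.ofReal ((2 : ℝ) ^ j)⁻¹ *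
        ∫⁻ p in (exterior n R ∩ {p | 3 * R ^ 2 ≤ ‖p.2‖ ^ 2}) ∩ annulus n (2 ^ j),
          ENNReal.ofReal (totalDens K (fun a : multiIndices n k => mpd (region K) a u) p) ≤
        M * dataNorm K k u F ^ 2 := by
  obtain ⟨c, hc, hs, Ra, hRa1, hRa0, hSM, A₀, hA₀, hdev⟩ :=
    hflat.exists_symbolMetric hK hKR hφ hg k
  have hcw : Continuous fun p : Spacetime n => weight φ c p.2 :=
    (continuous_weight hφ hc hs).comp continuous_snd
  obtain ⟨A, hA, hsys⟩ := hSM.exists_exteriorSystem (fun p => weight_nonneg hc p.2)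
    hcw.measurable hA₀ hdev
  obtain ⟨δ, hδ, C, hest⟩ := ExteriorSystem.local_energy_estimate hn A hA (multiIndices n k)
  -- far out the tail of the profile is below the absorption threshold
  obtain ⟨J, hJ⟩ := ((tendsto_sum_nat_add c).eventually (gt_mem_nhds hδ)).exists
  set R : ℝ := max (max (2 ^ J) (2 * Ra)) R₁
  have hRJ : (2 : ℝ) ^ J ≤ R := (le_max_left _ _).trans (le_max_left _ _)
  have hRa : 2 * Ra ≤ R := (le_max_right _ _).trans (le_max_left _ _)
  have hRR : R₁ ≤ R := le_max_right _ _
  have hR1 : 1 ≤ R := by linarith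
  have hsub : exterior n R ⊆ region K := exterior_subset_region hKR (hR₁.trans hRR)
  obtain ⟨Cn, hCn⟩ := exists_lintegral_near_le hK hR1 hRR N k hsub
  set q : ℕ := (multiIndices n k).card * (9 * (n + 1))
  refine ⟨R, hR1, hRR, C * ((multiIndices n k).card * (q * Cw) + Cn * Cw ^ 2 + (q * Cw) ^ 2),
    fun u hu F hF hD j => ?_⟩
  set D := dataNorm K k u F with hDdef
  have hFbox : Set.EqOn (box K g u) F (region K) := hF.2
  have hW := hw u hu F hF
  have hWtop : weakNorm K R₁ N k u ≠ ⊤ :=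
    ne_top_of_le_ne_top (ENNReal.mul_ne_top ENNReal.coe_ne_top hD) hW
  have hES := hsys R (by linarith) hR1 u F hF.1 hFbox
  have h0 : normL2 K (fun x => u (0, x)) ≠ ⊤ := by
    refine ne_top_of_le_ne_top hD (le_trans ?_ (le_add_right (le_add_right le_rfl)))
    have h1 := le_sumUpTo (d := n) (k := k + 1) (fun b => normL2 K (spd b fun x => u (0, x)))
      (a := 0) (by simp)
    rwa [spd_zero] at h1
  have hB : ((q : ℝ≥0∞) * weakNorm K R₁ N k u) ≠ ⊤ :=
    ENNReal.mul_ne_top (ENNReal.natCast_ne_top q) hWtop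
  have hE := ae_lintegral_totalDens_le hn hK hRa1 hRa (exterior_subset_region hKR hRa0) hF.1 h0
    hWtop
  have hT := continuousOn_totalDens hK hR1 hsub hES.smooth
  have hX : ∫⁻ p in exterior n R, ENNReal.ofReal ((∑ i : multiIndices n k,
      |mpd (region K) i F p|) * Real.sqrt (totalDens K
        (fun a : multiIndices n k => mpd (region K) a u) p)) ≤
      ((multiIndices n k).card : ℝ≥0∞) * (D * (q * weakNorm K R₁ N k u)) := by
    have e : ∀ p : Spacetime n, ENNReal.ofReal ((∑ i : multiIndices n k,
        |mpd (region K) i F p|) * Real.sqrt (totalDens K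
          (fun a : multiIndices n k => mpd (region K) a u) p)) =
        ∑ i : multiIndices n k, ENNReal.ofReal (|mpd (region K) i F p| * Real.sqrt (totalDens K
          (fun a : multiIndices n k => mpd (region K) a u) p)) := fun p => by
      rw [Finset.sum_mul, ENNReal.ofReal_sum_of_nonneg fun _ _ =>
        mul_nonneg (abs_nonneg _) (Real.sqrt_nonneg _)]
    have hfc : ∀ i : multiIndices n k, ContinuousOn (mpd (region K) i F) (exterior n R) :=
      fun i => (hES.smooth_source i).continuousOn.mono hsub
    have hm : ∀ i : multiIndices n k, AEMeasurable (fun p => ENNReal.ofReal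
        (|mpd (region K) i F p| * Real.sqrt (totalDens K
          (fun a : multiIndices n k => mpd (region K) a u) p)))
        (volume.restrict (exterior n R)) := fun i =>
      (ExteriorSystem.aemeasurable_of_continuousOn ((hfc i).abs.mul hT.sqrt)).ennreal_ofReal
    simp only [e]
    rw [lintegral_finsetSum' _ fun i _ => hm i]
    have hFD : ∀ i : multiIndices n k, normLqL2 K 1 (mpd (region K) i F) ≤ D := fun i =>
      (le_sumUpTo (fun a => normLqL2 K 1 (mpd (region K) a F))
        (mem_multiIndices.1 i.2)).trans (le_add_left le_rfl)
    refine (Finset.sum_le_sum fun i _ => (lintegral_mul_sqrt_le hsub (hfc i) hT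
      (totalDens_nonneg _) hB hE).trans (mul_le_mul_left (hFD i) _)).trans (le_of_eq ?_)
    simp
  have habs : ∀ f : Spacetime n → ℝ≥0∞, AEMeasurable f (volume.restrict (exterior n R)) →
      ∫⁻ p in exterior n R, ENNReal.ofReal (weight φ c p.2) * f p ≤
        ENNReal.ofReal δ * ⨆ j : ℕ, ENNReal.ofReal ((2 : ℝ) ^ j)⁻¹ *
          ∫⁻ p in exterior n R ∩ annulus n (2 ^ j), f p := fun f hf =>
    (lintegral_weight_mul_le hφ hc hs hRJ hf).trans
      (mul_le_mul_left (ENNReal.ofReal_le_ofReal hJ.le) _)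
  refine (hest K R _ _ _ _ hES habs _ hE j).trans ?_
  calc _ ≤ (C : ℝ≥0∞) * (((multiIndices n k).card : ℝ≥0∞) * (D * (q * (Cw * D))) +
        Cn * (Cw * D) ^ 2 + (q * (Cw * D)) ^ 2) := by
        gcongr
        · exact hX.trans (by gcongr)
        · exact (hCn u hF.1).trans (by gcongr)
    _ = _ := by push_cast; ring

lemma IsCutoff.exists_sq_le (hψ : IsCutoff R₁ ψ) : ∃ C : ℝ≥0, ∀ x, ψ x ^ 2 ≤ C := by
  obtain ⟨B, hB⟩ := (isCompact_closedBall (0 : Space n) (R₁ + 1)).exists_bound_of_continuousOn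
    hψ.smooth.continuous.continuousOn
  refine ⟨Real.toNNReal (max (B ^ 2) 1), fun x => ?_⟩
  rw [Real.coe_toNNReal _ (by positivity)]
  by_cases hx : R₁ + 1 < ‖x‖
  · rw [hψ.eq_one x hx]; simp
  · refine le_max_of_le_left ?_
    rw [← sq_abs]
    exact pow_le_pow_left₀ (abs_nonneg _) (hB x (by simpa using hx)) 2

/-- The weak bound implies the local energy hypothesis. -/
theorem WeakLocalEnergy.localEnergy (hn : 3 ≤ n) (hK : IsClosed K)
    (hKR : K ⊆ Metric.ball 0 R₀) (hR₁ : R₀ ≤ R₁) (hφ : IsDyadicPartition φ)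
    (hg : IsLorentzianMetric K g) (hflat : IsAsymptoticallyFlat φ K g)
    (hweak : WeakLocalEnergy K g 𝒮 R₁ N) (hψ : IsCutoff R₁ ψ) : LocalEnergy φ K g 𝒮 ψ := by
  intro k
  obtain ⟨Cw, hw⟩ := hweak k
  obtain ⟨R, hR1, hRR, M, hM⟩ := exists_exterior_estimate hn hK hKR hR₁ hφ hg hflat hw
  obtain ⟨Cψ, hCψ⟩ := hψ.exists_sq_le
  obtain ⟨C₁, hC₁⟩ := exists_one_le_mul_bracket (3 * R ^ 2) (-N / 2)
  obtain ⟨C₂, hC₂⟩ := exists_one_le_mul_bracket (3 * R ^ 2) ((-N - 1) / 2)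
  obtain ⟨cs, hcs⟩ := exists_sumUpTo_le (n + 1) k
  set B₁ : ℝ≥0 := 1 + (Cψ * C₁) * Cw ^ 2 + Cψ * M with hB₁
  set B₂ : ℝ≥0 := 1 + C₂ * Cw ^ 2 + 4 * M with hB₂
  refine ⟨1 + cs * ((n + 1) * Cw + (n + 1) * B₁ + B₂), fun u hu F hF => ?_⟩
  set D := dataNorm K k u F
  by_cases hD : D = ⊤
  · rw [hD, ENNReal.mul_top]
    · exact le_top
    · exact (ENNReal.coe_pos.2 (by positivity)).ne'
  have hW := hw u hu F hF
  have hsm : ∀ a, SmoothOn K (mpd (region K) a u) := fun a => SmoothOn.mpd hK hF.1 a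
  have hmeas : ∀ {v : Spacetime n → ℝ}, SmoothOn K v →
      AEMeasurable v (volume.restrict (region K)) := fun hv =>
    hv.continuousOn.aemeasurable (measurableSet_region hK)
  have hest := hM u hu F hF hD
  have hinv : ∀ j : ℕ, ((2 : ℝ) ^ j)⁻¹ ≤ 1 := fun j =>
    inv_le_one_of_one_le₀ (one_le_pow₀ one_le_two)
  refine (hcs _ (((n + 1) * Cw + (n + 1) * B₁ + B₂ : ℝ≥0) * D) fun a ha => ?_).trans ?_
  · set T := totalDens K (fun a : multiIndices n k => mpd (region K) a u) with hT
    have hTle : ∀ p, dens K (mpd (region K) a u) p ≤ T p := fun p =>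
      dens_le_totalDens (fun a : multiIndices n k => mpd (region K) a u) p
        ⟨a, mem_multiIndices.2 ha⟩
    have hdir : ∀ α, normEllInfL2 φ K (-1 / 2)
        (fun p => ψ p.2 * pd (region K) α (mpd (region K) a u) p) ≤ B₁ * D := by
      intro α
      rw [hB₁]
      refine (normEllInfL2_le_of_near_far hφ hK hR1 (Cn := Cψ * C₁) (Cf := Cψ)
        (f := fun p => ψ p.2 * pd (region K) α (mpd (region K) a u) p) dyad_neg_half_sq
        (fun j => by positivity) hinv
        (((hψ.smooth.continuous.comp continuous_snd).measurable.aemeasurable).mul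
          (hmeas ((hsm a).pd hK α)))
        (aemeasurable_weightedPd (R₁ := R₁) (N := N) hK α (hsm a)) (fun p hp hpr => ?_)
        (fun j p hp => ?_) hest ((normLqL2_weightedPd_le_weakNorm ha α).trans hW))
      · rw [mul_pow, NNReal.coe_mul, mul_assoc]
        by_cases h0 : ψ p.2 = 0
        · rw [h0]; simp only [ne_eq, OfNat.ofNat_ne_zero, not_false_eq_true, zero_pow, zero_mul]
          positivity
        have hmem : p ∈ {p : Spacetime n | R₁ ≤ ‖p.2‖} :=
          le_of_not_gt fun h => h0 (hψ.eq_zero _ h)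
        refine mul_le_mul (hCψ _) ?_ (sq_nonneg _) Cψ.coe_nonneg
        rw [weightedPd, Set.indicator_of_mem hmem, mul_pow, ← mul_assoc]
        exact le_mul_of_one_le_left (sq_nonneg _) (hC₁ _ hpr)
      · have h1 : pd (region K) α (mpd (region K) a u) p ^ 2 ≤ T p := by
          rw [← sq_abs, ← Real.sq_sqrt ((dens_nonneg _ _).trans (hTle p))]
          exact pow_le_pow_left₀ (abs_nonneg _) ((abs_pd_le_sqrt_dens _ _ _).trans
            (Real.sqrt_le_sqrt (hTle p))) 2
        calc ((2 : ℝ) ^ j)⁻¹ * (ψ p.2 * pd (region K) α (mpd (region K) a u) p) ^ 2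
            = ψ p.2 ^ 2 * (((2 : ℝ) ^ j)⁻¹ * pd (region K) α (mpd (region K) a u) p ^ 2) := by
              ring
          _ ≤ Cψ * (((2 : ℝ) ^ j)⁻¹ * T p) := by
              gcongr
              exact hCψ _
    have hzero : normEllInfL2 φ K (-3 / 2) (mpd (region K) a u) ≤ B₂ * D := by
      rw [hB₂]
      refine normEllInfL2_le_of_near_far hφ hK hR1 (Cn := C₂) (Cf := 4) dyad_neg_three_half_sq
        (fun j => by positivity) (fun j => pow_le_one₀ (by positivity) (hinv j))
        (hmeas (hsm a)) (aemeasurable_weighted hK ((-N - 1) / 2) (hsm a)) (fun p hp hpr => ?_)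
        (fun j p hp => ?_) hest ((normLqL2_weighted_le_weakNorm ha).trans hW)
      · rw [mul_pow, ← mul_assoc]
        exact le_mul_of_one_le_left (sq_nonneg _) (hC₂ _ hpr)
      · have hr : 0 < ‖p.2‖ := norm_pos_of_mem_exterior hR1 hp.1
        have h1 : mpd (region K) a u p ^ 2 / ‖p.2‖ ^ 2 ≤ T p :=
          (le_add_of_nonneg_left (Finset.sum_nonneg fun _ _ => sq_nonneg _)).trans (hTle p)
        rw [div_le_iff₀ (by positivity)] at h1
        have h2 : ‖p.2‖ ^ 2 ≤ (2 * 2 ^ j) ^ 2 := pow_le_pow_left₀ hr.le hp.2.2 2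
        have hT0 : 0 ≤ T p := (dens_nonneg _ _).trans (hTle p)
        calc ((2 : ℝ) ^ j)⁻¹ ^ 3 * mpd (region K) a u p ^ 2
            ≤ ((2 : ℝ) ^ j)⁻¹ ^ 3 * (T p * (2 * 2 ^ j) ^ 2) := by
              gcongr
              exact h1.trans (mul_le_mul_of_nonneg_left h2 hT0)
          _ = ((4 : ℝ≥0) : ℝ) * (((2 : ℝ) ^ j)⁻¹ * T p) := by
              push_cast
              field_simp
              ring
    rw [normLE]
    calc _ ≤ ∑ _α : Fin (n + 1), (Cw : ℝ≥0∞) * D + ∑ _α : Fin (n + 1), (B₁ : ℝ≥0∞) * D +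
          B₂ * D := by
          refine add_le_add (add_le_add (Finset.sum_le_sum fun α _ => ?_)
            (Finset.sum_le_sum fun α _ => hdir α)) hzero
          exact (normLqL2_top_pd_le_weakNorm ha α).trans hW
      _ = _ := by
          simp only [Finset.sum_const, Finset.card_univ, Fintype.card_fin, nsmul_eq_mul]
          push_cast
          ring
  · rw [← mul_assoc, ← ENNReal.coe_mul]
    gcongr
    exact le_add_of_nonneg_left zero_le_one

end Conclusion

end

end AFWave

/-- On an asymptotically flat space-time, the weak local energy bound with polynomial weights
implies the local energy hypothesis. `𝒮` is the class of admissible functions: all functions, or,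
for an exterior domain, the functions with a prescribed boundary condition. -/
theorem mainTheorem8 (n : ℕ) (hn : 3 ≤ n)
    (K : Set (Space n)) (hK : IsCompact K) (R₀ : ℝ) (hR₀ : 0 ≤ R₀) (hKR : K ⊆ Metric.ball 0 R₀)
    (φ : ℕ → Space n → ℝ) (hφ : IsDyadicPartition φ)
    (g : TensorField n) (hg : IsLorentzianMetric K g) (hflat : IsAsymptoticallyFlat φ K g)
    (𝒮 : Set (Spacetime n → ℝ))
    (R₁ : ℝ) (hR₁ : R₀ ≤ R₁) (N : ℝ) (hweak : WeakLocalEnergy K g 𝒮 R₁ N)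
    (ψ : Space n → ℝ) (hψ : IsCutoff R₁ ψ) :
    LocalEnergy φ K g 𝒮 ψ :=
  hweak.localEnergy hn hK.isClosed hKR hR₁ hφ hg hflat hψ
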